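/- Fix constants $m_\alpha,T_\alpha,\nu_\alpha>0$ ($\alpha=i,e$), $c>0$, $e>0$, and put $q_i=e$, $q_e=-e$. Consider on $\mathbb{R}^3$ the linearized two-fluid Euler–Maxwell system for $U=[\rho_\alpha,u_\alpha,E,B]$: $$\partial_t\rho_\alpha+\nabla\cdot u_\alpha=0,\qquad m_\alpha\partial_t u_\alpha+T_\alpha\nabla\rho_\alpha-q_\alpha E+m_\alpha\nu_\alpha u_\alpha=0,$$ $$\partial_tE-c\nabla\times B+4\pi\sum_{\alpha=i,e}q_\alpha u_\alpha=0,\qquad \partial_tB+c\nabla\times E=0,$$ $$\nabla\cdot E=4\pi\sum_{\alpha=i,e}q_\alpha\rho_\alpha,\qquad \nabla\cdot B=0.$$ For $\ell\ge0$ and $1\le r\le2\le q\le\infty$ let $[\ell+3(\frac1r-\frac1q)]_+$ be $\ell$ if $\ell$ is an integer and $r=q=2$, and the integer part of $\ell+3(\frac1r-\frac1q)$ plus one otherwise ($[3(\frac1r-\frac1q)]_+$ is the case $\ell=0$). There is $\lambda>0$ such that for all $1\le p,r\le2\le q\le\infty$, all real $\ell\ge0$ and all integers $m\ge1$ there is $C=C(m,p,r,q,\ell)>0$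 with the following property. Let $N_0=[\nabla\cdot f_{\alpha0},\,g_{2\alpha},\,g_3,\,0]$ be initial data satisfying the compatibility condition $\nabla\cdot g_3=4\pi\sum_\alpha q_\alpha\nabla\cdot f_{\alpha0}$, and let $U(t)=[\rho_\alpha,u_\alpha,E,B](t)=e^{tL}N_0$ be the solution (in $C([0,\infty);L^2)$, in the sense of distributions) of the system with $U(0)=N_0$. Then for all $t\ge0$ and $\alpha=i,e$, $$\begin{aligned}\|\nabla^m\rho_\alpha(t)\|_{L^q}\le{}& C(1+t)^{-\frac32(\frac1p-\frac1q)-\frac{m+1}2}\|N_0\|_{L^p}+Ce^{-\lambda t}\|N_0\|_{L^p}+C(1+t)^{-\frac\ell2}\|\nabla^{m+[\ell+3(\frac1r-\frac1q)]_+}N_0\|_{L^r}\\&+Ce^{-\lambda t}\|\nabla^{m+1+[3(\frac1r-\frac1q)]_+}[f_{i0},f_{e0}]\|_{L^r}+C(1+t)^{-\frac32(\frac1p-\frac1q)-\frac{m+1}2}\|[f_{i0},f_{e0}]\|_{L^p},\end{aligned}$$ each of $\|\nabla^mu_\alpha(t)\|_{L^q}$ and $\|\nabla^mE(t)\|_{L^q}$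 is at most $$\begin{aligned}& C(1+t)^{-\frac32(\frac1p-\frac1q)-\frac{m+2}2}\|N_0\|_{L^p}+Ce^{-\lambda t}\|N_0\|_{L^p}+C(1+t)^{-\frac\ell2}\|\nabla^{m+[\ell+3(\frac1r-\frac1q)]_+}N_0\|_{L^r}\\&+Ce^{-\lambda t}\|\nabla^{m+2+[3(\frac1r-\frac1q)]_+}[f_{i0},f_{e0}]\|_{L^r}+C(1+t)^{-\frac32(\frac1p-\frac1q)-\frac{m+2}2}\|[f_{i0},f_{e0}]\|_{L^p},\end{aligned}$$ and $$\|\nabla^mB(t)\|_{L^q}\le C(1+t)^{-\frac32(\frac1p-\frac1q)-\frac{m+1}2}\|N_0\|_{L^p}+Ce^{-\lambda t}\|N_0\|_{L^p}+C(1+t)^{-\frac\ell2}\|\nabla^{m+[\ell+3(\frac1r-\frac1q)]_+}N_0\|_{L^r}.$$ Here $C$ and $\lambda$ may also depend on the physical constants, but not on $t$ or on the data; derivatives are distributional, and a norm is $+\infty$ when the distribution is not a function in the Lebesgue space concerned. -/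

import Mathlib

open MeasureTheory SchwartzMap LineDeriv
open scoped ENNReal

namespace EulerMaxwell

/-! ### Tempered distributions on three-dimensional space, vector calculus, Lebesgue norms -/

/-- Physical space. -/
abbrev Space : Type := EuclideanSpace ℝ (Fin 3)

/-- Complex-valued tempered distributions on physical space. -/
abbrev Dist : Type := 𝓢'(Space, ℂ)

/-- The `j`-th vector of the standard basis. -/
noncomputable def basisVec (j : Fin 3) : Space := EuclideanSpace.single j 1

/-- The gradient of a scalar distribution. -/
noncomputable def grad (T : Dist) : Fin 3 → Dist := fun j => ∂_{basisVec j} T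

/-- The divergence of a vector distribution. -/
noncomputable def div (F : Fin 3 → Dist) : Dist := ∑ j, ∂_{basisVec j} (F j)

/-- The curl of a vector distribution. -/
noncomputable def curl (F : Fin 3 → Dist) : Fin 3 → Dist :=
  ![∂_{basisVec 1} (F 2) - ∂_{basisVec 2} (F 1),
    ∂_{basisVec 2} (F 0) - ∂_{basisVec 0} (F 2),
    ∂_{basisVec 0} (F 1) - ∂_{basisVec 1} (F 0)]

/-- The array `∇^M F` of all partial derivatives of order `M` of all components of `F`. -/
noncomputable def nablaPow {ι : Type} (M : ℕ) (F : ι → Dist) : ι × (Fin M → Fin 3) → Dist :=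
  fun a => ∂^{fun j => basisVec (a.2 j)} (F a.1)

/-- The family of distributions `F` is given by the family of `L^q` functions `g`. -/
def IsRepresentedBy {ι : Type} (F : ι → Dist) (q : ℝ≥0∞) (g : ι → Space → ℂ) : Prop :=
  ∀ a, MemLp (g a) q volume ∧ ∀ φ : 𝓢(Space, ℂ), F a φ = ∫ x, φ x * g a x

/-- The `L^q` norm of a finite family of tempered distributions (the `L^q` norm of the pointwise
Euclidean length). It is `⊤` unless all members of the family are `L^q` functions; if they are, the
representing functions are unique almost everywhere, so that the infimum is over a single value. -/
noncomputable def lpNorm {ι : Type} [Fintype ι] (q : ℝ≥0∞) (F : ι → Dist) : ℝ≥0∞ :=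
  ⨅ (g : ι → Space → ℂ) (_ : IsRepresentedBy F q g),
    eLpNorm (fun x => (WithLp.toLp 2 (fun a => g a x) : EuclideanSpace ℂ ι)) q volume

/-! ### The linearized two-fluid Euler-Maxwell system with collisions -/

/-- The two species: ions and electrons. -/
inductive Species : Type
  | ion
  | electron
  deriving DecidableEq

instance : Fintype Species := ⟨{Species.ion, Species.electron}, fun α => by cases α <;> decide⟩

/-- The physical constants of the system. -/
structure Params where
  /-- masses -/
  mass : Species → ℝ
  /-- temperatures -/
  temp : Species → ℝ
  /-- collision frequencies -/
  nu : Species → ℝ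
  /-- the speed of light -/
  c : ℝ
  /-- the elementary charge -/
  e : ℝ
  mass_pos : ∀ α, 0 < mass α
  temp_pos : ∀ α, 0 < temp α
  nu_pos : ∀ α, 0 < nu α
  c_pos : 0 < c
  e_pos : 0 < e

/-- The charge of a species: `e` for ions and `-e` for electrons. -/
def Params.charge (P : Params) : Species → ℝ
  | Species.ion => P.e
  | Species.electron => -P.e

/-- The unknown `[ρ_α, u_α, E, B]`. -/
structure State where
  /-- density perturbations -/
  rho : Species → Dist
  /-- velocities -/
  u : Species → Fin 3 → Dist
  /-- electric field -/
  E : Fin 3 → Dist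
  /-- magnetic field -/
  B : Fin 3 → Dist

/-- Index set of the fourteen scalar components of a state. -/
abbrev Component : Type := Species ⊕ (Species × Fin 3) ⊕ Fin 3 ⊕ Fin 3

/-- The fourteen scalar components of a state, as one family. -/
def State.comp (U : State) : Component → Dist
  | Sum.inl α => U.rho α
  | Sum.inr (Sum.inl a) => U.u a.1 a.2
  | Sum.inr (Sum.inr (Sum.inl j)) => U.E j
  | Sum.inr (Sum.inr (Sum.inr j)) => U.B j

/-- The constraints `∇·E = 4π ∑_α q_α ρ_α` and `∇·B = 0`. -/
def Compatible (P : Params) (U : State) : Prop :=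
  div U.E = (4 * Real.pi : ℂ) • ∑ α, (P.charge α : ℂ) • U.rho α ∧ div U.B = 0

/-- `∂_t F = G` at time `t`, in the sense of distributions in space. -/
def HasTimeDeriv (F : ℝ → Dist) (G : Dist) (t : ℝ) : Prop :=
  ∀ φ : 𝓢(Space, ℂ), HasDerivAt (fun s => F s φ) (G φ) t

/-- `U(t) = e^{tL} U₀` for `t ≥ 0`: `U` belongs to `C([0,∞); L²)`, satisfies the linearized system
in the sense of distributions, and `U(0) = U₀`. -/
structure IsLinearSolution (P : Params) (U₀ : State) (U : ℝ → State) : Prop where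
  continuous_L2 : ∃ V : Component → ℝ → Lp ℂ 2 (volume : Measure Space),
    ∀ a, ContinuousOn (V a) (Set.Ici 0) ∧
      ∀ t, 0 ≤ t → (U t).comp a = Lp.toTemperedDistribution (V a t)
  initial : U 0 = U₀
  mass_eq : ∀ t, 0 < t → ∀ α,
    HasTimeDeriv (fun s => (U s).rho α) (-div ((U t).u α)) t
  momentum_eq : ∀ t, 0 < t → ∀ α j,
    HasTimeDeriv (fun s => (P.mass α : ℂ) • (U s).u α j)
      (-((P.temp α : ℂ) • grad ((U t).rho α) j) + (P.charge α : ℂ) • (U t).E j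
        - (P.mass α * P.nu α : ℂ) • (U t).u α j) t
  ampere_eq : ∀ t, 0 < t → ∀ j,
    HasTimeDeriv (fun s => (U s).E j)
      ((P.c : ℂ) • curl (U t).B j - (4 * Real.pi : ℂ) • ∑ α, (P.charge α : ℂ) • (U t).u α j) t
  faraday_eq : ∀ t, 0 < t → ∀ j,
    HasTimeDeriv (fun s => (U s).B j) (-((P.c : ℂ) • curl (U t).E j)) t
  constraints : ∀ t, 0 < t → Compatible P (U t)

/-- The special data `[∇·f_α, g_{2α}, g_3, 0]`. -/
noncomputable def specialData (f g₂ : Species → Fin 3 → Dist) (g₃ : Fin 3 → Dist) : State where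
  rho := fun α => div (f α)
  u := g₂
  E := g₃
  B := 0

/-! ### Rates -/

open Classical in
/-- The index `[ℓ + 3(1/r - 1/q)]_+`: equal to `ℓ` if `ℓ` is an integer and `r = q = 2`, and to the
integer part of `ℓ + 3(1/r - 1/q)` plus one otherwise. -/
noncomputable def regIndex (ℓ : ℝ) (r q : ℝ≥0∞) : ℕ :=
  if (∃ n : ℕ, ℓ = n) ∧ r = 2 ∧ q = 2 then ⌊ℓ⌋₊
  else ⌊ℓ + 3 * ((r⁻¹).toReal - (q⁻¹).toReal)⌋₊ + 1

/-- The rate `(1+t)^{-(3/2)(1/p - 1/q) - k/2}`. -/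
noncomputable def polyRate (p q : ℝ≥0∞) (k : ℕ) (t : ℝ) : ℝ≥0∞ :=
  ENNReal.ofReal ((1 + t) ^ (-(3 / 2 : ℝ) * ((p⁻¹).toReal - (q⁻¹).toReal) - (k : ℝ) / 2))

/-- The rate `(1+t)^{-ℓ/2}`. -/
noncomputable def regLossRate (ℓ t : ℝ) : ℝ≥0∞ := ENNReal.ofReal ((1 + t) ^ (-ℓ / 2))

/-- The rate `exp(-λ t)`. -/
noncomputable def expRate (lam t : ℝ) : ℝ≥0∞ := ENNReal.ofReal (Real.exp (-lam * t))

end EulerMaxwell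

namespace EulerMaxwell

/-! ### Decay of the Fourier modes: real systems -/

/-! At each frequency the Fourier transform turns the system into the linear ODE `v' = symbol P k
v`. A solution is only continuous in time with values in L² and satisfies the equations weakly, so
`hat_eq_exp` is needed to show that its transform is, for almost every frequency, the exponential of
the symbol applied to the transform of the data. What remains is the decay of single modes at ξ =
κω, |ω| = 1, and the passage back to Lebesgue norms.

Gauss's law and ∇·B = 0 propagate, so a mode splits into a longitudinal system for (iρ_α, ω·u_α,
ω·E) and a transverse system for (ω×u_α, ω×E, iB), both with real coefficients. For small κ each
system is a block (velocities, electric field), damped at a rate independent of κ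
(`fastForm_lyapunov`) and coupled at order κ to one slow scalar. The transverse scalar is the
magnetic field, corrected at order κ; it obeys magnetic diffusion. The longitudinal scalar is the
friction-weighted total density, corrected by κ times the total momentum; it obeys ambipolar
diffusion. By `slow_fast_decay`, a slow scalar that starts with size κ stays of size κ exp(-λκ²t),
and the block, which it forces with one more factor κ, is of size κ² exp(-λκ²t) + exp(-λt). The
special data provide this initial size: B vanishes, and ρ = ∇·f has transform of size κ|f̂|. Hence ρ
and B gain one power of κ while u and E gain two, and the L^p norm of f enters all bounds except the
one for B. For large κ the longitudinal modes decay at a uniform exponential rate, the transverse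
ones only like exp(-λt/κ²); this is at most Cκ^ℓ(1+t)^(-ℓ/2), which trades ℓ derivatives for decay.

For the Lebesgue norms, Hausdorff–Young is replaced by Gaussian-weighted bounds: the transform h of
F ∈ L^p, 1 ≤ p ≤ 2, satisfies ‖exp(-a|k|²)h‖₂ ≤ C a^(-(3/2)(1/p-1/2))‖F‖_p for every a > 0
(`exists_hasFourier`). An L^q norm is computed by pairing with Schwartz functions measured in the
dual norm (`eLpNorm_le_of_forall_schwartz`), and the data and the test function both obey such
bounds. At low frequency exp(-λκ²t) supplies two Gaussians with a ~ 1+t, and Cauchy–Schwarz yields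
(1+t)^(-(3/2)(1/p-1/q)), each power of κ giving a further (1+t)^(-1/2). At high frequency a dyadic
sum of Gaussian bounds shows that the weight κ^(-s) maps transforms of L^p functions into L² once s
> 3(1/p-1/2) (`exists_high_weight_bound`); the integer part plus one in `regIndex` leaves room for
this strict inequality.

The terms with exp(-λt) and derivatives of f are not needed: the estimate holds without them. -/

lemma le_mul_exp_of_deriv_le {f f' : ℝ → ℝ} {a : ℝ} (hf : ∀ t, HasDerivAt f (f' t) t)
    (h : ∀ t, f' t ≤ -a * f t) {t : ℝ} (ht : 0 ≤ t) : f t ≤ f 0 * Real.exp (-a * t) := by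
  have hg : ∀ t, HasDerivAt (fun s => f s * Real.exp (a * s))
      (f' t * Real.exp (a * t) + f t * (Real.exp (a * t) * a)) t := by
    intro t
    have h1 : HasDerivAt (fun s : ℝ => a * s) a t := by
      simpa using (hasDerivAt_id t).const_mul a
    exact (hf t).mul h1.exp
  have hanti : Antitone (fun s => f s * Real.exp (a * s)) := by
    refine antitone_of_deriv_nonpos (fun t => (hg t).differentiableAt) fun t => ?_
    rw [(hg t).deriv]
    have := mul_nonneg (sub_nonneg.2 (h t)) (Real.exp_pos (a * t)).le
    nlinarith
  have h2 : f t * Real.exp (a * t) ≤ f 0 := by simpa using hanti ht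
  calc f t = (f t * Real.exp (a * t)) * Real.exp (-a * t) := by
        rw [mul_assoc, ← Real.exp_add]; simp
    _ ≤ _ := by gcongr

set_option maxHeartbeats 1600000 in
/-- Decay for a slow scalar mode `s` coupled to an exponentially stable block with Lyapunov
function `Q`, at low frequency `κ`. -/
lemma slow_fast_decay {μ γ C : ℝ} (hμ : 0 < μ) (hγ : 0 < γ) (hC : 0 < C) :
    ∃ r > 0, ∃ K > 0, ∀ κ, 0 < κ → κ ≤ r → ∀ s Q Z s' Q' : ℝ → ℝ,
      (∀ t, HasDerivAt s (s' t) t) → (∀ t, HasDerivAt Q (Q' t) t) → (∀ t, 0 ≤ Z t) →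
      (∀ t, Z t ^ 2 ≤ C * Q t) → Q 0 ≤ C * Z 0 ^ 2 →
      (∀ t, |s' t + γ * κ ^ 2 * s t| ≤ C * κ ^ 3 * Z t) →
      (∀ t, Q' t ≤ -2 * μ * Q t + C * κ * Z t * (|s t| + κ * Z t)) →
      ∀ D D₀, 0 ≤ D → Z 0 ≤ D₀ → |s 0| ≤ κ * D → ∀ t, 0 ≤ t →
        |s t| ≤ K * κ * (D + D₀) * Real.exp (-(γ / 2) * κ ^ 2 * t) ∧
        Z t ≤ K * (D₀ * Real.exp (-(μ / 2) * t) +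
          κ ^ 2 * (D + D₀) * Real.exp (-(γ / 2) * κ ^ 2 * t)) := by
  -- The single condition κ²G ≤ μ/2 makes the slow rate γκ² at most μ/2 and lets the damping of `Q`
  -- absorb every `Z²` term left by the coupling and by Young's inequality.
  set G : ℝ := C * (9 * C ^ 2 / (4 * γ) + C) + γ with hG
  have hGpos : 0 < G := by positivity
  refine ⟨√(μ / (2 * G)), by positivity, (1 + C) + C ^ 2 / μ * (1 + C), by positivity, ?_⟩
  intro κ hκ hκr s Q Z s' Q' hs hQ hZ0 hZQ hQ0 hs' hQ' D D₀ hD hD₀ hs0 t ht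
  have hκ2 : κ ^ 2 * G ≤ μ / 2 := by
    have h1 : κ ^ 2 ≤ μ / (2 * G) := by
      rw [← Real.sq_sqrt (show 0 ≤ μ / (2 * G) by positivity)]
      gcongr
    calc κ ^ 2 * G ≤ μ / (2 * G) * G := by gcongr
      _ = μ / 2 := by field_simp
  have hκγ : γ * κ ^ 2 ≤ μ / 2 := by
    refine le_trans ?_ hκ2
    rw [hG, mul_comm]; gcongr
    have : 0 ≤ C * (9 * C ^ 2 / (4 * γ) + C) := by positivity
    linarith
  have hκG : κ ^ 2 * (C * (9 * C ^ 2 / (4 * γ) + C)) ≤ μ / 2 := by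
    refine le_trans ?_ hκ2
    rw [hG]; gcongr; linarith
  have hκC : κ ^ 2 * C ^ 2 ≤ μ / 2 := by
    refine le_trans ?_ hκG
    gcongr
    have : 0 ≤ C * (9 * C ^ 2 / (4 * γ)) := by positivity
    nlinarith
  have hQnn : ∀ t, 0 ≤ Q t := fun t => by
    have := hZQ t
    by_contra hcon
    nlinarith [sq_nonneg (Z t)]
  set M : ℝ := D ^ 2 + C * D₀ ^ 2 with hM
  have hD₀' : 0 ≤ D₀ := (hZ0 0).trans hD₀
  -- the combined functional
  have hA : ∀ t, 0 ≤ t → s t ^ 2 + κ ^ 2 * Q t ≤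
      κ ^ 2 * M * Real.exp (-(γ * κ ^ 2) * t) := by
    intro t ht
    have hder : ∀ t, HasDerivAt (fun t => s t ^ 2 + κ ^ 2 * Q t)
        (2 * s t * s' t + κ ^ 2 * Q' t) t := fun t =>
      (((hs t).fun_pow 2).fun_add ((hQ t).const_mul (κ ^ 2))).congr_deriv (by simp)
    have hle := le_mul_exp_of_deriv_le (a := γ * κ ^ 2) hder (fun t => ?_) ht
    · refine hle.trans ?_
      gcongr
      have h1 : s 0 ^ 2 ≤ (κ * D) ^ 2 := sq_le_sq' (by linarith [abs_le.1 hs0]) (abs_le.1 hs0).2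
      have h2 : Z 0 ^ 2 ≤ D₀ ^ 2 := by gcongr; exact hZ0 0
      have h3 : Q 0 ≤ C * D₀ ^ 2 := hQ0.trans (by gcongr)
      have h4 : κ ^ 2 * Q 0 ≤ κ ^ 2 * (C * D₀ ^ 2) := by gcongr
      rw [hM]; linarith
    · have e1 : 2 * s t * s' t ≤ -2 * γ * κ ^ 2 * s t ^ 2 + 2 * |s t| * (C * κ ^ 3 * Z t) := by
        have : s t * (s' t + γ * κ ^ 2 * s t) ≤ |s t| * (C * κ ^ 3 * Z t) :=
          (le_abs_self _).trans (by rw [abs_mul]; gcongr; exact hs' t)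
        linarith
      have e2 := mul_le_mul_of_nonneg_left (hQ' t) (sq_nonneg κ)
      -- Two of the three cross terms come from `2 s s'`, the third from `κ² Q'`. Young's inequality
      -- spends half of the slow damping 2γκ²s² on them; the other half is the decay rate obtained.
      have e3 : 3 * C * κ * |s t| * Z t ≤
          γ * s t ^ 2 + 9 * C ^ 2 / (4 * γ) * (κ ^ 2 * Z t ^ 2) := by
        have h0 := sq_nonneg (2 * γ * |s t| - 3 * C * κ * Z t)
        have : 9 * C ^ 2 / (4 * γ) * (κ ^ 2 * Z t ^ 2) =
            9 * C ^ 2 * κ ^ 2 * Z t ^ 2 / (4 * γ) := by ring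
        rw [this, ← sub_le_iff_le_add', le_div_iff₀ (by positivity), ← sq_abs (s t)]
        linarith
      have e3' := mul_le_mul_of_nonneg_left e3 (sq_nonneg κ)
      have e4 : κ ^ 4 * (9 * C ^ 2 / (4 * γ) + C) * Z t ^ 2 ≤ κ ^ 2 * (μ / 2) * Q t := by
        calc κ ^ 4 * (9 * C ^ 2 / (4 * γ) + C) * Z t ^ 2
            ≤ κ ^ 4 * (9 * C ^ 2 / (4 * γ) + C) * (C * Q t) := by gcongr; exact hZQ t
          _ = κ ^ 2 * (κ ^ 2 * (C * (9 * C ^ 2 / (4 * γ) + C))) * Q t := by ring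
          _ ≤ _ := by gcongr; exact hQnn t
      have e5 : γ * κ ^ 2 * (κ ^ 2 * Q t) ≤ μ / 2 * (κ ^ 2 * Q t) := by
        have := hQnn t
        gcongr
      have e6 : 0 ≤ μ * (κ ^ 2 * Q t) := by have := hQnn t; positivity
      linarith
  have hE (x : ℝ) : Real.exp (-(x / 2) * t) ^ 2 = Real.exp (-x * t) := by
    rw [← Real.exp_nat_mul]; congr 1; push_cast; ring
  have hE' : Real.exp (-(γ / 2) * κ ^ 2 * t) ^ 2 = Real.exp (-(γ * κ ^ 2) * t) := by
    rw [← Real.exp_nat_mul]; congr 1; push_cast; ring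
  have hMle : M ≤ (1 + C) * (D + D₀) ^ 2 := by
    rw [hM]
    nlinarith [mul_nonneg hD hD₀', mul_nonneg hC.le (mul_nonneg hD hD₀'), sq_nonneg D,
      sq_nonneg D₀, mul_nonneg hC.le (sq_nonneg D)]
  have hMnn : 0 ≤ M := by positivity
  constructor
  · refine abs_le_of_sq_le_sq ?_ (by positivity)
    have h1 := hA t ht
    have h2 : 0 ≤ κ ^ 2 * Q t := by have := hQnn t; positivity
    calc s t ^ 2 ≤ κ ^ 2 * M * Real.exp (-(γ * κ ^ 2) * t) := by linarith
      _ ≤ κ ^ 2 * ((1 + C) * (D + D₀) ^ 2) * Real.exp (-(γ * κ ^ 2) * t) := by gcongr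
      _ ≤ κ ^ 2 * (((1 + C) + C ^ 2 / μ * (1 + C)) ^ 2 * (D + D₀) ^ 2) *
          Real.exp (-(γ * κ ^ 2) * t) := by
        gcongr
        have h3 : 0 ≤ C ^ 2 / μ * (1 + C) := by positivity
        nlinarith
      _ = _ := by rw [← hE']; ring
  -- `B exp(-γκ²t)` is a supersolution for `Q`: inserting the bound just found for `s` makes the
  -- forcing (μ/2)B exp(-γκ²t), and since γκ² ≤ μ/2 the damping μB exp(-γκ²t) covers forcing and
  -- time derivative together. Hence `(Q - B exp(-γκ²t)) exp(μt)` is nonincreasing. The factor κ⁴ in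
  -- `B` is the κ² gained by `Z`.
  · set B : ℝ := C ^ 3 / μ ^ 2 * κ ^ 4 * M with hB
    have hBnn : 0 ≤ B := by positivity
    -- decay of the Lyapunov function, for all times `≥ 0`
    have hQt : Q t ≤ B * Real.exp (-(γ * κ ^ 2) * t) + C * D₀ ^ 2 * Real.exp (-μ * t) := by
      have hexp : ∀ t, HasDerivAt (fun t => Real.exp (-(γ * κ ^ 2) * t))
          (Real.exp (-(γ * κ ^ 2) * t) * (-(γ * κ ^ 2))) t := fun t => by
        have h1 : HasDerivAt (fun s : ℝ => -(γ * κ ^ 2) * s) (-(γ * κ ^ 2)) t := by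
          simpa using (hasDerivAt_id t).const_mul (-(γ * κ ^ 2))
        exact h1.exp
      set F : ℝ → ℝ := fun t =>
        (Q t - B * Real.exp (-(γ * κ ^ 2) * t)) * Real.exp (μ * t) with hF
      have hFd : ∀ t, HasDerivAt F
          ((Q' t - B * (Real.exp (-(γ * κ ^ 2) * t) * (-(γ * κ ^ 2)))) * Real.exp (μ * t) +
            (Q t - B * Real.exp (-(γ * κ ^ 2) * t)) * (Real.exp (μ * t) * μ)) t := fun t => by
        have h1 : HasDerivAt (fun s : ℝ => μ * s) μ t := by
          simpa using (hasDerivAt_id t).const_mul μ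
        exact ((hQ t).sub ((hexp t).const_mul B)).mul h1.exp
      have hanti : AntitoneOn F (Set.Ici 0) := by
        refine antitoneOn_of_deriv_nonpos (convex_Ici 0)
          (fun t _ => (hFd t).continuousAt.continuousWithinAt)
          (fun t _ => (hFd t).differentiableAt.differentiableWithinAt) fun t htt => ?_
        rw [interior_Ici] at htt
        have htt : 0 ≤ t := le_of_lt htt
        rw [(hFd t).deriv]
        set X := Real.exp (-(γ * κ ^ 2) * t) with hX
        have hXp : 0 < X := Real.exp_pos _
        have key : Q' t ≤ -μ * Q t + μ / 2 * B * X := by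
          have a1 : C * κ * Z t * |s t| ≤
              μ / 2 * Q t + C ^ 3 / (2 * μ) * (κ ^ 2 * s t ^ 2) := by
            have h0 := sq_nonneg (μ * Z t - C ^ 2 * κ * |s t|)
            have h1 : C * κ * Z t * |s t| ≤
                μ / (2 * C) * Z t ^ 2 + C ^ 3 / (2 * μ) * (κ ^ 2 * s t ^ 2) := by
              rw [← sq_abs (s t)]
              have : μ / (2 * C) * Z t ^ 2 + C ^ 3 / (2 * μ) * (κ ^ 2 * |s t| ^ 2) -
                C * κ * Z t * |s t| = (μ * Z t - C ^ 2 * κ * |s t|) ^ 2 / (2 * μ * C) := by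
                field_simp; ring
              have : 0 ≤ (μ * Z t - C ^ 2 * κ * |s t|) ^ 2 / (2 * μ * C) := by positivity
              linarith
            have h2 : μ / (2 * C) * Z t ^ 2 ≤ μ / (2 * C) * (C * Q t) := by
              gcongr; exact hZQ t
            have h3 : μ / (2 * C) * (C * Q t) = μ / 2 * Q t := by field_simp
            linarith
          have a2 : C * κ * Z t * (κ * Z t) ≤ μ / 2 * Q t := by
            calc C * κ * Z t * (κ * Z t) = κ ^ 2 * C * Z t ^ 2 := by ring
              _ ≤ κ ^ 2 * C * (C * Q t) := by gcongr; exact hZQ t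
              _ = κ ^ 2 * C ^ 2 * Q t := by ring
              _ ≤ _ := by gcongr; exact hQnn t
          have a3 : s t ^ 2 ≤ κ ^ 2 * M * X := by
            have h1 := hA t htt
            have h2 : 0 ≤ κ ^ 2 * Q t := by have := hQnn t; positivity
            linarith
          have a4 : C ^ 3 / (2 * μ) * (κ ^ 2 * s t ^ 2) ≤ μ / 2 * B * X := by
            calc C ^ 3 / (2 * μ) * (κ ^ 2 * s t ^ 2)
                ≤ C ^ 3 / (2 * μ) * (κ ^ 2 * (κ ^ 2 * M * X)) := by gcongr
              _ = μ / 2 * B * X := by rw [hB]; field_simp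
          have := hQ' t
          linarith
        have key2 : B * X * (γ * κ ^ 2) ≤ B * X * (μ / 2) := by gcongr
        have key3 : (Q' t + B * X * (γ * κ ^ 2)) + μ * (Q t - B * X) ≤ 0 := by linarith
        have := mul_nonneg (neg_nonneg.2 key3) (Real.exp_pos (μ * t)).le
        linarith
      have h1 : F t ≤ F 0 := hanti (Set.mem_Ici.2 le_rfl) (Set.mem_Ici.2 ht) ht
      have h2 : F 0 ≤ C * D₀ ^ 2 := by
        have h3 : Z 0 ^ 2 ≤ D₀ ^ 2 := by gcongr; exact hZ0 0
        have h4 : Q 0 ≤ C * D₀ ^ 2 := hQ0.trans (by gcongr)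
        simp [hF]; linarith
      have h5 : Q t - B * Real.exp (-(γ * κ ^ 2) * t) = F t * Real.exp (-μ * t) := by
        have hone : Real.exp (μ * t) * Real.exp (-μ * t) = 1 := by rw [← Real.exp_add]; simp
        rw [hF]; simp only; rw [mul_assoc (_ - _), hone, mul_one]
      have h6 : F t * Real.exp (-μ * t) ≤ C * D₀ ^ 2 * Real.exp (-μ * t) := by
        gcongr; exact h1.trans h2
      linarith
    refine le_of_sq_le_sq ?_ (by positivity)
    set K : ℝ := (1 + C) + C ^ 2 / μ * (1 + C) with hK
    have hKC : C ≤ K := by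
      rw [hK]
      have : 0 ≤ C ^ 2 / μ * (1 + C) := by positivity
      linarith
    have hK2 : C ^ 4 / μ ^ 2 * (1 + C) ≤ K ^ 2 := by
      have : C ^ 4 / μ ^ 2 * (1 + C) ≤ (C ^ 2 / μ * (1 + C)) ^ 2 := by
        have : (C ^ 2 / μ * (1 + C)) ^ 2 = C ^ 4 / μ ^ 2 * (1 + C) * (1 + C) := by ring
        rw [this]
        exact le_mul_of_one_le_right (by positivity) (by linarith)
      refine this.trans ?_
      gcongr
      linarith
    calc Z t ^ 2 ≤ C * Q t := hZQ t
      _ ≤ C * (B * Real.exp (-(γ * κ ^ 2) * t) + C * D₀ ^ 2 * Real.exp (-μ * t)) := by gcongr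
      _ = C ^ 4 / μ ^ 2 * M * (κ ^ 4 * Real.exp (-(γ * κ ^ 2) * t)) +
          C ^ 2 * (D₀ ^ 2 * Real.exp (-μ * t)) := by rw [hB]; ring
      _ ≤ C ^ 4 / μ ^ 2 * ((1 + C) * (D + D₀) ^ 2) * (κ ^ 4 * Real.exp (-(γ * κ ^ 2) * t)) +
          K ^ 2 * (D₀ ^ 2 * Real.exp (-μ * t)) := by gcongr
      _ = C ^ 4 / μ ^ 2 * (1 + C) * ((D + D₀) ^ 2 * (κ ^ 4 * Real.exp (-(γ * κ ^ 2) * t))) +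
          K ^ 2 * (D₀ ^ 2 * Real.exp (-μ * t)) := by ring
      _ ≤ K ^ 2 * ((D + D₀) ^ 2 * (κ ^ 4 * Real.exp (-(γ * κ ^ 2) * t))) +
          K ^ 2 * (D₀ ^ 2 * Real.exp (-μ * t)) := by gcongr
      _ ≤ _ := by
        rw [← hE', ← hE]
        have : 0 ≤ (D₀ * Real.exp (-(μ / 2) * t)) *
          (κ ^ 2 * (D + D₀) * Real.exp (-(γ / 2) * κ ^ 2 * t)) := by positivity
        nlinarith [mul_nonneg (sq_nonneg K) this]

/-! ### The exponentially stable block of velocities and electric field. -/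

/-- Quadratic Lyapunov functional of the block `(y₁, y₂, e)` of velocities and electric field. -/
noncomputable def fastForm (p q m₁ m₂ δ y₁ y₂ e : ℝ) : ℝ :=
  p * (m₁ * y₁ ^ 2 + m₂ * y₂ ^ 2) + e ^ 2 - 2 * δ * (q * (y₁ - y₂)) * e

/-- The differential of `fastForm` at `(y₁, y₂, e)` in the direction `(y₁', y₂', e')`. -/
noncomputable def fastFormDeriv (p q m₁ m₂ δ y₁ y₂ e y₁' y₂' e' : ℝ) : ℝ :=
  p * (m₁ * (2 * y₁ * y₁') + m₂ * (2 * y₂ * y₂')) + 2 * e * e' -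
    2 * δ * (q * ((y₁' - y₂') * e + (y₁ - y₂) * e'))

lemma hasDerivAt_fastForm {y₁ y₂ e : ℝ → ℝ} {y₁' y₂' e' t : ℝ} (p q m₁ m₂ δ : ℝ)
    (h₁ : HasDerivAt y₁ y₁' t) (h₂ : HasDerivAt y₂ y₂' t) (h₃ : HasDerivAt e e' t) :
    HasDerivAt (fun t => fastForm p q m₁ m₂ δ (y₁ t) (y₂ t) (e t))
      (fastFormDeriv p q m₁ m₂ δ (y₁ t) (y₂ t) (e t) y₁' y₂' e') t := by
  unfold fastForm fastFormDeriv
  refine (((((h₁.fun_pow 2).const_mul m₁).fun_add ((h₂.fun_pow 2).const_mul m₂)).const_mul p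
    |>.fun_add (h₃.fun_pow 2)).fun_sub
      ((((h₁.fun_sub h₂).const_mul q).const_mul (2 * δ)).fun_mul h₃)).congr_deriv ?_
  simp; ring

lemma exists_pos_le_of_pos {a₁ a₂ a₃ : ℝ} (h₁ : 0 < a₁) (h₂ : 0 < a₂) (h₃ : 0 < a₃) :
    ∃ d > 0, d ≤ a₁ ∧ d ≤ a₂ ∧ d ≤ a₃ :=
  ⟨min a₁ (min a₂ a₃), by positivity, min_le_left _ _, (min_le_right _ _).trans (min_le_left _ _),
    (min_le_right _ _).trans (min_le_right _ _)⟩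

set_option maxHeartbeats 1600000 in
-- With the weights `p * m` the work of the electric field cancels in the energy, so friction alone
-- dissipates, and only the velocities. The cross term repairs this: differentiating `-2δ q(y₁ -
-- y₂)e` produces `-2δ q²(1/m₁ + 1/m₂)e²`. The perturbations `κ h` stand for the coupling to the
-- slow mode and are kept as a separate error.
lemma fastForm_lyapunov {p q m₁ m₂ n₁ n₂ : ℝ} (hp : 0 < p) (hq : 0 < q) (hm₁ : 0 < m₁)
    (hm₂ : 0 < m₂) (hn₁ : 0 < n₁) (hn₂ : 0 < n₂) :
    ∃ δ μ C : ℝ, 0 < μ ∧ 0 < C ∧ ∀ y₁ y₂ e : ℝ,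
      (|y₁| + |y₂| + |e|) ^ 2 ≤ C * fastForm p q m₁ m₂ δ y₁ y₂ e ∧
      fastForm p q m₁ m₂ δ y₁ y₂ e ≤ C * (|y₁| + |y₂| + |e|) ^ 2 ∧
      ∀ κ h₁ h₂ h₃ H : ℝ, 0 ≤ κ → |h₁| ≤ H → |h₂| ≤ H → |h₃| ≤ H →
        fastFormDeriv p q m₁ m₂ δ y₁ y₂ e (q / m₁ * e - n₁ * y₁ + κ * h₁)
          (-(q / m₂) * e - n₂ * y₂ + κ * h₂) (-p * (q * (y₁ - y₂)) + κ * h₃) ≤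
        -2 * μ * fastForm p q m₁ m₂ δ y₁ y₂ e + C * κ * (|y₁| + |y₂| + |e|) * H := by
  obtain ⟨a, ha, ha₁, ha₂, -⟩ := exists_pos_le_of_pos (a₁ := 2 * p * (m₁ * n₁))
    (a₂ := 2 * p * (m₂ * n₂)) (a₃ := 1) (by positivity) (by positivity) one_pos
  set b : ℝ := q ^ 2 * (1 / m₁ + 1 / m₂) with hb
  have hbpos : 0 < b := by positivity
  set K : ℝ := 2 * q ^ 2 * (n₁ ^ 2 + n₂ ^ 2) / b + 4 * p * q ^ 2 with hK
  have hKpos : 0 < K := by positivity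
  obtain ⟨mm, hmm, hmm₁, hmm₂, -⟩ := exists_pos_le_of_pos hm₁ hm₂ one_pos
  -- The first bound on `δ` keeps at least half of the friction after the velocity terms created by
  -- the cross term, collected in `K`, are subtracted. The other two keep the cross term below half
  -- of the diagonal part, so the form stays positive definite.
  obtain ⟨δ, hδ, hδ₁, hδ₂, hδ₃⟩ := exists_pos_le_of_pos (a₁ := a / (2 * K))
    (a₂ := p * mm / (4 * q)) (a₃ := 1 / (2 * q)) (by positivity) (by positivity) (by positivity)
  rw [le_div_iff₀ (by positivity)] at hδ₁ hδ₂ hδ₃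
  obtain ⟨α, hα, hα₁, hα₂, -⟩ := exists_pos_le_of_pos (a₁ := p * mm / 2)
    (a₂ := 1 / 2) (a₃ := 1) (by positivity) (by positivity) one_pos
  obtain ⟨d, hd, hd₁, hd₂, -⟩ := exists_pos_le_of_pos (a₁ := a / 2)
    (a₂ := δ * b) (a₃ := 1) (by positivity) (by positivity) one_pos
  set C₁ : ℝ := p * (m₁ + m₂) + 1 + 2 * δ * q with hC₁
  have hC₁pos : 0 < C₁ := by positivity
  set C₂ : ℝ := 2 * p * (m₁ + m₂) + 2 + 8 * δ * q with hC₂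
  have hC₂pos : 0 < C₂ := by positivity
  refine ⟨δ, d / (2 * C₁), 3 / α + C₁ + C₂, by positivity, by positivity, fun y₁ y₂ e => ?_⟩
  set S : ℝ := y₁ ^ 2 + y₂ ^ 2 + e ^ 2 with hS
  set Z : ℝ := |y₁| + |y₂| + |e| with hZ
  set Q : ℝ := fastForm p q m₁ m₂ δ y₁ y₂ e with hQ
  have hZ0 : 0 ≤ Z := by positivity
  have hSnn : 0 ≤ S := by positivity
  have hZS : Z ^ 2 ≤ 3 * S := by
    rw [hZ, hS, ← sq_abs y₁, ← sq_abs y₂, ← sq_abs e]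
    nlinarith only [sq_nonneg (|y₁| - |y₂|), sq_nonneg (|y₁| - |e|), sq_nonneg (|y₂| - |e|)]
  have hSZ : S ≤ Z ^ 2 := by
    rw [hZ, hS, ← sq_abs y₁, ← sq_abs y₂, ← sq_abs e]
    nlinarith only [mul_nonneg (abs_nonneg y₁) (abs_nonneg y₂), mul_nonneg (abs_nonneg y₁) (abs_nonneg e),
      mul_nonneg (abs_nonneg y₂) (abs_nonneg e)]
  have hcross₁ : 2 * (y₁ - y₂) * e ≤ 2 * (y₁ ^ 2 + y₂ ^ 2) + e ^ 2 := by
    nlinarith only [sq_nonneg (y₁ - y₂ - e), sq_nonneg (y₁ + y₂)]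
  have hcross₂ : -(2 * (y₁ ^ 2 + y₂ ^ 2) + e ^ 2) ≤ 2 * (y₁ - y₂) * e := by
    nlinarith only [sq_nonneg (y₁ - y₂ + e), sq_nonneg (y₁ + y₂)]
  have hδq : 0 < δ * q := by positivity
  have hQlow : α * S ≤ Q := by
    have h1 := mul_le_mul_of_nonneg_left hcross₁ hδq.le
    have h2 : p * mm * y₁ ^ 2 ≤ p * m₁ * y₁ ^ 2 := by gcongr
    have h3 : p * mm * y₂ ^ 2 ≤ p * m₂ * y₂ ^ 2 := by gcongr
    have h4 : α * (y₁ ^ 2 + y₂ ^ 2) ≤ p * mm / 2 * (y₁ ^ 2 + y₂ ^ 2) := by gcongr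
    have h5 : α * e ^ 2 ≤ 1 / 2 * e ^ 2 := by gcongr
    have h6 := mul_le_mul_of_nonneg_right hδ₂ (add_nonneg (sq_nonneg y₁) (sq_nonneg y₂))
    have h7 := mul_le_mul_of_nonneg_right hδ₃ (sq_nonneg e)
    rw [hQ, hS, fastForm]
    linarith only [h1, h2, h3, h4, h5, h6, h7]
  have hQup : Q ≤ C₁ * S := by
    have h1 := mul_le_mul_of_nonneg_left hcross₂ hδq.le
    have h2 : 0 ≤ p * m₁ * y₂ ^ 2 + p * m₂ * y₁ ^ 2 + p * (m₁ + m₂) * e ^ 2 := by positivity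
    have h3 : 0 ≤ δ * q * e ^ 2 := by positivity
    rw [hQ, hS, fastForm, hC₁]
    linarith only [h1, h2, h3, sq_nonneg y₁, sq_nonneg y₂]
  have hQnn : 0 ≤ Q := (mul_nonneg hα.le hSnn).trans hQlow
  refine ⟨?_, ?_, fun κ h₁ h₂ h₃ H hκ hh₁ hh₂ hh₃ => ?_⟩
  · have h1 : Z ^ 2 ≤ 3 / α * Q := by
      refine hZS.trans ?_
      rw [div_mul_eq_mul_div, le_div_iff₀ hα]
      linarith
    have : 0 ≤ (C₁ + C₂) * Q := by positivity
    linarith only [h1, this]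
  · have h1 : Q ≤ C₁ * Z ^ 2 := hQup.trans (by gcongr)
    have : 0 ≤ (3 / α + C₂) * Z ^ 2 := by positivity
    linarith only [h1, this]
  · have hdiss : -(2 * p) * (m₁ * n₁ * y₁ ^ 2 + m₂ * n₂ * y₂ ^ 2) - 2 * δ * b * e ^ 2 +
        2 * δ * q * ((n₁ * y₁ - n₂ * y₂) * e) + 2 * δ * p * q ^ 2 * (y₁ - y₂) ^ 2 ≤ -d * S := by
      have f1 : 2 * q * ((n₁ * y₁ - n₂ * y₂) * e) ≤
          b * e ^ 2 + q ^ 2 / b * (n₁ * y₁ - n₂ * y₂) ^ 2 := by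
        have : b * e ^ 2 + q ^ 2 / b * (n₁ * y₁ - n₂ * y₂) ^ 2 -
          2 * q * ((n₁ * y₁ - n₂ * y₂) * e) = (b * e - q * (n₁ * y₁ - n₂ * y₂)) ^ 2 / b := by
          field_simp; ring
        have h0 : 0 ≤ (b * e - q * (n₁ * y₁ - n₂ * y₂)) ^ 2 / b := by positivity
        linarith
      have f2 : (n₁ * y₁ - n₂ * y₂) ^ 2 ≤ 2 * (n₁ ^ 2 + n₂ ^ 2) * (y₁ ^ 2 + y₂ ^ 2) := by
        nlinarith only [sq_nonneg (n₁ * y₁ + n₂ * y₂), sq_nonneg (n₁ * y₂), sq_nonneg (n₂ * y₁)]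
      have f3 : q ^ 2 / b * (n₁ * y₁ - n₂ * y₂) ^ 2 ≤
          2 * q ^ 2 * (n₁ ^ 2 + n₂ ^ 2) / b * (y₁ ^ 2 + y₂ ^ 2) := by
        calc _ ≤ q ^ 2 / b * (2 * (n₁ ^ 2 + n₂ ^ 2) * (y₁ ^ 2 + y₂ ^ 2)) := by gcongr
          _ = _ := by ring
      have f4 : (y₁ - y₂) ^ 2 ≤ 2 * (y₁ ^ 2 + y₂ ^ 2) := by nlinarith only [sq_nonneg (y₁ + y₂)]
      have f5 : 2 * p * q ^ 2 * (y₁ - y₂) ^ 2 ≤ 4 * p * q ^ 2 * (y₁ ^ 2 + y₂ ^ 2) := by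
        calc _ ≤ 2 * p * q ^ 2 * (2 * (y₁ ^ 2 + y₂ ^ 2)) := by gcongr
          _ = _ := by ring
      have f6 : δ * (2 * q * ((n₁ * y₁ - n₂ * y₂) * e) + 2 * p * q ^ 2 * (y₁ - y₂) ^ 2) ≤
          δ * (b * e ^ 2 + K * (y₁ ^ 2 + y₂ ^ 2)) := by
        refine mul_le_mul_of_nonneg_left ?_ hδ.le; rw [hK]; linarith only [f1, f3, f5]
      have f7 : δ * K * (y₁ ^ 2 + y₂ ^ 2) ≤ a / 2 * (y₁ ^ 2 + y₂ ^ 2) := by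
        gcongr; linarith
      have f8 := mul_le_mul_of_nonneg_right ha₁ (sq_nonneg y₁)
      have f9 := mul_le_mul_of_nonneg_right ha₂ (sq_nonneg y₂)
      have f10 := mul_le_mul_of_nonneg_right hd₁ (add_nonneg (sq_nonneg y₁) (sq_nonneg y₂))
      have f11 := mul_le_mul_of_nonneg_right hd₂ (sq_nonneg e)
      rw [hS]; linarith only [f6, f7, f8, f9, f10, f11]
    have hdQ : -d * S ≤ -2 * (d / (2 * C₁)) * Q := by
      have : 2 * (d / (2 * C₁)) * Q ≤ 2 * (d / (2 * C₁)) * (C₁ * S) := by gcongr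
      have h2 : 2 * (d / (2 * C₁)) * (C₁ * S) = d * S := by field_simp
      linarith
    have hH : 0 ≤ H := (abs_nonneg _).trans hh₁
    have hy₁ : |y₁| ≤ Z := by rw [hZ]; linarith [abs_nonneg y₂, abs_nonneg e]
    have hy₂ : |y₂| ≤ Z := by rw [hZ]; linarith [abs_nonneg y₁, abs_nonneg e]
    have he : |e| ≤ Z := by rw [hZ]; linarith [abs_nonneg y₁, abs_nonneg y₂]
    have hprod : ∀ x h : ℝ, |x| ≤ Z → |h| ≤ H → |x * h| ≤ Z * H := fun x h hx hh => by
      rw [abs_mul]; gcongr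
    have hforce : 2 * p * (m₁ * (y₁ * h₁) + m₂ * (y₂ * h₂)) + 2 * (e * h₃) -
        2 * δ * q * (e * h₁ - e * h₂ + (y₁ * h₃ - y₂ * h₃)) ≤ C₂ * Z * H := by
      have g1 := mul_le_mul_of_nonneg_left (abs_le.1 (hprod y₁ h₁ hy₁ hh₁)).2
        (show 0 ≤ 2 * p * m₁ by positivity)
      have g2 := mul_le_mul_of_nonneg_left (abs_le.1 (hprod y₂ h₂ hy₂ hh₂)).2
        (show 0 ≤ 2 * p * m₂ by positivity)
      have g3 := (abs_le.1 (hprod e h₃ he hh₃)).2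
      have g4 : -(4 * (Z * H)) ≤ e * h₁ - e * h₂ + (y₁ * h₃ - y₂ * h₃) := by
        linarith [(abs_le.1 (hprod e h₁ he hh₁)).1, (abs_le.1 (hprod e h₂ he hh₂)).2,
          (abs_le.1 (hprod y₁ h₃ hy₁ hh₃)).1, (abs_le.1 (hprod y₂ h₃ hy₂ hh₃)).2]
      have g5 := mul_le_mul_of_nonneg_left g4 (show 0 ≤ 2 * δ * q by positivity)
      rw [hC₂]; linarith only [g1, g2, g3, g5]
    have hsplit : fastFormDeriv p q m₁ m₂ δ y₁ y₂ e (q / m₁ * e - n₁ * y₁ + κ * h₁)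
          (-(q / m₂) * e - n₂ * y₂ + κ * h₂) (-p * (q * (y₁ - y₂)) + κ * h₃) =
        (-(2 * p) * (m₁ * n₁ * y₁ ^ 2 + m₂ * n₂ * y₂ ^ 2) - 2 * δ * b * e ^ 2 +
        2 * δ * q * ((n₁ * y₁ - n₂ * y₂) * e) + 2 * δ * p * q ^ 2 * (y₁ - y₂) ^ 2) +
        κ * (2 * p * (m₁ * (y₁ * h₁) + m₂ * (y₂ * h₂)) + 2 * (e * h₃) -
        2 * δ * q * (e * h₁ - e * h₂ + (y₁ * h₃ - y₂ * h₃))) := by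
      rw [fastFormDeriv, hb]; field_simp; ring
    have hlast := mul_le_mul_of_nonneg_left hforce hκ
    have : 0 ≤ (3 / α + C₁) * (κ * (Z * H)) := by positivity
    rw [hsplit]
    linarith only [hlast, this, hdQ, hdiss]

/-! ### Real mode systems at high frequency. -/

set_option maxHeartbeats 1600000 in
/-- High-frequency decay of the longitudinal modes. -/
lemma longitudinal_high_decay {p q m₁ m₂ n₁ n₂ T₁ T₂ : ℝ} (hp : 0 < p)
    (hm₁ : 0 < m₁) (hm₂ : 0 < m₂) (hn₁ : 0 < n₁) (hn₂ : 0 < n₂) (hT₁ : 0 < T₁) (hT₂ : 0 < T₂)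
    {r : ℝ} (hr : 0 < r) :
    ∃ lam K : ℝ, 0 < lam ∧ 0 < K ∧ ∀ κ, r ≤ κ → ∀ R₁ R₂ w₁ w₂ e : ℝ → ℝ,
      (∀ t, HasDerivAt R₁ (κ * w₁ t) t) → (∀ t, HasDerivAt R₂ (κ * w₂ t) t) →
      (∀ t, HasDerivAt w₁ (q / m₁ * e t - n₁ * w₁ t - T₁ / m₁ * κ * R₁ t) t) →
      (∀ t, HasDerivAt w₂ (-(q / m₂) * e t - n₂ * w₂ t - T₂ / m₂ * κ * R₂ t) t) →
      (∀ t, HasDerivAt e (-p * (q * (w₁ t - w₂ t))) t) →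
      (∀ t, κ * e t = -p * (q * (R₁ t - R₂ t))) →
      ∀ t, 0 ≤ t → R₁ t ^ 2 + R₂ t ^ 2 + (w₁ t ^ 2 + w₂ t ^ 2) + e t ^ 2 ≤
        K * Real.exp (-lam * t) * (R₁ 0 ^ 2 + R₂ 0 ^ 2 + (w₁ 0 ^ 2 + w₂ 0 ^ 2) + e 0 ^ 2) := by
  set b : ℝ := 1 / r with hb
  have hbpos : 0 < b := by positivity
  obtain ⟨δa, hδa, ha₁, ha₂, ha₃⟩ := exists_pos_le_of_pos
    (a₁ := n₁ * m₁ / (2 * m₁ + b ^ 2 * m₁ ^ 2 * n₁ ^ 2 / T₁))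
    (a₂ := n₂ * m₂ / (2 * m₂ + b ^ 2 * m₂ ^ 2 * n₂ ^ 2 / T₂)) (a₃ := 1)
    (by positivity) (by positivity) one_pos
  obtain ⟨δ, hδ, hδa', hδ₁, hδ₂⟩ := exists_pos_le_of_pos (a₁ := δa)
    (a₂ := T₁ / (4 * b ^ 2 * m₁)) (a₃ := T₂ / (4 * b ^ 2 * m₂)) hδa
    (by positivity) (by positivity)
  have hd₁ := hδa'.trans ha₁
  have hd₂ := hδa'.trans ha₂
  have hδ1 : δ ≤ 1 := hδa'.trans ha₃
  rw [le_div_iff₀ (by positivity)] at hd₁ hd₂ hδ₁ hδ₂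
  obtain ⟨d, hd, hdn₁, hdn₂, hdδ⟩ := exists_pos_le_of_pos hn₁ hn₂ hδ
  obtain ⟨α', hα', hαT₁, hαT₂, hαp⟩ := exists_pos_le_of_pos hT₁ hT₂ (show 0 < 1 / p by positivity)
  obtain ⟨α, hα, hαα, hαm₁, hαm₂⟩ := exists_pos_le_of_pos hα' hm₁ hm₂
  set A : ℝ := T₁ + T₂ + m₁ + m₂ + 1 / p with hA
  have hApos : 0 < A := by positivity
  refine ⟨d / 2, 3 * A / α, by positivity, by positivity, ?_⟩
  intro κ hκr R₁ R₂ w₁ w₂ e hR₁ hR₂ hw₁ hw₂ he hcon t ht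
  have hκ : 0 < κ := hr.trans_le hκr
  have hkb : κ⁻¹ ≤ b := by rw [hb, one_div]; gcongr
  have hk0 : 0 < κ⁻¹ := by positivity
  set Φ₀ : ℝ → ℝ := fun t =>
    T₁ * R₁ t ^ 2 + T₂ * R₂ t ^ 2 + (m₁ * w₁ t ^ 2 + m₂ * w₂ t ^ 2) + 1 / p * e t ^ 2 with hΦ₀
  -- The energy `Φ₀` dissipates the velocities only. The density–velocity cross terms carry κ⁻¹
  -- because the pressure coupling is of order κ; their derivative dissipates the densities at a
  -- rate independent of κ, and they remain small perturbations since κ⁻¹ ≤ 1/r.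
  set Φ : ℝ → ℝ := fun t =>
    T₁ * R₁ t ^ 2 + T₂ * R₂ t ^ 2 + (m₁ * w₁ t ^ 2 + m₂ * w₂ t ^ 2) + 1 / p * e t ^ 2 +
      2 * δ * κ⁻¹ * (m₁ * (R₁ t * w₁ t) + m₂ * (R₂ t * w₂ t)) with hΦ
  have hder : ∀ t, HasDerivAt Φ (-2 * (m₁ * n₁ * w₁ t ^ 2 + m₂ * n₂ * w₂ t ^ 2) +
      2 * δ * (m₁ * w₁ t ^ 2 + m₂ * w₂ t ^ 2) - 2 * δ * (T₁ * R₁ t ^ 2 + T₂ * R₂ t ^ 2) -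
      2 * δ * (1 / p * e t ^ 2) -
      δ * (2 * κ⁻¹ * (m₁ * n₁ * (R₁ t * w₁ t)) + 2 * κ⁻¹ * (m₂ * n₂ * (R₂ t * w₂ t)))) t := by
    intro t
    refine ((((((hR₁ t).fun_pow 2).const_mul T₁).fun_add (((hR₂ t).fun_pow 2).const_mul T₂)).fun_add
      ((((hw₁ t).fun_pow 2).const_mul m₁).fun_add (((hw₂ t).fun_pow 2).const_mul m₂))).fun_add
      (((he t).fun_pow 2).const_mul (1 / p)) |>.fun_add
      (((((hR₁ t).fun_mul (hw₁ t)).const_mul m₁).fun_add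
        (((hR₂ t).fun_mul (hw₂ t)).const_mul m₂)).const_mul (2 * δ * κ⁻¹))).congr_deriv ?_
    have e1 : q * (R₁ t - R₂ t) = -κ * e t / p := by
      rw [eq_div_iff hp.ne']; linarith [hcon t]
    have e2 : q * R₁ t = -κ * e t / p + q * R₂ t := by linarith
    have e3 : q * (R₁ t * e t) = (-κ * e t / p + q * R₂ t) * e t := by rw [← e2]; ring
    simp only [Nat.cast_ofNat, Nat.add_one_sub_one, pow_one]
    -- Gauss's law turns the electric contribution κ⁻¹q(R₁ - R₂)e of the cross terms into the
    -- negative definite -e²/p, so the electric field needs no cross term of its own.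
    have e4 : 2 * δ * κ⁻¹ * (q * (R₁ t * e t)) - 2 * δ * κ⁻¹ * (q * (R₂ t * e t)) =
        -2 * δ * (1 / p * e t ^ 2) := by
      rw [e3]; field_simp; ring
    have e5 : -2 * δ * (1 / p * e t ^ 2) = -(2 * δ * (1 / p * e t ^ 2)) := by ring
    rw [e5] at e4
    rw [sub_eq_add_neg _ (2 * δ * (1 / p * e t ^ 2)), ← e4]
    field_simp
    ring
  have hcross : ∀ {m n T R w : ℝ}, 0 < m → 0 < n → 0 < T →
      |2 * κ⁻¹ * (m * n * (R * w))| ≤ T * R ^ 2 + b ^ 2 * m ^ 2 * n ^ 2 / T * w ^ 2 := by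
    intro m n T R w hm hn hT
    have h1 : |2 * κ⁻¹ * (m * n * (R * w))| = κ⁻¹ * (2 * (m * n * (|R| * |w|))) := by
      simp only [abs_mul, abs_of_pos hm, abs_of_pos hn, abs_of_pos hk0, abs_two]; ring
    have h2 : κ⁻¹ * (2 * (m * n * (|R| * |w|))) ≤ b * (2 * (m * n * (|R| * |w|))) := by gcongr
    have h3 : T * R ^ 2 + b ^ 2 * m ^ 2 * n ^ 2 / T * w ^ 2 - b * (2 * (m * n * (|R| * |w|))) =
        (T * |R| - b * m * n * |w|) ^ 2 / T := by
      rw [← sq_abs R, ← sq_abs w]; field_simp; ring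
    have h4 : 0 ≤ (T * |R| - b * m * n * |w|) ^ 2 / T := by positivity
    linarith only [h1, h2, h3, h4]
  have hcross' : ∀ {m T R w : ℝ}, 0 < m → 0 < T → δ * (4 * b ^ 2 * m) ≤ T →
      |2 * δ * κ⁻¹ * (m * (R * w))| ≤ 1 / 2 * (T * R ^ 2) + 1 / 2 * (m * w ^ 2) := by
    intro m T R w hm hT hmT
    have h1 : |2 * δ * κ⁻¹ * (m * (R * w))| = κ⁻¹ * (2 * δ * (m * (|R| * |w|))) := by
      simp only [abs_mul, abs_of_pos hm, abs_of_pos hδ, abs_of_pos hk0, abs_two]; ring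
    have h2 : κ⁻¹ * (2 * δ * (m * (|R| * |w|))) ≤ b * (2 * δ * (m * (|R| * |w|))) := by gcongr
    have h3 : b * (2 * δ * (m * (|R| * |w|))) ≤ 2 * δ * b ^ 2 * m * R ^ 2 + δ / 2 * m * w ^ 2 := by
      rw [← sq_abs R, ← sq_abs w]
      have := mul_nonneg (mul_pos hδ hm).le (sq_nonneg (2 * b * |R| - |w|))
      linarith only [this]
    have h4 := mul_le_mul_of_nonneg_right hmT (sq_nonneg R)
    have h5 : δ * (m * w ^ 2) ≤ 1 * (m * w ^ 2) := by gcongr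
    linarith only [h1, h2, h3, h4, h5]
  have hΦlow : ∀ t, 1 / 2 * Φ₀ t ≤ Φ t := fun t => by
    have h1 := (abs_le.1 (hcross' (R := R₁ t) (w := w₁ t) hm₁ hT₁ hδ₁)).1
    have h2 := (abs_le.1 (hcross' (R := R₂ t) (w := w₂ t) hm₂ hT₂ hδ₂)).1
    have h3 : 0 ≤ 1 / p * e t ^ 2 := by positivity
    simp only [hΦ₀, hΦ]; linarith only [h1, h2, h3]
  have hΦup : ∀ t, Φ t ≤ 3 / 2 * Φ₀ t := fun t => by
    have h1 := (abs_le.1 (hcross' (R := R₁ t) (w := w₁ t) hm₁ hT₁ hδ₁)).2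
    have h2 := (abs_le.1 (hcross' (R := R₂ t) (w := w₂ t) hm₂ hT₂ hδ₂)).2
    have h3 : 0 ≤ 1 / p * e t ^ 2 := by positivity
    simp only [hΦ₀, hΦ]; linarith only [h1, h2, h3]
  have hmain := le_mul_exp_of_deriv_le (a := d / 2) hder (fun t => ?_) ht
  · have h1 := hΦlow t
    have h2 := hΦup 0
    have h3 : α * (R₁ t ^ 2 + R₂ t ^ 2 + (w₁ t ^ 2 + w₂ t ^ 2) + e t ^ 2) ≤ Φ₀ t := by
      have g1 := mul_le_mul_of_nonneg_right (hαα.trans hαT₁) (sq_nonneg (R₁ t))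
      have g2 := mul_le_mul_of_nonneg_right (hαα.trans hαT₂) (sq_nonneg (R₂ t))
      have g3 := mul_le_mul_of_nonneg_right (hαα.trans hαp) (sq_nonneg (e t))
      have g4 := mul_le_mul_of_nonneg_right hαm₁ (sq_nonneg (w₁ t))
      have g5 := mul_le_mul_of_nonneg_right hαm₂ (sq_nonneg (w₂ t))
      simp only [hΦ₀]; linarith only [g1, g2, g3, g4, g5]
    have h4 : Φ₀ 0 ≤ A * (R₁ 0 ^ 2 + R₂ 0 ^ 2 + (w₁ 0 ^ 2 + w₂ 0 ^ 2) + e 0 ^ 2) := by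
      have g1 : T₁ * R₁ 0 ^ 2 ≤ A * R₁ 0 ^ 2 := by
        gcongr
        have : 0 < 1 / p := by positivity
        linarith only [hA, this, hT₁, hT₂, hm₁, hm₂]
      have g2 : T₂ * R₂ 0 ^ 2 ≤ A * R₂ 0 ^ 2 := by
        gcongr
        have : 0 < 1 / p := by positivity
        linarith only [hA, this, hT₁, hT₂, hm₁, hm₂]
      have g3 : m₁ * w₁ 0 ^ 2 ≤ A * w₁ 0 ^ 2 := by
        gcongr
        have : 0 < 1 / p := by positivity
        linarith only [hA, this, hT₁, hT₂, hm₁, hm₂]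
      have g4 : m₂ * w₂ 0 ^ 2 ≤ A * w₂ 0 ^ 2 := by
        gcongr
        have : 0 < 1 / p := by positivity
        linarith only [hA, this, hT₁, hT₂, hm₁, hm₂]
      have g5 : 1 / p * e 0 ^ 2 ≤ A * e 0 ^ 2 := by
        gcongr
        linarith only [hA, hT₁, hT₂, hm₁, hm₂]
      simp only [hΦ₀]; linarith only [g1, g2, g3, g4, g5]
    have h5 : Φ 0 * Real.exp (-(d / 2) * t) ≤
        3 / 2 * (A * (R₁ 0 ^ 2 + R₂ 0 ^ 2 + (w₁ 0 ^ 2 + w₂ 0 ^ 2) + e 0 ^ 2)) *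
          Real.exp (-(d / 2) * t) := by gcongr; linarith only [h2, h4]
    rw [mul_assoc, div_mul_eq_mul_div, le_div_iff₀ hα]
    linarith only [h1, h3, h5, hmain]
  · have h1 := (abs_le.1 (hcross (R := R₁ t) (w := w₁ t) hm₁ hn₁ hT₁)).1
    have h2 := (abs_le.1 (hcross (R := R₂ t) (w := w₂ t) hm₂ hn₂ hT₂)).1
    have h3 := mul_le_mul_of_nonneg_left (add_le_add h1 h2) hδ.le
    have h4 := mul_le_mul_of_nonneg_right hd₁ (sq_nonneg (w₁ t))
    have h5 := mul_le_mul_of_nonneg_right hd₂ (sq_nonneg (w₂ t))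
    have h6 : -(m₁ * n₁ * w₁ t ^ 2 + m₂ * n₂ * w₂ t ^ 2) - δ * (T₁ * R₁ t ^ 2 + T₂ * R₂ t ^ 2) -
        δ * (1 / p * e t ^ 2) ≤ - d * Φ₀ t := by
      have g1 : d * (T₁ * R₁ t ^ 2) ≤ δ * (T₁ * R₁ t ^ 2) := by gcongr
      have g2 : d * (T₂ * R₂ t ^ 2) ≤ δ * (T₂ * R₂ t ^ 2) := by gcongr
      have g3 : d * (1 / p * e t ^ 2) ≤ δ * (1 / p * e t ^ 2) := by gcongr
      have g4 : d * (m₁ * w₁ t ^ 2) ≤ n₁ * (m₁ * w₁ t ^ 2) := by gcongr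
      have g5 : d * (m₂ * w₂ t ^ 2) ≤ n₂ * (m₂ * w₂ t ^ 2) := by gcongr
      simp only [hΦ₀]; linarith only [g1, g2, g3, g4, g5]
    have h7 : d / 2 * Φ t ≤ d / 2 * (3 / 2 * Φ₀ t) := by gcongr; exact hΦup t
    have h8 : 0 ≤ d * Φ₀ t := by simp only [hΦ₀]; positivity
    have h9 : 0 ≤ δ * (1 / p * e t ^ 2) := by positivity
    linarith only [h3, h4, h5, h6, h7, h8, h9]

set_option maxHeartbeats 1600000 in
/-- High-frequency decay of the transverse modes, with the loss `κ⁻²` in the rate. -/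
lemma transverse_high_decay {p q m₁ m₂ n₁ n₂ c : ℝ} (hp : 0 < p) (hq : 0 < q)
    (hm₁ : 0 < m₁) (hm₂ : 0 < m₂) (hn₁ : 0 < n₁) (hn₂ : 0 < n₂) (hc : 0 < c)
    {r : ℝ} (hr : 0 < r) :
    ∃ lam K : ℝ, 0 < lam ∧ 0 < K ∧ ∀ κ, r ≤ κ → ∀ y₁ y₂ e β : ℝ → ℝ,
      (∀ t, HasDerivAt y₁ (q / m₁ * e t - n₁ * y₁ t) t) →
      (∀ t, HasDerivAt y₂ (-(q / m₂) * e t - n₂ * y₂ t) t) →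
      (∀ t, HasDerivAt e (-p * (q * (y₁ t - y₂ t)) - c * κ * β t) t) →
      (∀ t, HasDerivAt β (c * κ * e t) t) →
      ∀ t, 0 ≤ t → y₁ t ^ 2 + y₂ t ^ 2 + e t ^ 2 + β t ^ 2 ≤
        K * Real.exp (-(lam * κ⁻¹ ^ 2) * t) *
          (y₁ 0 ^ 2 + y₂ 0 ^ 2 + e 0 ^ 2 + β 0 ^ 2) := by
  set B : ℝ := 1 / r with hB
  have hBpos : 0 < B := by positivity
  set b : ℝ := q ^ 2 * (1 / m₁ + 1 / m₂) with hb
  have hbpos : 0 < b := by positivity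
  -- With L b = 2c the dissipation 4εc(ke)² of the velocity–electric cross term is twice the term
  -- 2εc(ke)² that the electric–magnetic cross term creates with the wrong sign.
  set L : ℝ := 2 * c / b with hL
  have hLpos : 0 < L := by positivity
  have hLb : L * b = 2 * c := by rw [hL]; field_simp
  set K : ℝ := (L * B * q) ^ 2 / c * (2 * (n₁ ^ 2 + n₂ ^ 2)) +
    ((L * c + B ^ 2 * p) ^ 2 / c + 2 * L * p * B ^ 2) * (2 * q ^ 2) with hK
  have hKpos : 0 < K := by positivity
  obtain ⟨a, ha, ha₁, ha₂, -⟩ := exists_pos_le_of_pos (a₁ := 2 * p * (m₁ * n₁))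
    (a₂ := 2 * p * (m₂ * n₂)) (a₃ := 1) (by positivity) (by positivity) one_pos
  obtain ⟨mm, hmm, hmm₁, hmm₂, -⟩ := exists_pos_le_of_pos hm₁ hm₂ one_pos
  obtain ⟨ε, hε, hε₁, hε₂, hε₃⟩ := exists_pos_le_of_pos (a₁ := a / (2 * K))
    (a₂ := p * mm / (4 * (L * B ^ 2 * q))) (a₃ := 1 / (2 * (L * B ^ 2 * q + B ^ 3)))
    (by positivity) (by positivity) (by positivity)
  rw [le_div_iff₀ (by positivity)] at hε₁ hε₂ hε₃
  obtain ⟨α, hα, hα₁, hα₂, -⟩ := exists_pos_le_of_pos (a₁ := p * mm / 2)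
    (a₂ := 1 / 2) (a₃ := 1) (by positivity) (by positivity) one_pos
  obtain ⟨d, hd, hd₁, hd₂, -⟩ := exists_pos_le_of_pos (a₁ := a / (2 * B ^ 2))
    (a₂ := ε * c) (a₃ := 1) (by positivity) (by positivity) one_pos
  rw [le_div_iff₀ (by positivity)] at hd₁
  set A : ℝ := 2 * p * (m₁ + m₂) + 2 with hA
  have hApos : 0 < A := by positivity
  refine ⟨d / A, A / α, by positivity, by positivity, ?_⟩
  intro κ hκr y₁ y₂ e β hy₁ hy₂ he hβ t ht
  have hκ : 0 < κ := hr.trans_le hκr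
  set k : ℝ := κ⁻¹ with hk
  have hkB : k ≤ B := by rw [hk, hB, one_div]; gcongr
  have hk0 : 0 < k := by positivity
  have hkκ : k * κ = 1 := by rw [hk]; field_simp
  set S : ℝ → ℝ := fun t => y₁ t ^ 2 + y₂ t ^ 2 + e t ^ 2 + β t ^ 2 with hS
  -- The powers of k = κ⁻¹ are forced by the Maxwell coupling cκ. The term k³eβ dissipates β² with
  -- coefficient k², and k²(y₁ - y₂)e dissipates e² with the same coefficient, while its product
  -- with cκβ is of order k and pairs with kβ. All dissipation of the fields therefore carries k²,
  -- which is the regularity loss in the rate.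
  set Φ : ℝ → ℝ := fun t => p * (m₁ * y₁ t ^ 2 + m₂ * y₂ t ^ 2) + e t ^ 2 + β t ^ 2 -
    2 * (ε * L) * k ^ 2 * ((q * (y₁ t - y₂ t)) * e t) + 2 * ε * k ^ 3 * (e t * β t) with hΦ
  have hder : ∀ t, HasDerivAt Φ (-2 * p * (m₁ * n₁ * y₁ t ^ 2 + m₂ * n₂ * y₂ t ^ 2) -
      2 * ε * (L * b) * (k * e t) ^ 2 +
      ε * (2 * (L * k * q) * ((n₁ * y₁ t - n₂ * y₂ t) * (k * e t))) +
      2 * ε * L * p * k ^ 2 * (q * (y₁ t - y₂ t)) ^ 2 +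
      ε * (2 * (L * c - k ^ 2 * p) * ((q * (y₁ t - y₂ t)) * (k * β t))) -
      2 * ε * c * (k * β t) ^ 2 + 2 * ε * c * (k * e t) ^ 2) t := by
    intro t
    refine ((((((hy₁ t).fun_pow 2).const_mul m₁).fun_add
      (((hy₂ t).fun_pow 2).const_mul m₂)).const_mul p).fun_add ((he t).fun_pow 2)
      |>.fun_add ((hβ t).fun_pow 2)
      |>.fun_sub (((((hy₁ t).fun_sub (hy₂ t)).const_mul q).fun_mul (he t)).const_mul
        (2 * (ε * L) * k ^ 2))
      |>.fun_add (((he t).fun_mul (hβ t)).const_mul (2 * ε * k ^ 3))).congr_deriv ?_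
    simp only [Nat.cast_ofNat, Nat.add_one_sub_one, pow_one]
    rw [hb, hk]
    field_simp
    ring
  have hcr : ∀ x y : ℝ, |2 * (x * y)| ≤ x ^ 2 + y ^ 2 := fun x y => by
    rw [abs_le]
    constructor <;> nlinarith only [sq_nonneg (x - y), sq_nonneg (x + y)]
  have hY2 : ∀ t, (y₁ t - y₂ t) ^ 2 ≤ 2 * (y₁ t ^ 2 + y₂ t ^ 2) := fun t => by
    nlinarith only [sq_nonneg (y₁ t + y₂ t)]
  have hpert : ∀ t, |2 * (ε * L) * k ^ 2 * ((q * (y₁ t - y₂ t)) * e t)| +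
      |2 * ε * k ^ 3 * (e t * β t)| ≤
      p * mm / 2 * (y₁ t ^ 2 + y₂ t ^ 2) + 1 / 2 * (e t ^ 2 + β t ^ 2) := fun t => by
    have h1 : |2 * (ε * L) * k ^ 2 * ((q * (y₁ t - y₂ t)) * e t)| ≤
        ε * L * B ^ 2 * q * (2 * (y₁ t ^ 2 + y₂ t ^ 2) + e t ^ 2) := by
      have e0 : 2 * (ε * L) * k ^ 2 * ((q * (y₁ t - y₂ t)) * e t) =
        (ε * L * k ^ 2 * q) * (2 * ((y₁ t - y₂ t) * e t)) := by ring
      rw [e0, abs_mul, abs_of_pos (by positivity : 0 < ε * L * k ^ 2 * q)]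
      have := (hcr (y₁ t - y₂ t) (e t)).trans (add_le_add_left (hY2 t) _)
      gcongr
    have h2 : |2 * ε * k ^ 3 * (e t * β t)| ≤ ε * B ^ 3 * (e t ^ 2 + β t ^ 2) := by
      have e0 : 2 * ε * k ^ 3 * (e t * β t) = (ε * k ^ 3) * (2 * (e t * β t)) := by ring
      rw [e0, abs_mul, abs_of_pos (by positivity : 0 < ε * k ^ 3)]
      have := hcr (e t) (β t)
      gcongr
    have h3 := mul_le_mul_of_nonneg_right hε₂ (add_nonneg (sq_nonneg (y₁ t)) (sq_nonneg (y₂ t)))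
    have h4 := mul_le_mul_of_nonneg_right hε₃ (sq_nonneg (e t))
    have h5 := mul_le_mul_of_nonneg_right hε₃ (sq_nonneg (β t))
    have h6 : 0 ≤ ε * (L * B ^ 2 * q) * β t ^ 2 := by positivity
    linarith only [h1, h2, h3, h4, h5, h6]
  have hΦlow : ∀ t, α * S t ≤ Φ t := fun t => by
    have h0 := hpert t
    have h1 := (abs_le.1 (le_refl |2 * (ε * L) * k ^ 2 * ((q * (y₁ t - y₂ t)) * e t)|)).2
    have h2 := (abs_le.1 (le_refl |2 * ε * k ^ 3 * (e t * β t)|)).1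
    have h3 : p * mm * y₁ t ^ 2 ≤ p * m₁ * y₁ t ^ 2 := by gcongr
    have h4 : p * mm * y₂ t ^ 2 ≤ p * m₂ * y₂ t ^ 2 := by gcongr
    have h5 := mul_le_mul_of_nonneg_right hα₁ (add_nonneg (sq_nonneg (y₁ t)) (sq_nonneg (y₂ t)))
    have h6 := mul_le_mul_of_nonneg_right hα₂ (add_nonneg (sq_nonneg (e t)) (sq_nonneg (β t)))
    simp only [hS, hΦ]; linarith only [h0, h1, h2, h3, h4, h5, h6]
  have hΦup : ∀ t, Φ t ≤ A * S t := fun t => by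
    have h0 := hpert t
    have h1 := (abs_le.1 (le_refl |2 * (ε * L) * k ^ 2 * ((q * (y₁ t - y₂ t)) * e t)|)).1
    have h2 := (abs_le.1 (le_refl |2 * ε * k ^ 3 * (e t * β t)|)).2
    have h3 : p * mm * y₁ t ^ 2 ≤ p * m₁ * y₁ t ^ 2 := by gcongr
    have h4 : p * mm * y₂ t ^ 2 ≤ p * m₂ * y₂ t ^ 2 := by gcongr
    have h5 : 0 ≤ p * (m₁ + m₂) * (e t ^ 2 + β t ^ 2) := by positivity
    have h6 : 0 ≤ p * m₁ * y₁ t ^ 2 + p * m₂ * y₂ t ^ 2 + p * m₁ * y₂ t ^ 2 + p * m₂ * y₁ t ^ 2 := by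
      positivity
    have h7 : 0 ≤ p * m₁ * y₂ t ^ 2 + p * m₂ * y₁ t ^ 2 := by positivity
    simp only [hS, hΦ, hA]
    linarith only [h0, h1, h2, h3, h4, h5, h6, h7, sq_nonneg (y₁ t), sq_nonneg (y₂ t),
      sq_nonneg (e t), sq_nonneg (β t)]
  have hmain := le_mul_exp_of_deriv_le (a := d / A * k ^ 2) hder (fun t => ?_) ht
  · have h1 := hΦlow t
    have h2 : Φ 0 * Real.exp (-(d / A * k ^ 2) * t) ≤
      A * S 0 * Real.exp (-(d / A * k ^ 2) * t) := by gcongr; exact hΦup 0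
    change S t ≤ A / α * Real.exp (-(d / A * k ^ 2) * t) * S 0
    rw [mul_assoc, div_mul_eq_mul_div, le_div_iff₀ hα]
    linarith only [h1, h2, hmain]
  · have f1 : 2 * (L * k * q) * ((n₁ * y₁ t - n₂ * y₂ t) * (k * e t)) ≤
        c * (k * e t) ^ 2 + (L * B * q) ^ 2 / c * (2 * (n₁ ^ 2 + n₂ ^ 2)) *
          (y₁ t ^ 2 + y₂ t ^ 2) := by
      set X := n₁ * y₁ t - n₂ * y₂ t with hX
      have g1 : c * (k * e t) ^ 2 + (L * k * q) ^ 2 / c * X ^ 2 -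
          2 * (L * k * q) * (X * (k * e t)) = (c * (k * e t) - L * k * q * X) ^ 2 / c := by
        field_simp; ring
      have g2 : 0 ≤ (c * (k * e t) - L * k * q * X) ^ 2 / c := by positivity
      have g3 : X ^ 2 ≤ 2 * (n₁ ^ 2 + n₂ ^ 2) * (y₁ t ^ 2 + y₂ t ^ 2) := by
        rw [hX]
        nlinarith only [sq_nonneg (n₁ * y₁ t + n₂ * y₂ t), sq_nonneg (n₁ * y₂ t),
          sq_nonneg (n₂ * y₁ t)]
      have g4 : (L * k * q) ^ 2 / c * X ^ 2 ≤
          (L * B * q) ^ 2 / c * (2 * (n₁ ^ 2 + n₂ ^ 2) * (y₁ t ^ 2 + y₂ t ^ 2)) := by gcongr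
      linarith only [g1, g2, g4]
    have f2 : 2 * (L * c - k ^ 2 * p) * ((q * (y₁ t - y₂ t)) * (k * β t)) ≤
        c * (k * β t) ^ 2 + (L * c + B ^ 2 * p) ^ 2 / c * (2 * q ^ 2) *
          (y₁ t ^ 2 + y₂ t ^ 2) := by
      set Y := q * (y₁ t - y₂ t) with hY
      set G := L * c - k ^ 2 * p with hG
      have g1 : c * (k * β t) ^ 2 + G ^ 2 / c * Y ^ 2 -
          2 * G * (Y * (k * β t)) = (c * (k * β t) - G * Y) ^ 2 / c := by
        field_simp; ring
      have g2 : 0 ≤ (c * (k * β t) - G * Y) ^ 2 / c := by positivity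
      have g3 : Y ^ 2 ≤ 2 * q ^ 2 * (y₁ t ^ 2 + y₂ t ^ 2) := by
        have := mul_le_mul_of_nonneg_left (hY2 t) (sq_nonneg q)
        rw [hY]; linarith only [this]
      have g5 : G ^ 2 ≤ (L * c + B ^ 2 * p) ^ 2 := by
        have k2 : k ^ 2 * p ≤ B ^ 2 * p := by gcongr
        have k3 : 0 ≤ k ^ 2 * p := by positivity
        have k4 : 0 < L * c := by positivity
        apply sq_le_sq' <;> rw [hG] <;> linarith only [k2, k3, k4]
      have g4 : G ^ 2 / c * Y ^ 2 ≤
          (L * c + B ^ 2 * p) ^ 2 / c * (2 * q ^ 2 * (y₁ t ^ 2 + y₂ t ^ 2)) := by gcongr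
      linarith only [g1, g2, g4]
    have f3 : L * p * k ^ 2 * (q * (y₁ t - y₂ t)) ^ 2 ≤
        L * p * B ^ 2 * (2 * q ^ 2 * (y₁ t ^ 2 + y₂ t ^ 2)) := by
      have g3 : (q * (y₁ t - y₂ t)) ^ 2 ≤ 2 * q ^ 2 * (y₁ t ^ 2 + y₂ t ^ 2) := by
        have := mul_le_mul_of_nonneg_left (hY2 t) (sq_nonneg q)
        linarith only [this]
      gcongr
    have f4 := mul_le_mul_of_nonneg_left f1 hε.le
    have f5 := mul_le_mul_of_nonneg_left f2 hε.le
    have f6 := mul_le_mul_of_nonneg_left f3 hε.le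
    have f7 := mul_le_mul_of_nonneg_right hε₁ (add_nonneg (sq_nonneg (y₁ t)) (sq_nonneg (y₂ t)))
    rw [hK] at f7
    have f8 := mul_le_mul_of_nonneg_right ha₁ (sq_nonneg (y₁ t))
    have f9 := mul_le_mul_of_nonneg_right ha₂ (sq_nonneg (y₂ t))
    have f10 : d * k ^ 2 * (y₁ t ^ 2 + y₂ t ^ 2) ≤ a / 2 * (y₁ t ^ 2 + y₂ t ^ 2) := by
      have : d * k ^ 2 ≤ d * B ^ 2 := by gcongr
      gcongr
      linarith only [this, hd₁]
    have f11 : d * k ^ 2 * (e t ^ 2 + β t ^ 2) ≤ ε * c * ((k * e t) ^ 2 + (k * β t) ^ 2) := by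
      calc d * k ^ 2 * (e t ^ 2 + β t ^ 2) ≤ ε * c * k ^ 2 * (e t ^ 2 + β t ^ 2) := by gcongr
        _ = _ := by ring
    have f12 : d / A * k ^ 2 * Φ t ≤ d * k ^ 2 * S t := by
      calc d / A * k ^ 2 * Φ t ≤ d / A * k ^ 2 * (A * S t) := by gcongr; exact hΦup t
        _ = _ := by field_simp
    rw [hLb]
    simp only [hS] at f12
    linarith only [f4, f5, f6, f7, f8, f9, f10, f11, f12]

/-! ### Real mode systems at low frequency: reduction to a slow scalar and a damped block. -/

set_option maxHeartbeats 1600000 in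
/-- Low-frequency decay of the transverse modes when the magnetic field vanishes initially. -/
lemma transverse_low_decay {p q m₁ m₂ n₁ n₂ c : ℝ} (hp : 0 < p) (hq : 0 < q)
    (hm₁ : 0 < m₁) (hm₂ : 0 < m₂) (hn₁ : 0 < n₁) (hn₂ : 0 < n₂) (hc : 0 < c) :
    ∃ r lam K : ℝ, 0 < r ∧ 0 < lam ∧ 0 < K ∧ ∀ κ, 0 < κ → κ ≤ r → ∀ y₁ y₂ e β : ℝ → ℝ,
      (∀ t, HasDerivAt y₁ (q / m₁ * e t - n₁ * y₁ t) t) →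
      (∀ t, HasDerivAt y₂ (-(q / m₂) * e t - n₂ * y₂ t) t) →
      (∀ t, HasDerivAt e (-p * (q * (y₁ t - y₂ t)) - c * κ * β t) t) →
      (∀ t, HasDerivAt β (c * κ * e t) t) → β 0 = 0 →
      ∀ D, |y₁ 0| + |y₂ 0| + |e 0| ≤ D → ∀ t, 0 ≤ t →
        |β t| ≤ K * (κ * Real.exp (-lam * κ ^ 2 * t) + Real.exp (-lam * t)) * D ∧
        |y₁ t| + |y₂ t| + |e t| ≤
          K * (κ ^ 2 * Real.exp (-lam * κ ^ 2 * t) + Real.exp (-lam * t)) * D := by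
  obtain ⟨δ, μ, C₀, hμ, hC₀, hform⟩ := fastForm_lyapunov hp hq hm₁ hm₂ hn₁ hn₂
  -- `σ` is the electric conductivity of the two species together, and `γ` the corresponding
  -- magnetic diffusivity.
  set σ : ℝ := q ^ 2 / (m₁ * n₁) + q ^ 2 / (m₂ * n₂) with hσ
  have hσpos : 0 < σ := by positivity
  set γ : ℝ := c ^ 2 / (p * σ) with hγ
  have hγpos : 0 < γ := by positivity
  set L : ℝ := c / (p * σ) + c * q / (σ * n₁) + c * q / (σ * n₂) with hL
  have hLpos : 0 < L := by positivity
  set C : ℝ := C₀ + γ * L + C₀ * c + C₀ * c * L with hC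
  have hCpos : 0 < C := by positivity
  obtain ⟨r, hr, K, hK, hsf⟩ := slow_fast_decay hμ hγpos hCpos
  obtain ⟨lam, hlam, hlam₁, hlam₂, -⟩ := exists_pos_le_of_pos (show 0 < γ / 2 by positivity)
    (show 0 < μ / 2 by positivity) one_pos
  refine ⟨min r 1, lam, K * (L + 1) + K * L * (L + 1) + K * (L + 1), by positivity, hlam,
    by positivity, ?_⟩
  intro κ hκ hκr y₁ y₂ e β hy₁ hy₂ he hβ hβ0 D hD t ht
  have hκ1 : κ ≤ 1 := hκr.trans (min_le_right _ _)
  -- `l` is the linear form on the block whose derivative is exactly -c e - γκβ. Hence the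
  -- first-order term cκe drops out of the equation for β + κl, which becomes (β + κl)' = -γκ²β.
  -- Since β and β + κl differ by O(κZ), this is the slow equation up to an error of order κ³.
  set l : ℝ → ℝ := fun t =>
    c / (p * σ) * e t - c * q / (σ * n₁) * y₁ t + c * q / (σ * n₂) * y₂ t with hl
  set Z : ℝ → ℝ := fun t => |y₁ t| + |y₂ t| + |e t| with hZ
  have hZ0 : ∀ t, 0 ≤ Z t := fun t => by positivity
  have hlZ : ∀ t, |l t| ≤ L * Z t := fun t => by
    have h1 : |l t| ≤ c / (p * σ) * |e t| + c * q / (σ * n₁) * |y₁ t| +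
        c * q / (σ * n₂) * |y₂ t| := by
      refine (abs_add_le _ _).trans ?_
      refine add_le_add ((abs_sub _ _).trans (add_le_add ?_ ?_)) ?_ <;>
      rw [abs_mul, abs_of_pos (by positivity)]
    have h2 : 0 ≤ c / (p * σ) * (|y₁ t| + |y₂ t|) + c * q / (σ * n₁) * (|y₂ t| + |e t|) +
        c * q / (σ * n₂) * (|y₁ t| + |e t|) := by positivity
    simp only [hL, hZ]; linarith only [h1, h2]
  have hs : ∀ t, HasDerivAt (fun t => β t + κ * l t) (-γ * κ ^ 2 * β t) t := fun t => by
    refine ((hβ t).fun_add (((((he t).const_mul (c / (p * σ))).fun_sub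
      ((hy₁ t).const_mul (c * q / (σ * n₁)))).fun_add
        ((hy₂ t).const_mul (c * q / (σ * n₂)))).const_mul κ)).congr_deriv ?_
    have e1 : c * q / (σ * n₁) * (q / m₁) + c * q / (σ * n₂) * (q / m₂) = c := by
      rw [hσ]; field_simp
    have e2 : c / (p * σ) * p = c / σ := by field_simp
    have e3 : c * q / (σ * n₁) * n₁ = c / σ * q := by field_simp
    have e4 : c * q / (σ * n₂) * n₂ = c / σ * q := by field_simp
    have e5 : c / (p * σ) * c = γ := by rw [hγ]; ring
    linear_combination (-κ * e t) * e1 - κ * (q * (y₁ t - y₂ t)) * e2 + κ * y₁ t * e3 -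
      κ * y₂ t * e4 - κ ^ 2 * β t * e5
  have hQ : ∀ t, HasDerivAt (fun t => fastForm p q m₁ m₂ δ (y₁ t) (y₂ t) (e t)) _ t :=
    fun t => hasDerivAt_fastForm p q m₁ m₂ δ (hy₁ t) (hy₂ t) (he t)
  have hβs : ∀ t, |β t| ≤ |β t + κ * l t| + κ * (L * Z t) := fun t => by
    have : β t = (β t + κ * l t) - κ * l t := by ring
    calc |β t| = |(β t + κ * l t) - κ * l t| := by rw [← this]
      _ ≤ |β t + κ * l t| + |κ * l t| := abs_sub _ _
      _ ≤ _ := by rw [abs_mul κ, abs_of_pos hκ]; gcongr; exact hlZ t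
  have key := hsf κ hκ (hκr.trans (min_le_left _ _)) (fun t => β t + κ * l t)
    (fun t => fastForm p q m₁ m₂ δ (y₁ t) (y₂ t) (e t)) Z _ _ hs hQ hZ0 ?_ ?_ ?_ ?_ (L * D) D
    (by have := (hZ0 0).trans hD; positivity) hD ?_ t ht
  rotate_left
  · intro t
    have h1 := (hform (y₁ t) (y₂ t) (e t)).1
    refine h1.trans ?_
    have hnn : 0 ≤ fastForm p q m₁ m₂ δ (y₁ t) (y₂ t) (e t) := by
      have := (sq_nonneg _).trans h1
      exact nonneg_of_mul_nonneg_right this hC₀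
    gcongr
    have : 0 ≤ γ * L + C₀ * c + C₀ * c * L := by positivity
    linarith only [hC, this]
  · refine (hform (y₁ 0) (y₂ 0) (e 0)).2.1.trans ?_
    simp only [hZ]
    gcongr
    have : 0 ≤ γ * L + C₀ * c + C₀ * c * L := by positivity
    linarith only [hC, this]
  · intro t
    have e1 : -γ * κ ^ 2 * β t + γ * κ ^ 2 * (β t + κ * l t) = γ * κ ^ 3 * l t := by ring
    rw [e1, abs_mul, abs_of_pos (by positivity)]
    calc γ * κ ^ 3 * |l t| ≤ γ * κ ^ 3 * (L * Z t) := by gcongr; exact hlZ t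
      _ = (γ * L) * κ ^ 3 * Z t := by ring
      _ ≤ _ := by
        have := hZ0 t
        gcongr
        have : 0 ≤ C₀ + C₀ * c + C₀ * c * L := by positivity
        linarith only [hC, this]
  · intro t
    have h1 := (hform (y₁ t) (y₂ t) (e t)).2.2 κ 0 0 (-c * β t) (c * |β t|) hκ.le
      (by simp; positivity) (by simp; positivity)
      (by rw [abs_mul, abs_neg, abs_of_pos hc])
    have e1 : -p * (q * (y₁ t - y₂ t)) + κ * (-c * β t) =
      -p * (q * (y₁ t - y₂ t)) - c * κ * β t := by ring
    rw [e1, mul_zero, add_zero, add_zero] at h1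
    refine h1.trans ?_
    have h2 : C₀ * κ * Z t * (c * |β t|) ≤
        C * κ * Z t * (|β t + κ * l t| + κ * Z t) := by
      have hz := hZ0 t
      calc C₀ * κ * Z t * (c * |β t|)
          ≤ C₀ * κ * Z t * (c * (|β t + κ * l t| + κ * (L * Z t))) := by gcongr; exact hβs t
        _ = (C₀ * c) * κ * Z t * |β t + κ * l t| + (C₀ * c * L) * κ * Z t * (κ * Z t) := by ring
        _ ≤ C * κ * Z t * |β t + κ * l t| + C * κ * Z t * (κ * Z t) := by
          have a1 : 0 < γ * L := by positivity
          have a2 : 0 < C₀ * c := by positivity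
          have a3 : 0 < C₀ * c * L := by positivity
          gcongr <;> linarith only [hC, a1, a2, a3, hC₀]
        _ = _ := by ring
    linarith only [h2]
  · rw [hβ0, zero_add, abs_mul, abs_of_pos hκ]
    gcongr
    exact (hlZ 0).trans (by gcongr)
  obtain ⟨k1, k2⟩ := key
  have hD0 : 0 ≤ D := (hZ0 0).trans hD
  set E₁ := Real.exp (-lam * κ ^ 2 * t) with hE₁
  set E₂ := Real.exp (-lam * t) with hE₂
  have hE₁' : Real.exp (-(γ / 2) * κ ^ 2 * t) ≤ E₁ := by
    rw [hE₁]; gcongr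
  have hE₂' : Real.exp (-(μ / 2) * t) ≤ E₂ := by
    rw [hE₂]; gcongr
  have hE₁p : 0 < E₁ := Real.exp_pos _
  have hE₂p : 0 < E₂ := Real.exp_pos _
  have k1' : |β t + κ * l t| ≤ K * (L + 1) * (κ * E₁) * D := by
    refine k1.trans ?_
    calc _ ≤ K * κ * (L * D + D) * E₁ := by gcongr
      _ = _ := by ring
  have k2' : Z t ≤ K * (L + 1) * (κ ^ 2 * E₁ + E₂) * D := by
    refine k2.trans ?_
    calc _ ≤ K * (D * E₂ + κ ^ 2 * (L * D + D) * E₁) := by gcongr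
      _ = K * (L + 1) * (κ ^ 2 * E₁) * D + K * 1 * E₂ * D := by ring
      _ ≤ K * (L + 1) * (κ ^ 2 * E₁) * D + K * (L + 1) * E₂ * D := by gcongr; linarith
      _ = _ := by ring
  constructor
  · refine (hβs t).trans ?_
    have h1 : κ * (L * Z t) ≤ K * L * (L + 1) * (κ * E₁ + E₂) * D := by
      calc κ * (L * Z t) ≤ κ * (L * (K * (L + 1) * (κ ^ 2 * E₁ + E₂) * D)) := by gcongr
        _ = K * L * (L + 1) * (κ ^ 2 * (κ * E₁) + κ * E₂) * D := by ring
        _ ≤ K * L * (L + 1) * (1 * (κ * E₁) + 1 * E₂) * D := by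
          gcongr
          nlinarith
        _ = _ := by ring
    have h2 : 0 ≤ K * (L + 1) * (κ * E₁ + E₂) * D + K * (L + 1) * E₂ * D := by positivity
    linarith only [k1', h1, h2]
  · refine k2'.trans ?_
    have h2 : 0 ≤ (K * (L + 1) + K * L * (L + 1)) * (κ ^ 2 * E₁ + E₂) * D := by positivity
    linarith only [h2]

set_option maxHeartbeats 1600000 in
/-- Low-frequency decay of the longitudinal modes when the densities are initially of size `κ`. -/
lemma longitudinal_low_decay {p q m₁ m₂ n₁ n₂ T₁ T₂ : ℝ} (hp : 0 < p) (hq : 0 < q)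
    (hm₁ : 0 < m₁) (hm₂ : 0 < m₂) (hn₁ : 0 < n₁) (hn₂ : 0 < n₂) (hT₁ : 0 < T₁) (hT₂ : 0 < T₂) :
    ∃ r lam K : ℝ, 0 < r ∧ 0 < lam ∧ 0 < K ∧ ∀ κ, 0 < κ → κ ≤ r → ∀ R₁ R₂ w₁ w₂ e : ℝ → ℝ,
      (∀ t, HasDerivAt R₁ (κ * w₁ t) t) → (∀ t, HasDerivAt R₂ (κ * w₂ t) t) →
      (∀ t, HasDerivAt w₁ (q / m₁ * e t - n₁ * w₁ t - T₁ / m₁ * κ * R₁ t) t) →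
      (∀ t, HasDerivAt w₂ (-(q / m₂) * e t - n₂ * w₂ t - T₂ / m₂ * κ * R₂ t) t) →
      (∀ t, HasDerivAt e (-p * (q * (w₁ t - w₂ t))) t) →
      (∀ t, κ * e t = -p * (q * (R₁ t - R₂ t))) →
      ∀ D F, |w₁ 0| + |w₂ 0| + |e 0| ≤ D → |R₁ 0| ≤ κ * F → |R₂ 0| ≤ κ * F → ∀ t, 0 ≤ t →
        |R₁ t| + |R₂ t| ≤
          K * (κ * Real.exp (-lam * κ ^ 2 * t) * (D + F) + Real.exp (-lam * t) * D) ∧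
        |w₁ t| + |w₂ t| + |e t| ≤
          K * (κ ^ 2 * Real.exp (-lam * κ ^ 2 * t) * (D + F) + Real.exp (-lam * t) * D) := by
  obtain ⟨δ, μ, C₀, hμ, hC₀, hform⟩ := fastForm_lyapunov hp hq hm₁ hm₂ hn₁ hn₂
  set M : ℝ := m₁ * n₁ + m₂ * n₂ with hM
  have hMpos : 0 < M := by positivity
  -- The ambipolar diffusion coefficient: at low frequency the two densities move together, driven
  -- by both pressures against the total friction `M`.
  set γ : ℝ := (T₁ + T₂) / M with hγ
  have hγpos : 0 < γ := by positivity
  set L : ℝ := (m₁ + m₂ + M / (p * q)) / M with hL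
  have hLpos : 0 < L := by positivity
  set τ : ℝ := T₁ / m₁ + T₂ / m₂ with hτ
  have hτpos : 0 < τ := by positivity
  set C : ℝ := C₀ + (T₁ + T₂) * L + C₀ * τ / M + C₀ * τ * L with hC
  have hCpos : 0 < C := by positivity
  obtain ⟨r, hr, K, hK, hsf⟩ := slow_fast_decay hμ hγpos hCpos
  obtain ⟨lam, hlam, hlam₁, hlam₂, -⟩ := exists_pos_le_of_pos (show 0 < γ / 2 by positivity)
    (show 0 < μ / 2 by positivity) one_pos
  set J : ℝ := M + m₁ + m₂ + 1 with hJ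
  have hJpos : 0 < J := by positivity
  refine ⟨min r 1, lam, 2 * (K * J / M) + 2 * (L * K * J) + K * J, by positivity, hlam,
    by positivity, ?_⟩
  intro κ hκ hκr R₁ R₂ w₁ w₂ e hR₁ hR₂ hw₁ hw₂ he hcon D F hD hF₁ hF₂ t ht
  have hκ1 : κ ≤ 1 := hκr.trans (min_le_right _ _)
  have hF : 0 ≤ F := by
    have := (abs_nonneg _).trans hF₁
    exact nonneg_of_mul_nonneg_right this hκ
  set Z : ℝ → ℝ := fun t => |w₁ t| + |w₂ t| + |e t| with hZ
  have hZ0 : ∀ t, 0 ≤ Z t := fun t => by positivity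
  have hD0 : 0 ≤ D := (hZ0 0).trans hD
  -- The friction terms of order κ cancel between the weighted densities and κ times the total
  -- momentum, and the electric forces on the two species cancel in the momentum; only the pressure
  -- terms -κ²(T₁R₁ + T₂R₂) remain.
  set s : ℝ → ℝ := fun t =>
    m₁ * n₁ * R₁ t + m₂ * n₂ * R₂ t + κ * (m₁ * w₁ t + m₂ * w₂ t) with hs_def
  -- By Gauss's law the charge density is of order κe, so each density equals `s / M` up to O(κZ).
  -- This closes the slow equation and bounds the pressure forces on the block.
  have hdiff : ∀ t, R₁ t - R₂ t = -κ * e t / (p * q) := fun t => by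
    rw [eq_div_iff (by positivity)]; linarith only [hcon t]
  have hsup : ∀ t, |m₁ * w₁ t + m₂ * w₂ t| + (m₁ * n₁ + m₂ * n₂) / (p * q) * |e t| ≤
      (M * L) * Z t := fun t => by
    have h1 : |m₁ * w₁ t + m₂ * w₂ t| ≤ m₁ * |w₁ t| + m₂ * |w₂ t| := by
      refine (abs_add_le _ _).trans ?_
      rw [abs_mul, abs_mul, abs_of_pos hm₁, abs_of_pos hm₂]
    have h2 : M * L = m₁ + m₂ + M / (p * q) := by rw [hL]; field_simp
    have h3 : 0 ≤ m₁ * (|w₂ t| + |e t|) + m₂ * (|w₁ t| + |e t|) +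
      M / (p * q) * (|w₁ t| + |w₂ t|) := by positivity
    rw [h2]; simp only [hZ]; rw [← hM]; linarith only [h1, h3]
  have hR₁s : ∀ t, |R₁ t - s t / M| ≤ κ * (L * Z t) := fun t => by
    have e1 : R₁ t - s t / M =
        (-κ * (m₁ * w₁ t + m₂ * w₂ t) + m₂ * n₂ * (R₁ t - R₂ t)) / M := by
      rw [hs_def]; field_simp; rw [hM]; ring
    rw [e1, abs_div, abs_of_pos hMpos, div_le_iff₀ hMpos, hdiff t]
    refine (abs_add_le _ _).trans ?_
    have h1 : |-κ * (m₁ * w₁ t + m₂ * w₂ t)| = κ * |m₁ * w₁ t + m₂ * w₂ t| := by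
      rw [abs_mul, abs_neg, abs_of_pos hκ]
    have h2 : |m₂ * n₂ * (-κ * e t / (p * q))| = κ * (m₂ * n₂ / (p * q) * |e t|) := by
      rw [abs_mul, abs_div, abs_mul (-κ), abs_neg, abs_of_pos hκ,
        abs_of_pos (by positivity : 0 < m₂ * n₂), abs_of_pos (by positivity : 0 < p * q)]
      ring
    have h3 : m₂ * n₂ / (p * q) * |e t| ≤ (m₁ * n₁ + m₂ * n₂) / (p * q) * |e t| := by
      gcongr
      have : 0 < m₁ * n₁ := by positivity
      linarith only [this]
    have h4 := mul_le_mul_of_nonneg_left (hsup t) hκ.le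
    have h5 := mul_le_mul_of_nonneg_left h3 hκ.le
    linarith only [h1, h2, h4, h5]
  have hR₂s : ∀ t, |R₂ t - s t / M| ≤ κ * (L * Z t) := fun t => by
    have e1 : R₂ t - s t / M =
        (-κ * (m₁ * w₁ t + m₂ * w₂ t) - m₁ * n₁ * (R₁ t - R₂ t)) / M := by
      rw [hs_def]; field_simp; rw [hM]; ring
    rw [e1, abs_div, abs_of_pos hMpos, div_le_iff₀ hMpos, hdiff t]
    refine (abs_sub _ _).trans ?_
    have h1 : |-κ * (m₁ * w₁ t + m₂ * w₂ t)| = κ * |m₁ * w₁ t + m₂ * w₂ t| := by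
      rw [abs_mul, abs_neg, abs_of_pos hκ]
    have h2 : |m₁ * n₁ * (-κ * e t / (p * q))| = κ * (m₁ * n₁ / (p * q) * |e t|) := by
      rw [abs_mul, abs_div, abs_mul (-κ), abs_neg, abs_of_pos hκ,
        abs_of_pos (by positivity : 0 < m₁ * n₁), abs_of_pos (by positivity : 0 < p * q)]
      ring
    have h3 : m₁ * n₁ / (p * q) * |e t| ≤ (m₁ * n₁ + m₂ * n₂) / (p * q) * |e t| := by
      gcongr
      have : 0 < m₂ * n₂ := by positivity
      linarith only [this]
    have h4 := mul_le_mul_of_nonneg_left (hsup t) hκ.le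
    have h5 := mul_le_mul_of_nonneg_left h3 hκ.le
    linarith only [h1, h2, h4, h5]
  have hle_of_sub : ∀ {x t : ℝ}, |x - s t / M| ≤ κ * (L * Z t) →
      |x| ≤ |s t| / M + κ * (L * Z t) := fun {x t} h => by
    have h1 : |s t / M| = |s t| / M := by rw [abs_div, abs_of_pos hMpos]
    have h2 := abs_sub_abs_le_abs_sub x (s t / M)
    linarith only [h, h1, h2]
  have hs : ∀ t, HasDerivAt s (-κ ^ 2 * (T₁ * R₁ t + T₂ * R₂ t)) t := fun t => by
    refine ((((hR₁ t).const_mul (m₁ * n₁)).fun_add ((hR₂ t).const_mul (m₂ * n₂))).fun_add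
      ((((hw₁ t).const_mul m₁).fun_add ((hw₂ t).const_mul m₂)).const_mul κ)).congr_deriv ?_
    field_simp
    ring
  have hQ : ∀ t, HasDerivAt (fun t => fastForm p q m₁ m₂ δ (w₁ t) (w₂ t) (e t)) _ t :=
    fun t => hasDerivAt_fastForm p q m₁ m₂ δ (hw₁ t) (hw₂ t) (he t)
  have hCle : C₀ ≤ C := by
    have : 0 ≤ (T₁ + T₂) * L + C₀ * τ / M + C₀ * τ * L := by positivity
    linarith only [hC, this]
  have key := hsf κ hκ (hκr.trans (min_le_left _ _)) s
    (fun t => fastForm p q m₁ m₂ δ (w₁ t) (w₂ t) (e t)) Z _ _ hs hQ hZ0 ?_ ?_ ?_ ?_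
    (M * F + (m₁ + m₂) * D) D (by positivity) hD ?_ t ht
  rotate_left
  · intro t
    have h1 := (hform (w₁ t) (w₂ t) (e t)).1
    refine h1.trans ?_
    have hnn : 0 ≤ fastForm p q m₁ m₂ δ (w₁ t) (w₂ t) (e t) := by
      have := (sq_nonneg _).trans h1
      exact nonneg_of_mul_nonneg_right this hC₀
    gcongr
  · refine (hform (w₁ 0) (w₂ 0) (e 0)).2.1.trans ?_
    simp only [hZ]
    gcongr
  · intro t
    have e1 : -κ ^ 2 * (T₁ * R₁ t + T₂ * R₂ t) + γ * κ ^ 2 * s t =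
        -κ ^ 2 * (T₁ * (R₁ t - s t / M) + T₂ * (R₂ t - s t / M)) := by
      rw [hγ]; ring
    rw [e1, abs_mul, abs_neg, abs_of_pos (by positivity)]
    have h1 : |T₁ * (R₁ t - s t / M) + T₂ * (R₂ t - s t / M)| ≤
        (T₁ + T₂) * (κ * (L * Z t)) := by
      refine (abs_add_le _ _).trans ?_
      rw [abs_mul, abs_mul, abs_of_pos hT₁, abs_of_pos hT₂, add_mul]
      have a1 := hR₁s t
      have a2 := hR₂s t
      gcongr
    calc _ ≤ κ ^ 2 * ((T₁ + T₂) * (κ * (L * Z t))) := by gcongr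
      _ = (T₁ + T₂) * L * κ ^ 3 * Z t := by ring
      _ ≤ _ := by
        have := hZ0 t
        gcongr
        have : 0 ≤ C₀ + C₀ * τ / M + C₀ * τ * L := by positivity
        linarith only [hC, this]
  · intro t
    have hz := hZ0 t
    have b1 := hle_of_sub (hR₁s t)
    have b2 := hle_of_sub (hR₂s t)
    have hXnn : 0 ≤ |s t| / M + κ * (L * Z t) := by positivity
    have h1 := (hform (w₁ t) (w₂ t) (e t)).2.2 κ (-(T₁ / m₁) * R₁ t) (-(T₂ / m₂) * R₂ t) 0
      (τ * (|s t| / M + κ * (L * Z t))) hκ.le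
      (by
        rw [abs_mul, abs_neg, abs_of_pos (by positivity : 0 < T₁ / m₁)]
        have : 0 < T₂ / m₂ := by positivity
        gcongr
        linarith only [hτ, this])
      (by
        rw [abs_mul, abs_neg, abs_of_pos (by positivity : 0 < T₂ / m₂)]
        have : 0 < T₁ / m₁ := by positivity
        gcongr
        linarith only [hτ, this])
      (by simp only [abs_zero]; positivity)
    have e1 : q / m₁ * e t - n₁ * w₁ t + κ * (-(T₁ / m₁) * R₁ t) =
      q / m₁ * e t - n₁ * w₁ t - T₁ / m₁ * κ * R₁ t := by ring
    have e2 : -(q / m₂) * e t - n₂ * w₂ t + κ * (-(T₂ / m₂) * R₂ t) =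
      -(q / m₂) * e t - n₂ * w₂ t - T₂ / m₂ * κ * R₂ t := by ring
    rw [e1, e2, mul_zero, add_zero] at h1
    refine h1.trans ?_
    have h2 : C₀ * κ * Z t * (τ * (|s t| / M + κ * (L * Z t))) ≤
        C * κ * Z t * (|s t| + κ * Z t) := by
      calc C₀ * κ * Z t * (τ * (|s t| / M + κ * (L * Z t)))
          = (C₀ * τ / M) * κ * Z t * |s t| + (C₀ * τ * L) * κ * Z t * (κ * Z t) := by ring
        _ ≤ C * κ * Z t * |s t| + C * κ * Z t * (κ * Z t) := by
          have a1 : 0 < (T₁ + T₂) * L := by positivity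
          have a2 : 0 < C₀ * τ / M := by positivity
          have a3 : 0 < C₀ * τ * L := by positivity
          gcongr <;> linarith only [hC, a1, a2, a3, hC₀]
        _ = _ := by ring
    linarith only [h2]
  · simp only [hs_def]
    have a1 : |w₁ 0| ≤ D := by
      have : 0 ≤ |w₂ 0| + |e 0| := by positivity
      linarith only [hD, this]
    have a2 : |w₂ 0| ≤ D := by
      have : 0 ≤ |w₁ 0| + |e 0| := by positivity
      linarith only [hD, this]
    have b1 : |m₁ * n₁ * R₁ 0| ≤ m₁ * n₁ * (κ * F) := by
      rw [abs_mul, abs_of_pos (by positivity : 0 < m₁ * n₁)]; gcongr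
    have b2 : |m₂ * n₂ * R₂ 0| ≤ m₂ * n₂ * (κ * F) := by
      rw [abs_mul, abs_of_pos (by positivity : 0 < m₂ * n₂)]; gcongr
    have b3 : |κ * (m₁ * w₁ 0 + m₂ * w₂ 0)| ≤ κ * (m₁ * D + m₂ * D) := by
      rw [abs_mul, abs_of_pos hκ]
      gcongr
      refine (abs_add_le _ _).trans ?_
      rw [abs_mul, abs_mul, abs_of_pos hm₁, abs_of_pos hm₂]
      gcongr
    refine (abs_add_le _ _).trans ((add_le_add (abs_add_le _ _) le_rfl).trans ?_)
    rw [hM]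
    linarith only [b1, b2, b3]
  obtain ⟨k1, k2⟩ := key
  set E₁ := Real.exp (-lam * κ ^ 2 * t) with hE₁
  set E₂ := Real.exp (-lam * t) with hE₂
  have hE₁' : Real.exp (-(γ / 2) * κ ^ 2 * t) ≤ E₁ := by
    rw [hE₁]; gcongr
  have hE₂' : Real.exp (-(μ / 2) * t) ≤ E₂ := by
    rw [hE₂]; gcongr
  have hE₁p : 0 < E₁ := Real.exp_pos _
  have hE₂p : 0 < E₂ := Real.exp_pos _
  have hDF : M * F + (m₁ + m₂) * D + D ≤ J * (D + F) := by
    have : 0 ≤ M * D + (m₁ + m₂) * F + F := by positivity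
    rw [hJ]; linarith only [this]
  have k1' : |s t| ≤ K * J * (κ * E₁ * (D + F)) := by
    refine k1.trans ?_
    calc _ ≤ K * κ * (J * (D + F)) * E₁ := by gcongr
      _ = _ := by ring
  have hJ1 : 1 ≤ J := by
    have : 0 ≤ M + m₁ + m₂ := by positivity
    linarith only [hJ, this]
  have k2' : Z t ≤ K * J * (κ ^ 2 * E₁ * (D + F) + E₂ * D) := by
    refine k2.trans ?_
    calc _ ≤ K * (1 * (D * E₂) + κ ^ 2 * (J * (D + F)) * E₁) := by rw [one_mul]; gcongr
      _ ≤ K * (J * (D * E₂) + κ ^ 2 * (J * (D + F)) * E₁) := by gcongr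
      _ = _ := by ring
  constructor
  · have b1 := hle_of_sub (hR₁s t)
    have b2 := hle_of_sub (hR₂s t)
    have h1 : κ * (L * Z t) ≤ L * K * J * (κ * E₁ * (D + F) + E₂ * D) := by
      calc κ * (L * Z t) ≤ κ * (L * (K * J * (κ ^ 2 * E₁ * (D + F) + E₂ * D))) := by gcongr
        _ = L * K * J * (κ ^ 2 * (κ * E₁ * (D + F)) + κ * (E₂ * D)) := by ring
        _ ≤ L * K * J * (1 * (κ * E₁ * (D + F)) + 1 * (E₂ * D)) := by
          gcongr
          nlinarith
        _ = _ := by ring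
    have h2 : |s t| / M ≤ K * J / M * (κ * E₁ * (D + F)) := by
      rw [div_mul_eq_mul_div]; gcongr
    have h3 : 0 ≤ K * J / M * (E₂ * D) := by positivity
    have h4 : 0 ≤ K * J * (κ * E₁ * (D + F) + E₂ * D) := by positivity
    linarith only [b1, b2, h1, h2, h3, h4]
  · refine k2'.trans ?_
    have h2 : 0 ≤ (2 * (K * J / M) + 2 * (L * K * J)) *
      (κ ^ 2 * E₁ * (D + F) + E₂ * D) := by positivity
    linarith only [h2]

/-! ### Fourier modes of the linearized system -/

/-- The curl formed with the operators `D` in place of the partial derivatives. -/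
def curlOp {X : Type*} [AddCommGroup X] (D : Fin 3 → X → X) (F : Fin 3 → X) : Fin 3 → X :=
  ![D 1 (F 2) - D 2 (F 1), D 2 (F 0) - D 0 (F 2), D 0 (F 1) - D 1 (F 0)]

/-- The evolution operator of the linearized system, with operators `D` in place of the partial
derivatives. -/
noncomputable def evolOp (P : Params) {X : Type*} [AddCommGroup X] [Module ℂ X]
    (D : Fin 3 → X → X) (V : Component → X) : Component → X
  | Sum.inl α => -∑ j, D j (V (Sum.inr (Sum.inl (α, j))))
  | Sum.inr (Sum.inl (α, j)) => ((P.mass α)⁻¹ : ℂ) •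
      (-((P.temp α : ℂ) • D j (V (Sum.inl α))) +
        (P.charge α : ℂ) • V (Sum.inr (Sum.inr (Sum.inl j))) -
        (P.mass α * P.nu α : ℂ) • V (Sum.inr (Sum.inl (α, j))))
  | Sum.inr (Sum.inr (Sum.inl j)) =>
      (P.c : ℂ) • curlOp D (fun i => V (Sum.inr (Sum.inr (Sum.inr i)))) j -
        (4 * Real.pi : ℂ) • ∑ α, (P.charge α : ℂ) • V (Sum.inr (Sum.inl (α, j)))
  | Sum.inr (Sum.inr (Sum.inr j)) =>
      -((P.c : ℂ) • curlOp D (fun i => V (Sum.inr (Sum.inr (Sum.inl i)))) j)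

/-- A Fourier mode of the system at frequency `ξ` whose magnetic field vanishes initially. -/
structure IsMode (P : Params) (ξ : Fin 3 → ℝ) (v : ℝ → Component → ℂ) : Prop where
  deriv : ∀ t a, HasDerivAt (fun s => v s a)
    (evolOp P (fun j x => (Complex.I * ξ j) * x) (v t) a) t
  gauss : ∑ j, (Complex.I * ξ j) * v 0 (Sum.inr (Sum.inr (Sum.inl j))) =
    (4 * Real.pi : ℂ) * ∑ α, (P.charge α : ℂ) * v 0 (Sum.inl α)
  magnetic : ∀ j, v 0 (Sum.inr (Sum.inr (Sum.inr j))) = 0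

lemma sum_species {X : Type*} [AddCommMonoid X] (f : Species → X) :
    ∑ α, f α = f Species.ion + f Species.electron := by
  have : (Finset.univ : Finset Species) = {Species.ion, Species.electron} := rfl
  rw [this, Finset.sum_pair (by decide)]

/-! ### Longitudinal and transverse components of a mode. -/

/-- The longitudinal part of a vector. -/
noncomputable def longit (ω : Fin 3 → ℝ) (F : Fin 3 → ℂ) : ℂ := ω 0 * F 0 + ω 1 * F 1 + ω 2 * F 2

/-- The cross product of a real and a complex vector. -/
noncomputable def crossR (ω : Fin 3 → ℝ) (F : Fin 3 → ℂ) : Fin 3 → ℂ :=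
  ![ω 1 * F 2 - ω 2 * F 1, ω 2 * F 0 - ω 0 * F 2, ω 0 * F 1 - ω 1 * F 0]

lemma norm_unit_mul_le {ω : Fin 3 → ℝ} (hω : ω 0 ^ 2 + ω 1 ^ 2 + ω 2 ^ 2 = 1) (j : Fin 3) (z : ℂ) :
    ‖(ω j : ℂ) * z‖ ≤ ‖z‖ := by
  have h1 : |ω j| ≤ 1 := by
    rw [← sq_le_one_iff_abs_le_one, ← hω, ← Fin.sum_univ_three (fun j => ω j ^ 2)]
    exact Finset.single_le_sum (f := fun j => ω j ^ 2) (fun i _ => sq_nonneg _) (Finset.mem_univ j)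
  rw [norm_mul, Complex.norm_real, Real.norm_eq_abs]
  exact mul_le_of_le_one_left (norm_nonneg _) h1

/-- This is F = ω(ω·F) - ω×(ω×F) for a unit vector ω. Transverse parts are represented by ω×F
instead of a projection, so that each component of the curl equations becomes a separate scalar
system. -/
lemma norm_apply_le_longit_add_crossR {ω : Fin 3 → ℝ} (hω : ω 0 ^ 2 + ω 1 ^ 2 + ω 2 ^ 2 = 1)
    (F : Fin 3 → ℂ) (j : Fin 3) : ‖F j‖ ≤ ‖longit ω F‖ + ∑ i, ‖crossR ω F i‖ := by
  have hω' : ((ω 0 : ℂ)) ^ 2 + (ω 1 : ℂ) ^ 2 + (ω 2 : ℂ) ^ 2 = 1 := by exact_mod_cast hω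
  have hle := norm_unit_mul_le hω
  rw [Fin.sum_univ_three]
  have key : ∀ (a b c d : Fin 3) (x y : ℂ), F j = ω a * longit ω F + (ω b * x - ω c * y) →
      ‖F j‖ ≤ ‖longit ω F‖ + (‖x‖ + ‖y‖) := fun a b c d x y h => by
    rw [h]
    refine (norm_add_le _ _).trans (add_le_add (hle _ _) ((norm_sub_le _ _).trans
      (add_le_add (hle _ _) (hle _ _))))
  have n0 := norm_nonneg (crossR ω F 0)
  have n1 := norm_nonneg (crossR ω F 1)
  have n2 := norm_nonneg (crossR ω F 2)
  fin_cases j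
  · have := key 0 2 1 0 (crossR ω F 1) (crossR ω F 2) (by
      simp [longit, crossR]; linear_combination (-F 0) * hω')
    simp only [Fin.zero_eta] at *; linarith
  · have := key 1 0 2 0 (crossR ω F 2) (crossR ω F 0) (by
      simp [longit, crossR]; linear_combination (-F 1) * hω')
    simp only [Fin.mk_one] at *; linarith
  · have := key 2 1 0 0 (crossR ω F 0) (crossR ω F 1) (by
      simp [longit, crossR]; linear_combination (-F 2) * hω')
    simp only [Fin.reduceFinMk] at *; linarith

lemma norm_longit_le {ω : Fin 3 → ℝ} (hω : ω 0 ^ 2 + ω 1 ^ 2 + ω 2 ^ 2 = 1) (F : Fin 3 → ℂ) :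
    ‖longit ω F‖ ≤ ∑ j, ‖F j‖ := by
  have hle := norm_unit_mul_le hω
  rw [Fin.sum_univ_three]
  exact (norm_add_le _ _).trans (add_le_add ((norm_add_le _ _).trans
    (add_le_add (hle _ _) (hle _ _))) (hle _ _))

lemma norm_crossR_le {ω : Fin 3 → ℝ} (hω : ω 0 ^ 2 + ω 1 ^ 2 + ω 2 ^ 2 = 1) (F : Fin 3 → ℂ)
    (i : Fin 3) : ‖crossR ω F i‖ ≤ ∑ j, ‖F j‖ := by
  have hle := norm_unit_mul_le hω
  rw [Fin.sum_univ_three]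
  have n0 := norm_nonneg (F 0)
  have n1 := norm_nonneg (F 1)
  have n2 := norm_nonneg (F 2)
  fin_cases i
  · have := (norm_sub_le (ω 1 * F 2) (ω 2 * F 1)).trans (add_le_add (hle _ _) (hle _ _))
    simp [crossR]; linarith
  · have := (norm_sub_le (ω 2 * F 0) (ω 0 * F 2)).trans (add_le_add (hle _ _) (hle _ _))
    simp [crossR]; linarith
  · have := (norm_sub_le (ω 0 * F 1) (ω 1 * F 0)).trans (add_le_add (hle _ _) (hle _ _))
    simp [crossR]; linarith

section Mode

variable {P : Params} {ξ ω : Fin 3 → ℝ} {κ : ℝ} {v : ℝ → Component → ℂ}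

/-- Velocity of a species in a mode. -/
def modeU (v : ℝ → Component → ℂ) (α : Species) (t : ℝ) : Fin 3 → ℂ :=
  fun j => v t (Sum.inr (Sum.inl (α, j)))

/-- Electric field of a mode. -/
def modeE (v : ℝ → Component → ℂ) (t : ℝ) : Fin 3 → ℂ :=
  fun j => v t (Sum.inr (Sum.inr (Sum.inl j)))

/-- Magnetic field of a mode. -/
def modeB (v : ℝ → Component → ℂ) (t : ℝ) : Fin 3 → ℂ :=
  fun j => v t (Sum.inr (Sum.inr (Sum.inr j)))

/-- The divergence of a curl vanishes, so ξ·B is constant in time, and it starts at zero. -/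
lemma IsMode.longit_magnetic (h : IsMode P ξ v) (t : ℝ) : longit ξ (modeB v t) = 0 := by
  have hd : ∀ t, HasDerivAt (fun t => longit ξ (modeB v t)) 0 t := fun t => by
    refine (((((h.deriv t (Sum.inr (Sum.inr (Sum.inr 0)))).const_mul (ξ 0 : ℂ)).fun_add
      ((h.deriv t (Sum.inr (Sum.inr (Sum.inr 1)))).const_mul (ξ 1 : ℂ))).fun_add
      ((h.deriv t (Sum.inr (Sum.inr (Sum.inr 2)))).const_mul (ξ 2 : ℂ)))).congr_deriv ?_
    simp [evolOp, curlOp]; ring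
  have := is_const_of_deriv_eq_zero (fun t => (hd t).differentiableAt) (fun t => (hd t).deriv) t 0
  rw [this]; simp [longit, modeB, h.magnetic]

/-- Conservation of charge: by Ampère's law and the two mass equations the defect in Gauss's law has
zero time derivative. -/
lemma IsMode.gauss_law (h : IsMode P ξ v) (t : ℝ) :
    Complex.I * longit ξ (modeE v t) =
      (4 * Real.pi : ℂ) * (P.e * v t (Sum.inl Species.ion) - P.e * v t (Sum.inl Species.electron)) := by
  set G : ℝ → ℂ := fun t => Complex.I * longit ξ (modeE v t) -
    (4 * Real.pi : ℂ) * (P.e * v t (Sum.inl Species.ion) - P.e * v t (Sum.inl Species.electron))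
    with hG
  have hd : ∀ t, HasDerivAt G 0 t := fun t => by
    refine ((((((h.deriv t (Sum.inr (Sum.inr (Sum.inl 0)))).const_mul (ξ 0 : ℂ)).fun_add
      ((h.deriv t (Sum.inr (Sum.inr (Sum.inl 1)))).const_mul (ξ 1 : ℂ))).fun_add
      ((h.deriv t (Sum.inr (Sum.inr (Sum.inl 2)))).const_mul (ξ 2 : ℂ)))).const_mul
        Complex.I |>.fun_sub
      ((((h.deriv t (Sum.inl Species.ion)).const_mul (P.e : ℂ)).fun_sub
        ((h.deriv t (Sum.inl Species.electron)).const_mul (P.e : ℂ))).const_mul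
          (4 * Real.pi : ℂ))).congr_deriv ?_
    simp [evolOp, curlOp, Fin.sum_univ_three, sum_species, Params.charge]; ring
  have h0 : G t = G 0 :=
    is_const_of_deriv_eq_zero (fun t => (hd t).differentiableAt) (fun t => (hd t).deriv) t 0
  have h1 : G 0 = 0 := by
    have := h.gauss
    simp [Fin.sum_univ_three, sum_species, Params.charge] at this
    simp only [hG, longit, modeE]
    linear_combination this
  have : G t = 0 := h0.trans h1
  exact sub_eq_zero.1 this

/-- The direction of a frequency. -/
structure IsDirection (ξ ω : Fin 3 → ℝ) (κ : ℝ) : Prop where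
  pos : 0 < κ
  eq : ∀ j, ξ j = κ * ω j
  unit : ω 0 ^ 2 + ω 1 ^ 2 + ω 2 ^ 2 = 1

/-- Multiplying the density by i removes the imaginary unit from the longitudinal system. Its
coefficients are then real, and the real and imaginary parts satisfy the real systems separately.
The magnetic field is multiplied by i for the same reason. -/
lemma IsMode.deriv_density (h : IsMode P ξ v) (hd : IsDirection ξ ω κ) (α : Species) (t : ℝ) :
    HasDerivAt (fun t => Complex.I * v t (Sum.inl α)) (κ • longit ω (modeU v α t)) t := by
  refine ((h.deriv t (Sum.inl α)).const_mul Complex.I).congr_deriv ?_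
  simp [evolOp, Fin.sum_univ_three, longit, modeU, hd.eq]
  linear_combination (-(κ * (ω 0 * v t (Sum.inr (Sum.inl (α, 0))) + ω 1 * v t (Sum.inr (Sum.inl (α, 1)))
    + ω 2 * v t (Sum.inr (Sum.inl (α, 2)))) : ℂ)) * Complex.I_sq

lemma IsMode.deriv_longit_velocity (h : IsMode P ξ v) (hd : IsDirection ξ ω κ) (α : Species)
    (t : ℝ) : HasDerivAt (fun t => longit ω (modeU v α t))
      ((P.charge α / P.mass α) • longit ω (modeE v t) - P.nu α • longit ω (modeU v α t) -
        (P.temp α / P.mass α * κ) • (Complex.I * v t (Sum.inl α))) t := by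
  refine (((((h.deriv t (Sum.inr (Sum.inl (α, 0)))).const_mul (ω 0 : ℂ)).fun_add
      ((h.deriv t (Sum.inr (Sum.inl (α, 1)))).const_mul (ω 1 : ℂ))).fun_add
      ((h.deriv t (Sum.inr (Sum.inl (α, 2)))).const_mul (ω 2 : ℂ)))).congr_deriv ?_
  have hm : (P.mass α : ℂ) ≠ 0 := by exact_mod_cast (P.mass_pos α).ne'
  have hu : ((ω 0 : ℂ)) ^ 2 + (ω 1 : ℂ) ^ 2 + (ω 2 : ℂ) ^ 2 = 1 := by exact_mod_cast hd.unit
  simp [evolOp, longit, modeU, modeE, hd.eq]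
  field_simp
  linear_combination (-(P.temp α * κ * Complex.I * v t (Sum.inl α) : ℂ)) * hu

lemma IsMode.deriv_longit_electric (h : IsMode P ξ v) (hd : IsDirection ξ ω κ) (t : ℝ) :
    HasDerivAt (fun t => longit ω (modeE v t))
      ((-(4 * Real.pi)) • (P.e • (longit ω (modeU v Species.ion t) -
        longit ω (modeU v Species.electron t)))) t := by
  refine (((((h.deriv t (Sum.inr (Sum.inr (Sum.inl 0)))).const_mul (ω 0 : ℂ)).fun_add
      ((h.deriv t (Sum.inr (Sum.inr (Sum.inl 1)))).const_mul (ω 1 : ℂ))).fun_add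
      ((h.deriv t (Sum.inr (Sum.inr (Sum.inl 2)))).const_mul (ω 2 : ℂ)))).congr_deriv ?_
  simp [evolOp, curlOp, sum_species, Params.charge, longit, modeU, hd.eq]
  ring

lemma IsMode.gauss_longit (h : IsMode P ξ v) (hd : IsDirection ξ ω κ) (t : ℝ) :
    κ • longit ω (modeE v t) = (-(4 * Real.pi)) • (P.e • (Complex.I * v t (Sum.inl Species.ion) -
      Complex.I * v t (Sum.inl Species.electron))) := by
  have h1 := h.gauss_law t
  have h2 : longit ξ (modeE v t) = κ * longit ω (modeE v t) := by
    simp [longit, hd.eq]; ring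
  rw [h2] at h1
  simp only [Complex.real_smul]
  push_cast
  linear_combination (-Complex.I) * h1 + (κ * longit ω (modeE v t)) * Complex.I_sq

lemma IsMode.deriv_cross_velocity (h : IsMode P ξ v) (hd : IsDirection ξ ω κ) (α : Species)
    (j : Fin 3) (t : ℝ) : HasDerivAt (fun t => crossR ω (modeU v α t) j)
      ((P.charge α / P.mass α) • crossR ω (modeE v t) j - P.nu α • crossR ω (modeU v α t) j) t := by
  have hm : (P.mass α : ℂ) ≠ 0 := by exact_mod_cast (P.mass_pos α).ne'
  have hu := fun i => h.deriv t (Sum.inr (Sum.inl (α, i)))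
  fin_cases j
  · refine (((hu 2).const_mul (ω 1 : ℂ)).fun_sub ((hu 1).const_mul (ω 2 : ℂ))).congr_deriv ?_
    simp [evolOp, crossR, modeU, modeE, hd.eq]; field_simp; ring
  · refine (((hu 0).const_mul (ω 2 : ℂ)).fun_sub ((hu 2).const_mul (ω 0 : ℂ))).congr_deriv ?_
    simp [evolOp, crossR, modeU, modeE, hd.eq]; field_simp; ring
  · refine (((hu 1).const_mul (ω 0 : ℂ)).fun_sub ((hu 0).const_mul (ω 1 : ℂ))).congr_deriv ?_
    simp [evolOp, crossR, modeU, modeE, hd.eq]; field_simp; ring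

/-- The magnetic contribution is ω×(ω×B) = (ω·B)ω - B, and ω·B = 0 along the mode. -/
lemma IsMode.deriv_cross_electric (h : IsMode P ξ v) (hd : IsDirection ξ ω κ)
    (j : Fin 3) (t : ℝ) : HasDerivAt (fun t => crossR ω (modeE v t) j)
      ((-(4 * Real.pi)) • (P.e • (crossR ω (modeU v Species.ion t) j -
        crossR ω (modeU v Species.electron t) j)) -
        (P.c * κ) • (Complex.I * modeB v t j)) t := by
  have hE := fun i => h.deriv t (Sum.inr (Sum.inr (Sum.inl i)))
  have hu : ((ω 0 : ℂ)) ^ 2 + (ω 1 : ℂ) ^ 2 + (ω 2 : ℂ) ^ 2 = 1 := by exact_mod_cast hd.unit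
  have hB : longit ω (modeB v t) = 0 := by
    have h1 := h.longit_magnetic t
    have h2 : longit ξ (modeB v t) = κ * longit ω (modeB v t) := by
      simp [longit, hd.eq]; ring
    rw [h2] at h1
    have hκ : (κ : ℂ) ≠ 0 := by exact_mod_cast hd.pos.ne'
    exact (mul_eq_zero.1 h1).resolve_left hκ
  simp only [longit, modeB] at hB
  fin_cases j
  · refine (((hE 2).const_mul (ω 1 : ℂ)).fun_sub ((hE 1).const_mul (ω 2 : ℂ))).congr_deriv ?_
    simp [evolOp, curlOp, sum_species, Params.charge, crossR, modeU, modeB, hd.eq]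
    linear_combination (P.c * Complex.I * κ * ω 0 : ℂ) * hB -
      (P.c * Complex.I * κ * v t (Sum.inr (Sum.inr (Sum.inr 0))) : ℂ) * hu
  · refine (((hE 0).const_mul (ω 2 : ℂ)).fun_sub ((hE 2).const_mul (ω 0 : ℂ))).congr_deriv ?_
    simp [evolOp, curlOp, sum_species, Params.charge, crossR, modeU, modeB, hd.eq]
    linear_combination (P.c * Complex.I * κ * ω 1 : ℂ) * hB -
      (P.c * Complex.I * κ * v t (Sum.inr (Sum.inr (Sum.inr 1))) : ℂ) * hu
  · refine (((hE 1).const_mul (ω 0 : ℂ)).fun_sub ((hE 0).const_mul (ω 1 : ℂ))).congr_deriv ?_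
    simp [evolOp, curlOp, sum_species, Params.charge, crossR, modeU, modeB, hd.eq]
    linear_combination (P.c * Complex.I * κ * ω 2 : ℂ) * hB -
      (P.c * Complex.I * κ * v t (Sum.inr (Sum.inr (Sum.inr 2))) : ℂ) * hu

lemma IsMode.deriv_magnetic (h : IsMode P ξ v) (hd : IsDirection ξ ω κ)
    (j : Fin 3) (t : ℝ) : HasDerivAt (fun t => Complex.I * modeB v t j)
      ((P.c * κ) • crossR ω (modeE v t) j) t := by
  refine ((h.deriv t (Sum.inr (Sum.inr (Sum.inr j)))).const_mul Complex.I).congr_deriv ?_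
  fin_cases j <;> simp [evolOp, curlOp, crossR, modeE, hd.eq]
  · linear_combination (-(P.c * κ * (ω 1 * v t (Sum.inr (Sum.inr (Sum.inl 2))) -
      ω 2 * v t (Sum.inr (Sum.inr (Sum.inl 1))))) : ℂ) * Complex.I_sq
  · linear_combination (-(P.c * κ * (ω 2 * v t (Sum.inr (Sum.inr (Sum.inl 0))) -
      ω 0 * v t (Sum.inr (Sum.inr (Sum.inl 2))))) : ℂ) * Complex.I_sq
  · linear_combination (-(P.c * κ * (ω 0 * v t (Sum.inr (Sum.inr (Sum.inl 1))) -
      ω 1 * v t (Sum.inr (Sum.inr (Sum.inl 0))))) : ℂ) * Complex.I_sq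

end Mode

lemma HasDerivAt.re_part {f : ℝ → ℂ} {f' : ℂ} {t : ℝ} (h : HasDerivAt f f' t) :
    HasDerivAt (fun s => (f s).re) f'.re t :=
  Complex.reCLM.hasFDerivAt.comp_hasDerivAt t h

lemma HasDerivAt.im_part {f : ℝ → ℂ} {f' : ℂ} {t : ℝ} (h : HasDerivAt f f' t) :
    HasDerivAt (fun s => (f s).im) f'.im t :=
  Complex.imCLM.hasFDerivAt.comp_hasDerivAt t h

/-! ### Decay of complex modes, uniform in the frequency. -/

section Constants

variable (P : Params)

/-- Applies the two low-frequency real lemmas to real and imaginary parts and reassembles the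
vectors. `F` measures the flux in ρ = ∇·f, so that the densities start at size κF. The magnetic
bound is free of `F` because the transverse system does not involve the densities. -/
lemma low_mode_decay :
    ∃ r lam K : ℝ, 0 < r ∧ 0 < lam ∧ 0 < K ∧ ∀ (ξ ω : Fin 3 → ℝ) (κ : ℝ), IsDirection ξ ω κ →
      κ ≤ r → ∀ v, IsMode P ξ v → ∀ F, (∀ α, ‖v 0 (Sum.inl α)‖ ≤ κ * F) → ∀ t, 0 ≤ t →
      let N := ∑ a, ‖v 0 a‖
      (∀ α, ‖v t (Sum.inl α)‖ ≤
        K * (κ * Real.exp (-lam * κ ^ 2 * t) * (N + F) + Real.exp (-lam * t) * N)) ∧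
      (∀ α j, ‖modeU v α t j‖ ≤
        K * (κ ^ 2 * Real.exp (-lam * κ ^ 2 * t) * (N + F) + Real.exp (-lam * t) * N)) ∧
      (∀ j, ‖modeE v t j‖ ≤
        K * (κ ^ 2 * Real.exp (-lam * κ ^ 2 * t) * (N + F) + Real.exp (-lam * t) * N)) ∧
      (∀ j, ‖modeB v t j‖ ≤
        K * (κ * Real.exp (-lam * κ ^ 2 * t) * N + Real.exp (-lam * t) * N)) := by
  have hp : 0 < 4 * Real.pi := by positivity
  obtain ⟨r₁, lam₁, K₁, hr₁, hlam₁, hK₁, hL⟩ := longitudinal_low_decay hp P.e_pos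
    (P.mass_pos Species.ion) (P.mass_pos Species.electron) (P.nu_pos Species.ion)
    (P.nu_pos Species.electron) (P.temp_pos Species.ion) (P.temp_pos Species.electron)
  obtain ⟨r₂, lam₂, K₂, hr₂, hlam₂, hK₂, hT⟩ := transverse_low_decay hp P.e_pos
    (P.mass_pos Species.ion) (P.mass_pos Species.electron) (P.nu_pos Species.ion)
    (P.nu_pos Species.electron) P.c_pos
  obtain ⟨lam, hlam, hl₁, hl₂, -⟩ := exists_pos_le_of_pos hlam₁ hlam₂ one_pos
  refine ⟨min r₁ r₂, lam, 6 * K₁ + 18 * K₂, by positivity, hlam, by positivity, ?_⟩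
  intro ξ ω κ hd hκr v hv F hF t ht N
  have hκ := hd.pos
  have hF0 : 0 ≤ F := nonneg_of_mul_nonneg_right ((norm_nonneg _).trans (hF Species.ion)) hκ
  have hN : 0 ≤ N := by positivity
  set X := Real.exp (-lam * κ ^ 2 * t) with hX
  set Y := Real.exp (-lam * t) with hY
  have hX0 : 0 < X := Real.exp_pos _
  have hY0 : 0 < Y := Real.exp_pos _
  have hX₁ : Real.exp (-lam₁ * κ ^ 2 * t) ≤ X := by rw [hX]; gcongr
  have hX₂ : Real.exp (-lam₂ * κ ^ 2 * t) ≤ X := by rw [hX]; gcongr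
  have hY₁ : Real.exp (-lam₁ * t) ≤ Y := by rw [hY]; gcongr
  have hY₂ : Real.exp (-lam₂ * t) ≤ Y := by rw [hY]; gcongr
  have hNsum : ∑ α, ‖v 0 (Sum.inl α)‖ + (∑ j, ‖modeU v Species.ion 0 j‖ +
      ∑ j, ‖modeU v Species.electron 0 j‖ + (∑ j, ‖modeE v 0 j‖ + ∑ j, ‖modeB v 0 j‖)) = N := by
    simp only [N, Fintype.sum_sum_type, Fintype.sum_prod_type]
    rw [sum_species (fun α => ∑ j, ‖v 0 (Sum.inr (Sum.inl (α, j)))‖)]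
    rfl
  have n0 : 0 ≤ ∑ α, ‖v 0 (Sum.inl α)‖ := by positivity
  have n4 : 0 ≤ ∑ j, ‖modeB v 0 j‖ := by positivity
  have hinit : ∀ a b c : ℂ, ‖a‖ ≤ ∑ j, ‖modeU v Species.ion 0 j‖ →
      ‖b‖ ≤ ∑ j, ‖modeU v Species.electron 0 j‖ → ‖c‖ ≤ ∑ j, ‖modeE v 0 j‖ →
      |a.re| + |b.re| + |c.re| ≤ N ∧ |a.im| + |b.im| + |c.im| ≤ N := fun a b c ha hb hc => by
    constructor
    · linarith [Complex.abs_re_le_norm a, Complex.abs_re_le_norm b, Complex.abs_re_le_norm c]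
    · linarith [Complex.abs_im_le_norm a, Complex.abs_im_le_norm b, Complex.abs_im_le_norm c]
  -- longitudinal part
  have hIρ : ∀ α s, ‖Complex.I * v s (Sum.inl α)‖ = ‖v s (Sum.inl α)‖ := fun α s => by simp
  have hLi := hinit (longit ω (modeU v Species.ion 0)) (longit ω (modeU v Species.electron 0))
    (longit ω (modeE v 0)) (norm_longit_le hd.unit _) (norm_longit_le hd.unit _)
    (norm_longit_le hd.unit _)
  have hLre := hL κ hκ (hκr.trans (min_le_left _ _))
    (fun s => (Complex.I * v s (Sum.inl Species.ion)).re)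
    (fun s => (Complex.I * v s (Sum.inl Species.electron)).re)
    (fun s => (longit ω (modeU v Species.ion s)).re)
    (fun s => (longit ω (modeU v Species.electron s)).re)
    (fun s => (longit ω (modeE v s)).re)
    (fun s => by simpa using HasDerivAt.re_part (hv.deriv_density hd Species.ion s))
    (fun s => by simpa using HasDerivAt.re_part (hv.deriv_density hd Species.electron s))
    (fun s => (HasDerivAt.re_part (hv.deriv_longit_velocity hd Species.ion s)).congr_deriv
      (by simp only [Complex.sub_re, Complex.smul_re, smul_eq_mul, Params.charge]))
    (fun s => (HasDerivAt.re_part (hv.deriv_longit_velocity hd Species.electron s)).congr_deriv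
      (by simp only [Complex.sub_re, Complex.smul_re, smul_eq_mul, Params.charge, neg_div]))
    (fun s => (HasDerivAt.re_part (hv.deriv_longit_electric hd s)).congr_deriv
      (by simp only [Complex.sub_re, Complex.smul_re, smul_eq_mul]))
    (fun s => by
      have := congrArg Complex.re (hv.gauss_longit hd s)
      simpa only [Complex.sub_re, Complex.smul_re, smul_eq_mul] using this)
    N F hLi.1
    ((Complex.abs_re_le_norm _).trans ((hIρ _ _).trans_le (hF _)))
    ((Complex.abs_re_le_norm _).trans ((hIρ _ _).trans_le (hF _))) t ht
  have hLim := hL κ hκ (hκr.trans (min_le_left _ _))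
    (fun s => (Complex.I * v s (Sum.inl Species.ion)).im)
    (fun s => (Complex.I * v s (Sum.inl Species.electron)).im)
    (fun s => (longit ω (modeU v Species.ion s)).im)
    (fun s => (longit ω (modeU v Species.electron s)).im)
    (fun s => (longit ω (modeE v s)).im)
    (fun s => by simpa using HasDerivAt.im_part (hv.deriv_density hd Species.ion s))
    (fun s => by simpa using HasDerivAt.im_part (hv.deriv_density hd Species.electron s))
    (fun s => (HasDerivAt.im_part (hv.deriv_longit_velocity hd Species.ion s)).congr_deriv
      (by simp only [Complex.sub_im, Complex.smul_im, smul_eq_mul, Params.charge]))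
    (fun s => (HasDerivAt.im_part (hv.deriv_longit_velocity hd Species.electron s)).congr_deriv
      (by simp only [Complex.sub_im, Complex.smul_im, smul_eq_mul, Params.charge, neg_div]))
    (fun s => (HasDerivAt.im_part (hv.deriv_longit_electric hd s)).congr_deriv
      (by simp only [Complex.sub_im, Complex.smul_im, smul_eq_mul]))
    (fun s => by
      have := congrArg Complex.im (hv.gauss_longit hd s)
      simpa only [Complex.sub_im, Complex.smul_im, smul_eq_mul] using this)
    N F hLi.2
    ((Complex.abs_im_le_norm _).trans ((hIρ _ _).trans_le (hF _)))
    ((Complex.abs_im_le_norm _).trans ((hIρ _ _).trans_le (hF _))) t ht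
  set A₁ := κ * X * (N + F) + Y * N with hA₁
  set A₂ := κ ^ 2 * X * (N + F) + Y * N with hA₂
  have hA₁0 : 0 ≤ A₁ := by positivity
  have hA₂0 : 0 ≤ A₂ := by positivity
  have hb₁ : K₁ * (κ * Real.exp (-lam₁ * κ ^ 2 * t) * (N + F) + Real.exp (-lam₁ * t) * N) ≤
      K₁ * A₁ := by rw [hA₁]; gcongr
  have hb₂ : K₁ * (κ ^ 2 * Real.exp (-lam₁ * κ ^ 2 * t) * (N + F) + Real.exp (-lam₁ * t) * N) ≤
      K₁ * A₂ := by rw [hA₂]; gcongr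
  have hρ : ∀ α, ‖v t (Sum.inl α)‖ ≤ 2 * K₁ * A₁ := fun α => by
    rw [← hIρ]
    refine (Complex.norm_le_abs_re_add_abs_im _).trans ?_
    have h1 := hLre.1.trans hb₁
    have h2 := hLim.1.trans hb₁
    have p1 := abs_nonneg (Complex.I * v t (Sum.inl Species.ion)).re
    have p2 := abs_nonneg (Complex.I * v t (Sum.inl Species.electron)).re
    have p3 := abs_nonneg (Complex.I * v t (Sum.inl Species.ion)).im
    have p4 := abs_nonneg (Complex.I * v t (Sum.inl Species.electron)).im
    cases α <;> linarith only [h1, h2, p1, p2, p3, p4]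
  have hlong : ‖longit ω (modeU v Species.ion t)‖ + ‖longit ω (modeU v Species.electron t)‖ +
      ‖longit ω (modeE v t)‖ ≤ 2 * K₁ * A₂ := by
    have h1 := hLre.2.trans hb₂
    have h2 := hLim.2.trans hb₂
    have p1 := Complex.norm_le_abs_re_add_abs_im (longit ω (modeU v Species.ion t))
    have p2 := Complex.norm_le_abs_re_add_abs_im (longit ω (modeU v Species.electron t))
    have p3 := Complex.norm_le_abs_re_add_abs_im (longit ω (modeE v t))
    linarith only [h1, h2, p1, p2, p3]
  -- transverse part
  have hTj : ∀ j, ‖modeB v t j‖ ≤ 2 * K₂ * (κ * X * N + Y * N) ∧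
      ‖crossR ω (modeU v Species.ion t) j‖ + ‖crossR ω (modeU v Species.electron t) j‖ +
        ‖crossR ω (modeE v t) j‖ ≤ 2 * K₂ * A₂ := fun j => by
    have hi := hinit (crossR ω (modeU v Species.ion 0) j)
      (crossR ω (modeU v Species.electron 0) j) (crossR ω (modeE v 0) j)
      (norm_crossR_le hd.unit _ _) (norm_crossR_le hd.unit _ _) (norm_crossR_le hd.unit _ _)
    have hre := hT κ hκ (hκr.trans (min_le_right _ _))
      (fun s => (crossR ω (modeU v Species.ion s) j).re)
      (fun s => (crossR ω (modeU v Species.electron s) j).re)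
      (fun s => (crossR ω (modeE v s) j).re) (fun s => (Complex.I * modeB v s j).re)
      (fun s => (HasDerivAt.re_part (hv.deriv_cross_velocity hd Species.ion j s)).congr_deriv
        (by simp only [Complex.sub_re, Complex.smul_re, smul_eq_mul, Params.charge]))
      (fun s => (HasDerivAt.re_part (hv.deriv_cross_velocity hd Species.electron j s)).congr_deriv
        (by simp only [Complex.sub_re, Complex.smul_re, smul_eq_mul, Params.charge, neg_div]))
      (fun s => (HasDerivAt.re_part (hv.deriv_cross_electric hd j s)).congr_deriv
        (by simp only [Complex.sub_re, Complex.smul_re, smul_eq_mul]))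
      (fun s => (HasDerivAt.re_part (hv.deriv_magnetic hd j s)).congr_deriv
        (by simp only [Complex.smul_re, smul_eq_mul]))
      (by simp [modeB, hv.magnetic]) N hi.1 t ht
    have him := hT κ hκ (hκr.trans (min_le_right _ _))
      (fun s => (crossR ω (modeU v Species.ion s) j).im)
      (fun s => (crossR ω (modeU v Species.electron s) j).im)
      (fun s => (crossR ω (modeE v s) j).im) (fun s => (Complex.I * modeB v s j).im)
      (fun s => (HasDerivAt.im_part (hv.deriv_cross_velocity hd Species.ion j s)).congr_deriv
        (by simp only [Complex.sub_im, Complex.smul_im, smul_eq_mul, Params.charge]))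
      (fun s => (HasDerivAt.im_part (hv.deriv_cross_velocity hd Species.electron j s)).congr_deriv
        (by simp only [Complex.sub_im, Complex.smul_im, smul_eq_mul, Params.charge, neg_div]))
      (fun s => (HasDerivAt.im_part (hv.deriv_cross_electric hd j s)).congr_deriv
        (by simp only [Complex.sub_im, Complex.smul_im, smul_eq_mul]))
      (fun s => (HasDerivAt.im_part (hv.deriv_magnetic hd j s)).congr_deriv
        (by simp only [Complex.smul_im, smul_eq_mul]))
      (by simp [modeB, hv.magnetic]) N hi.2 t ht
    have hc₁ : K₂ * (κ * Real.exp (-lam₂ * κ ^ 2 * t) + Real.exp (-lam₂ * t)) * N ≤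
        K₂ * (κ * X * N + Y * N) := by
      rw [mul_assoc, ← add_mul]; gcongr
    have hc₂ : K₂ * (κ ^ 2 * Real.exp (-lam₂ * κ ^ 2 * t) + Real.exp (-lam₂ * t)) * N ≤
        K₂ * A₂ := by
      rw [mul_assoc, add_mul]
      refine mul_le_mul_of_nonneg_left ?_ hK₂.le
      rw [hA₂]
      have hNF : N ≤ N + F := by linarith only [hF0]
      gcongr
    constructor
    · have hIB : ‖Complex.I * modeB v t j‖ = ‖modeB v t j‖ := by simp
      rw [← hIB]
      have h1 := hre.1.trans hc₁
      have h2 := him.1.trans hc₁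
      have p1 := Complex.norm_le_abs_re_add_abs_im (Complex.I * modeB v t j)
      linarith only [h1, h2, p1]
    · have h1 := hre.2.trans hc₂
      have h2 := him.2.trans hc₂
      have p1 := Complex.norm_le_abs_re_add_abs_im (crossR ω (modeU v Species.ion t) j)
      have p2 := Complex.norm_le_abs_re_add_abs_im (crossR ω (modeU v Species.electron t) j)
      have p3 := Complex.norm_le_abs_re_add_abs_im (crossR ω (modeE v t) j)
      linarith only [h1, h2, p1, p2, p3]
  have hcrossSum : ∀ G : Fin 3 → ℂ, (∀ j, ‖G j‖ ≤ 2 * K₂ * A₂) → ∑ j, ‖G j‖ ≤ 6 * K₂ * A₂ :=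
    fun G hG => by
      rw [Fin.sum_univ_three]; linarith [hG 0, hG 1, hG 2]
  have hKA : 0 ≤ K₁ * A₂ ∧ 0 ≤ K₂ * A₂ ∧ 0 ≤ K₁ * A₁ ∧ 0 ≤ K₂ * A₁ :=
    ⟨by positivity, by positivity, by positivity, by positivity⟩
  refine ⟨fun α => (hρ α).trans (by linarith only [hKA.1, hKA.2.1, hKA.2.2.1, hKA.2.2.2]),
    fun α j => ?_, fun j => ?_, fun j => ?_⟩
  · refine (norm_apply_le_longit_add_crossR hd.unit _ j).trans ?_
    have h1 : ‖longit ω (modeU v α t)‖ ≤ 2 * K₁ * A₂ := by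
      cases α
      · linarith only [hlong, norm_nonneg (longit ω (modeU v Species.electron t)),
          norm_nonneg (longit ω (modeE v t))]
      · linarith only [hlong, norm_nonneg (longit ω (modeU v Species.ion t)),
          norm_nonneg (longit ω (modeE v t))]
    have h2 := hcrossSum (crossR ω (modeU v α t)) fun j => by
      have h3 := (hTj j).2
      cases α
      · linarith only [h3, norm_nonneg (crossR ω (modeU v Species.electron t) j),
          norm_nonneg (crossR ω (modeE v t) j)]
      · linarith only [h3, norm_nonneg (crossR ω (modeU v Species.ion t) j),
          norm_nonneg (crossR ω (modeE v t) j)]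
    linarith only [h1, h2, hKA.1, hKA.2.1]
  · refine (norm_apply_le_longit_add_crossR hd.unit _ j).trans ?_
    have h1 : ‖longit ω (modeE v t)‖ ≤ 2 * K₁ * A₂ := by
      linarith only [hlong, norm_nonneg (longit ω (modeU v Species.ion t)),
          norm_nonneg (longit ω (modeU v Species.electron t))]
    have h2 := hcrossSum (crossR ω (modeE v t)) fun j => by
      have h3 := (hTj j).2
      linarith only [h3, norm_nonneg (crossR ω (modeU v Species.electron t) j),
          norm_nonneg (crossR ω (modeU v Species.ion t) j)]
    linarith only [h1, h2, hKA.1, hKA.2.1]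
  · refine (hTj j).1.trans ?_
    have : 0 ≤ (6 * K₁ + 16 * K₂) * (κ * X * N + Y * N) := by positivity
    linarith only [this]

lemma high_mode_decay {r : ℝ} (hr : 0 < r) :
    ∃ lam K : ℝ, 0 < lam ∧ 0 < K ∧ ∀ (ξ ω : Fin 3 → ℝ) (κ : ℝ), IsDirection ξ ω κ →
      r ≤ κ → ∀ v, IsMode P ξ v → ∀ t, 0 ≤ t → ∀ a,
      ‖v t a‖ ≤ K * Real.exp (-(lam * κ⁻¹ ^ 2) * t) * ∑ a, ‖v 0 a‖ := by
  have hp : 0 < 4 * Real.pi := by positivity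
  obtain ⟨lam₁, K₁, hlam₁, hK₁, hL⟩ := longitudinal_high_decay (q := P.e) hp
    (P.mass_pos Species.ion) (P.mass_pos Species.electron) (P.nu_pos Species.ion)
    (P.nu_pos Species.electron) (P.temp_pos Species.ion) (P.temp_pos Species.electron) hr
  obtain ⟨lam₂, K₂, hlam₂, hK₂, hT⟩ := transverse_high_decay hp P.e_pos
    (P.mass_pos Species.ion) (P.mass_pos Species.electron) (P.nu_pos Species.ion)
    (P.nu_pos Species.electron) P.c_pos hr
  -- The longitudinal rate `lam₁` is uniform; since rκ⁻¹ ≤ 1 it is at least `lam₁ * r ^ 2 * κ⁻¹ ^ 2`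
  -- and can be weakened to the transverse form. The real lemmas bound squares, which is why the
  -- final rate is `lam / 2`.
  obtain ⟨lam, hlam, hl₁, hl₂, -⟩ := exists_pos_le_of_pos
    (show 0 < lam₁ * r ^ 2 by positivity) hlam₂ one_pos
  set J : ℝ := √(5 * K₁) + √(4 * K₂) with hJ
  refine ⟨lam / 2, 4 * J, by positivity, by positivity, ?_⟩
  intro ξ ω κ hd hκr v hv t ht a
  have hκ := hd.pos
  set N := ∑ a, ‖v 0 a‖ with hN
  have hN0 : 0 ≤ N := by positivity
  set X := Real.exp (-(lam / 2 * κ⁻¹ ^ 2) * t) with hX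
  have hX0 : 0 < X := Real.exp_pos _
  have hX2 : X ^ 2 = Real.exp (-(lam * κ⁻¹ ^ 2) * t) := by
    rw [hX, ← Real.exp_nat_mul]; congr 1; push_cast; ring
  have hX₁ : Real.exp (-lam₁ * t) ≤ X ^ 2 := by
    rw [hX2]
    gcongr
    calc lam * κ⁻¹ ^ 2 ≤ lam₁ * r ^ 2 * κ⁻¹ ^ 2 := by gcongr
      _ = lam₁ * (r * κ⁻¹) ^ 2 := by ring
      _ ≤ lam₁ * 1 ^ 2 := by
        gcongr
        rw [← div_eq_mul_inv]; exact (div_le_one hκ).2 hκr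
      _ = lam₁ := by ring
  have hX₂ : Real.exp (-(lam₂ * κ⁻¹ ^ 2) * t) ≤ X ^ 2 := by rw [hX2]; gcongr
  have hle : ∀ a, ‖v 0 a‖ ≤ N := fun a =>
    Finset.single_le_sum (f := fun a => ‖v 0 a‖) (fun _ _ => norm_nonneg _) (Finset.mem_univ a)
  have hNsum : ∑ α, ‖v 0 (Sum.inl α)‖ + (∑ j, ‖modeU v Species.ion 0 j‖ +
      ∑ j, ‖modeU v Species.electron 0 j‖ + (∑ j, ‖modeE v 0 j‖ + ∑ j, ‖modeB v 0 j‖)) = N := by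
    simp only [N, Fintype.sum_sum_type, Fintype.sum_prod_type]
    rw [sum_species (fun α => ∑ j, ‖v 0 (Sum.inr (Sum.inl (α, j)))‖)]
    rfl
  have n0 : 0 ≤ ∑ α, ‖v 0 (Sum.inl α)‖ := by positivity
  have n1 : 0 ≤ ∑ j, ‖modeU v Species.ion 0 j‖ := by positivity
  have n2 : 0 ≤ ∑ j, ‖modeU v Species.electron 0 j‖ := by positivity
  have n3 : 0 ≤ ∑ j, ‖modeE v 0 j‖ := by positivity
  have n4 : 0 ≤ ∑ j, ‖modeB v 0 j‖ := by positivity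
  have hUle : ∀ α, ∑ j, ‖modeU v α 0 j‖ ≤ N := fun α => by
    cases α <;> linarith only [hNsum, n0, n1, n2, n3, n4]
  have hEle : ∑ j, ‖modeE v 0 j‖ ≤ N := by linarith only [hNsum, n0, n1, n2, n3, n4]
  have hsq : ∀ z : ℂ, ‖z‖ ^ 2 = z.re ^ 2 + z.im ^ 2 := fun z => by
    rw [Complex.sq_norm, Complex.normSq_apply]; ring
  have hIρ : ∀ α s, ‖Complex.I * v s (Sum.inl α)‖ = ‖v s (Sum.inl α)‖ := fun α s => by simp
  have hIB : ∀ s j, ‖Complex.I * modeB v s j‖ = ‖modeB v s j‖ := fun s j => by simp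
  have hLre := hL κ hκr
    (fun s => (Complex.I * v s (Sum.inl Species.ion)).re)
    (fun s => (Complex.I * v s (Sum.inl Species.electron)).re)
    (fun s => (longit ω (modeU v Species.ion s)).re)
    (fun s => (longit ω (modeU v Species.electron s)).re)
    (fun s => (longit ω (modeE v s)).re)
    (fun s => by simpa using HasDerivAt.re_part (hv.deriv_density hd Species.ion s))
    (fun s => by simpa using HasDerivAt.re_part (hv.deriv_density hd Species.electron s))
    (fun s => (HasDerivAt.re_part (hv.deriv_longit_velocity hd Species.ion s)).congr_deriv
      (by simp only [Complex.sub_re, Complex.smul_re, smul_eq_mul, Params.charge]))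
    (fun s => (HasDerivAt.re_part (hv.deriv_longit_velocity hd Species.electron s)).congr_deriv
      (by simp only [Complex.sub_re, Complex.smul_re, smul_eq_mul, Params.charge, neg_div]))
    (fun s => (HasDerivAt.re_part (hv.deriv_longit_electric hd s)).congr_deriv
      (by simp only [Complex.sub_re, Complex.smul_re, smul_eq_mul]))
    (fun s => by
      have := congrArg Complex.re (hv.gauss_longit hd s)
      simpa only [Complex.sub_re, Complex.smul_re, smul_eq_mul] using this) t ht
  have hLim := hL κ hκr
    (fun s => (Complex.I * v s (Sum.inl Species.ion)).im)
    (fun s => (Complex.I * v s (Sum.inl Species.electron)).im)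
    (fun s => (longit ω (modeU v Species.ion s)).im)
    (fun s => (longit ω (modeU v Species.electron s)).im)
    (fun s => (longit ω (modeE v s)).im)
    (fun s => by simpa using HasDerivAt.im_part (hv.deriv_density hd Species.ion s))
    (fun s => by simpa using HasDerivAt.im_part (hv.deriv_density hd Species.electron s))
    (fun s => (HasDerivAt.im_part (hv.deriv_longit_velocity hd Species.ion s)).congr_deriv
      (by simp only [Complex.sub_im, Complex.smul_im, smul_eq_mul, Params.charge]))
    (fun s => (HasDerivAt.im_part (hv.deriv_longit_velocity hd Species.electron s)).congr_deriv
      (by simp only [Complex.sub_im, Complex.smul_im, smul_eq_mul, Params.charge, neg_div]))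
    (fun s => (HasDerivAt.im_part (hv.deriv_longit_electric hd s)).congr_deriv
      (by simp only [Complex.sub_im, Complex.smul_im, smul_eq_mul]))
    (fun s => by
      have := congrArg Complex.im (hv.gauss_longit hd s)
      simpa only [Complex.sub_im, Complex.smul_im, smul_eq_mul] using this) t ht
  have hlong : ‖v t (Sum.inl Species.ion)‖ ^ 2 + ‖v t (Sum.inl Species.electron)‖ ^ 2 +
      (‖longit ω (modeU v Species.ion t)‖ ^ 2 + ‖longit ω (modeU v Species.electron t)‖ ^ 2) +
      ‖longit ω (modeE v t)‖ ^ 2 ≤ 5 * K₁ * X ^ 2 * N ^ 2 := by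
    have h0 : ‖v 0 (Sum.inl Species.ion)‖ ^ 2 + ‖v 0 (Sum.inl Species.electron)‖ ^ 2 +
      (‖longit ω (modeU v Species.ion 0)‖ ^ 2 + ‖longit ω (modeU v Species.electron 0)‖ ^ 2) +
      ‖longit ω (modeE v 0)‖ ^ 2 ≤ 5 * N ^ 2 := by
      have a1 := pow_le_pow_left₀ (norm_nonneg _) (hle (Sum.inl Species.ion)) 2
      have a2 := pow_le_pow_left₀ (norm_nonneg _) (hle (Sum.inl Species.electron)) 2
      have a3 := pow_le_pow_left₀ (norm_nonneg _)
        ((norm_longit_le hd.unit (modeU v Species.ion 0)).trans (hUle _)) 2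
      have a4 := pow_le_pow_left₀ (norm_nonneg _)
        ((norm_longit_le hd.unit (modeU v Species.electron 0)).trans (hUle _)) 2
      have a5 := pow_le_pow_left₀ (norm_nonneg _)
        ((norm_longit_le hd.unit (modeE v 0)).trans hEle) 2
      linarith only [a1, a2, a3, a4, a5]
    simp only [← hIρ, hsq] at h0 ⊢
    calc _ ≤ K₁ * Real.exp (-lam₁ * t) * (5 * N ^ 2) := by
          refine le_trans ?_ (mul_le_mul_of_nonneg_left h0 (by positivity))
          linarith only [hLre, hLim]
      _ ≤ K₁ * X ^ 2 * (5 * N ^ 2) := by gcongr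
      _ = _ := by ring
  have htrans : ∀ j, ‖crossR ω (modeU v Species.ion t) j‖ ^ 2 +
      ‖crossR ω (modeU v Species.electron t) j‖ ^ 2 + ‖crossR ω (modeE v t) j‖ ^ 2 +
      ‖modeB v t j‖ ^ 2 ≤ 4 * K₂ * X ^ 2 * N ^ 2 := fun j => by
    have h0 : ‖crossR ω (modeU v Species.ion 0) j‖ ^ 2 +
      ‖crossR ω (modeU v Species.electron 0) j‖ ^ 2 + ‖crossR ω (modeE v 0) j‖ ^ 2 +
      ‖modeB v 0 j‖ ^ 2 ≤ 4 * N ^ 2 := by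
      have a1 := pow_le_pow_left₀ (norm_nonneg _)
        ((norm_crossR_le hd.unit (modeU v Species.ion 0) j).trans (hUle _)) 2
      have a2 := pow_le_pow_left₀ (norm_nonneg _)
        ((norm_crossR_le hd.unit (modeU v Species.electron 0) j).trans (hUle _)) 2
      have a3 := pow_le_pow_left₀ (norm_nonneg _)
        ((norm_crossR_le hd.unit (modeE v 0) j).trans hEle) 2
      have a4 := pow_le_pow_left₀ (norm_nonneg _) (hle (Sum.inr (Sum.inr (Sum.inr j)))) 2
      change _ + ‖v 0 (Sum.inr (Sum.inr (Sum.inr j)))‖ ^ 2 ≤ _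
      linarith only [a1, a2, a3, a4]
    have hre := hT κ hκr
      (fun s => (crossR ω (modeU v Species.ion s) j).re)
      (fun s => (crossR ω (modeU v Species.electron s) j).re)
      (fun s => (crossR ω (modeE v s) j).re) (fun s => (Complex.I * modeB v s j).re)
      (fun s => (HasDerivAt.re_part (hv.deriv_cross_velocity hd Species.ion j s)).congr_deriv
        (by simp only [Complex.sub_re, Complex.smul_re, smul_eq_mul, Params.charge]))
      (fun s => (HasDerivAt.re_part (hv.deriv_cross_velocity hd Species.electron j s)).congr_deriv
        (by simp only [Complex.sub_re, Complex.smul_re, smul_eq_mul, Params.charge, neg_div]))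
      (fun s => (HasDerivAt.re_part (hv.deriv_cross_electric hd j s)).congr_deriv
        (by simp only [Complex.sub_re, Complex.smul_re, smul_eq_mul]))
      (fun s => (HasDerivAt.re_part (hv.deriv_magnetic hd j s)).congr_deriv
        (by simp only [Complex.smul_re, smul_eq_mul])) t ht
    have him := hT κ hκr
      (fun s => (crossR ω (modeU v Species.ion s) j).im)
      (fun s => (crossR ω (modeU v Species.electron s) j).im)
      (fun s => (crossR ω (modeE v s) j).im) (fun s => (Complex.I * modeB v s j).im)
      (fun s => (HasDerivAt.im_part (hv.deriv_cross_velocity hd Species.ion j s)).congr_deriv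
        (by simp only [Complex.sub_im, Complex.smul_im, smul_eq_mul, Params.charge]))
      (fun s => (HasDerivAt.im_part (hv.deriv_cross_velocity hd Species.electron j s)).congr_deriv
        (by simp only [Complex.sub_im, Complex.smul_im, smul_eq_mul, Params.charge, neg_div]))
      (fun s => (HasDerivAt.im_part (hv.deriv_cross_electric hd j s)).congr_deriv
        (by simp only [Complex.sub_im, Complex.smul_im, smul_eq_mul]))
      (fun s => (HasDerivAt.im_part (hv.deriv_magnetic hd j s)).congr_deriv
        (by simp only [Complex.smul_im, smul_eq_mul])) t ht
    simp only [← hIB, hsq] at h0 ⊢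
    calc _ ≤ K₂ * Real.exp (-(lam₂ * κ⁻¹ ^ 2) * t) * (4 * N ^ 2) := by
          refine le_trans ?_ (mul_le_mul_of_nonneg_left h0 (by positivity))
          linarith only [hre, him]
      _ ≤ K₂ * X ^ 2 * (4 * N ^ 2) := by gcongr
      _ = _ := by ring
  have hJ₁ : √(5 * K₁) * X * N ≤ J * X * N := by
    rw [hJ]; gcongr; linarith only [Real.sqrt_nonneg (4 * K₂)]
  have hJ₂ : √(4 * K₂) * X * N ≤ J * X * N := by
    rw [hJ]; gcongr; linarith only [Real.sqrt_nonneg (5 * K₁)]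
  have hrootL : ∀ x : ℝ, x ^ 2 ≤ 5 * K₁ * X ^ 2 * N ^ 2 → x ≤ J * X * N := fun x hx => by
    refine le_trans (le_of_sq_le_sq ?_ (by positivity)) hJ₁
    rw [mul_pow, mul_pow, Real.sq_sqrt (by positivity)]; exact hx
  have hrootT : ∀ x : ℝ, x ^ 2 ≤ 4 * K₂ * X ^ 2 * N ^ 2 → x ≤ J * X * N := fun x hx => by
    refine le_trans (le_of_sq_le_sq ?_ (by positivity)) hJ₂
    rw [mul_pow, mul_pow, Real.sq_sqrt (by positivity)]; exact hx
  have hJXN : 0 ≤ J * X * N := by positivity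
  have s1 := sq_nonneg ‖v t (Sum.inl Species.ion)‖
  have s2 := sq_nonneg ‖v t (Sum.inl Species.electron)‖
  have s3 := sq_nonneg ‖longit ω (modeU v Species.ion t)‖
  have s4 := sq_nonneg ‖longit ω (modeU v Species.electron t)‖
  have s5 := sq_nonneg ‖longit ω (modeE v t)‖
  have c1 := fun j => sq_nonneg ‖crossR ω (modeU v Species.ion t) j‖
  have c2 := fun j => sq_nonneg ‖crossR ω (modeU v Species.electron t) j‖
  have c3 := fun j => sq_nonneg ‖crossR ω (modeE v t) j‖
  have c4 := fun j => sq_nonneg ‖modeB v t j‖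
  have hfinal : ∀ x : ℝ, x ≤ 4 * (J * X * N) → x ≤ 4 * J * X * N := fun x hx => by linarith only [hx]
  rcases a with α | ⟨α, j⟩ | j | j
  · have : ‖v t (Sum.inl α)‖ ≤ J * X * N :=
      hrootL _ (by cases α <;> linarith only [hlong, s1, s2, s3, s4, s5])
    exact hfinal _ (by linarith only [this, hJXN])
  · refine (norm_apply_le_longit_add_crossR hd.unit (modeU v α t) j).trans (hfinal _ ?_)
    have h1 : ‖longit ω (modeU v α t)‖ ≤ J * X * N :=
      hrootL _ (by cases α <;> linarith only [hlong, s1, s2, s3, s4, s5])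
    have h2 : ∀ i, ‖crossR ω (modeU v α t) i‖ ≤ J * X * N := fun i =>
      hrootT _ (by cases α <;> linarith only [htrans i, c1 i, c2 i, c3 i, c4 i])
    rw [Fin.sum_univ_three]
    linarith only [h1, h2 0, h2 1, h2 2]
  · refine (norm_apply_le_longit_add_crossR hd.unit (modeE v t) j).trans (hfinal _ ?_)
    have h1 : ‖longit ω (modeE v t)‖ ≤ J * X * N :=
      hrootL _ (by linarith only [hlong, s1, s2, s3, s4, s5])
    have h2 : ∀ i, ‖crossR ω (modeE v t) i‖ ≤ J * X * N := fun i =>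
      hrootT _ (by linarith only [htrans i, c1 i, c2 i, c3 i, c4 i])
    rw [Fin.sum_univ_three]
    linarith only [h1, h2 0, h2 1, h2 2]
  · have : ‖v t (Sum.inr (Sum.inr (Sum.inr j)))‖ ≤ J * X * N :=
      hrootT ‖modeB v t j‖ (by linarith only [htrans j, c1 j, c2 j, c3 j, c4 j])
    exact hfinal _ (by linarith only [this, hJXN])

end Constants

open scoped FourierTransform

/-! ### Fourier transforms that are functions -/

/-- The Fourier transform of the distribution `T` is the locally integrable function `h`. -/
structure HasFourier (T : Dist) (h : Space → ℂ) : Prop where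
  locallyIntegrable : LocallyIntegrable h volume
  apply_fourier : ∀ ψ : 𝓢(Space, ℂ), HasCompactSupport ψ → T (𝓕 ψ) = ∫ k, ψ k * h k

/-- Smooth functions with compact support as Schwartz functions. -/
lemma exists_schwartzMap_of_contDiff {g : Space → ℂ} (hg : HasCompactSupport g)
    (hg' : ContDiff ℝ (⊤ : ℕ∞) g) : ∃ ψ : 𝓢(Space, ℂ), HasCompactSupport ψ ∧ ∀ x, ψ x = g x :=
  ⟨hg.toSchwartzMap hg', by exact hg, fun x => by simp⟩

lemma ae_eq_of_forall_integral_eq {h h' : Space → ℂ} (hh : LocallyIntegrable h volume)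
    (hh' : LocallyIntegrable h' volume)
    (H : ∀ ψ : 𝓢(Space, ℂ), HasCompactSupport ψ → ∫ k, ψ k * h k = ∫ k, ψ k * h' k) :
    h =ᵐ[volume] h' := by
  have key : ∀ᵐ k, h k - h' k = 0 := by
    refine ae_eq_zero_of_integral_contDiff_smul_eq_zero (hh.sub hh') fun g hg hc => ?_
    obtain ⟨ψ, hψ, hψg⟩ := exists_schwartzMap_of_contDiff (g := Complex.ofRealCLM ∘ g)
      (hc.comp_left rfl) (by fun_prop)
    have e := H ψ hψ
    have i1 : Integrable (fun k => g k • h k) := hh.integrable_smul_left_of_hasCompactSupport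
      hg.continuous hc
    have i2 : Integrable (fun k => g k • h' k) := hh'.integrable_smul_left_of_hasCompactSupport
      hg.continuous hc
    simp only [smul_sub]
    rw [integral_sub i1 i2, sub_eq_zero]
    simpa [hψg] using e
  filter_upwards [key] with k hk using sub_eq_zero.1 hk

lemma HasFourier.ae_eq {T : Dist} {h h' : Space → ℂ} (hh : HasFourier T h)
    (hh' : HasFourier T h') : h =ᵐ[volume] h' :=
  ae_eq_of_forall_integral_eq hh.1 hh'.1 fun ψ hψ => by rw [← hh.2 ψ hψ, ← hh'.2 ψ hψ]

lemma LocallyIntegrable.integrable_schwartz_mul {h : Space → ℂ} (hh : LocallyIntegrable h volume)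
    (ψ : 𝓢(Space, ℂ)) (hψ : HasCompactSupport ψ) : Integrable (fun k => ψ k * h k) := by
  simpa using hh.integrable_smul_left_of_hasCompactSupport ψ.continuous hψ

lemma LocallyIntegrable.continuous_mul {h g : Space → ℂ} (hh : LocallyIntegrable h volume)
    (hg : Continuous g) : LocallyIntegrable (fun k => g k * h k) volume := by
  have := (locallyIntegrableOn_univ.2 hh).continuousOn_smul (g := g) isOpen_univ.isLocallyClosed
    hg.continuousOn
  simpa using locallyIntegrableOn_univ.1 this

lemma HasFourier.congr {T : Dist} {h h' : Space → ℂ} (hh : HasFourier T h) (e : h =ᵐ[volume] h') :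
    HasFourier T h' :=
  ⟨fun x => (hh.1 x).congr (by exact e) , fun ψ hψ => by
    rw [hh.2 ψ hψ]; exact integral_congr_ae (e.mono fun k hk => by simp [hk])⟩

lemma HasFourier.add {S T : Dist} {g h : Space → ℂ} (hS : HasFourier S g) (hT : HasFourier T h) :
    HasFourier (S + T) (fun k => g k + h k) := by
  refine ⟨hS.1.add hT.1, fun ψ hψ => ?_⟩
  simp only [mul_add]
  rw [integral_add (LocallyIntegrable.integrable_schwartz_mul hS.1 ψ hψ)
    (LocallyIntegrable.integrable_schwartz_mul hT.1 ψ hψ), ← hS.2 ψ hψ, ← hT.2 ψ hψ]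
  rfl

lemma HasFourier.smul {T : Dist} {h : Space → ℂ} (c : ℂ) (hT : HasFourier T h) :
    HasFourier (c • T) (fun k => c * h k) := by
  refine ⟨hT.1.smul c, fun ψ hψ => ?_⟩
  simp only [mul_left_comm _ c]
  rw [integral_const_mul, ← hT.2 ψ hψ]
  rfl

lemma hasFourier_zero : HasFourier 0 (fun _ => 0) :=
  ⟨locallyIntegrable_zero, fun ψ _ => by simp⟩

lemma HasFourier.sum {ι : Type*} (s : Finset ι) {T : ι → Dist} {h : ι → Space → ℂ}
    (H : ∀ i, HasFourier (T i) (h i)) : HasFourier (∑ i ∈ s, T i) (fun k => ∑ i ∈ s, h i k) := by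
  classical
  induction s using Finset.induction_on with
  | empty => simpa using hasFourier_zero
  | insert a s ha ih => simpa [Finset.sum_insert ha] using (H a).add ih

lemma inner_basisVec (k : Space) (j : Fin 3) : inner ℝ k (basisVec j) = k j := by
  simp [basisVec, EuclideanSpace.inner_single_right]

/-- Multiplication of a Schwartz function by `2 π i k_j`. -/
noncomputable def mulFreq (j : Fin 3) (ψ : 𝓢(Space, ℂ)) : 𝓢(Space, ℂ) :=
  (2 * Real.pi * Complex.I) • smulLeftCLM ℂ (fun k : Space => inner ℝ k (basisVec j)) ψ

lemma mulFreq_apply (j : Fin 3) (ψ : 𝓢(Space, ℂ)) (k : Space) :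
    mulFreq j ψ k = (Complex.I * (2 * Real.pi * k j : ℝ)) * ψ k := by
  have hg : (fun k : Space => inner ℝ k (basisVec j)).HasTemperateGrowth := by fun_prop
  rw [mulFreq, smul_apply, SchwartzMap.smulLeftCLM_apply_apply hg, inner_basisVec, smul_eq_mul,
    Complex.real_smul]
  push_cast
  ring

/-- Two signs cancel: one from the definition of the distributional derivative, one from
differentiating the kernel of the Fourier transform. -/
lemma lineDerivOp_apply_fourier (T : Dist) (j : Fin 3) (ψ : 𝓢(Space, ℂ)) :
    (∂_{basisVec j} T) (𝓕 ψ) = T (𝓕 (mulFreq j ψ)) := by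
  rw [TemperedDistribution.lineDerivOp_apply_apply, SchwartzMap.lineDerivOp_fourier_eq, mulFreq]
  congr 1
  rw [neg_smul, FourierTransform.fourier_neg, neg_neg]

lemma HasFourier.lineDeriv {T : Dist} {h : Space → ℂ} (hT : HasFourier T h) (j : Fin 3) :
    HasFourier (∂_{basisVec j} T) (fun k => (Complex.I * (2 * Real.pi * k j : ℝ)) * h k) := by
  refine ⟨LocallyIntegrable.continuous_mul hT.1 (by fun_prop), fun ψ hψ => ?_⟩
  rw [lineDerivOp_apply_fourier, hT.2]
  · refine integral_congr_ae (.of_forall fun k => ?_)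
    simp only [mulFreq_apply]
    ring
  · refine hψ.mono fun k hk => ?_
    contrapose! hk
    simp only [Function.mem_support, not_not] at hk ⊢
    simp [mulFreq_apply, hk]

lemma HasFourier.div {F : Fin 3 → Dist} {h : Fin 3 → Space → ℂ}
    (H : ∀ j, HasFourier (F j) (h j)) :
    HasFourier (div F) (fun k => ∑ j, (Complex.I * (2 * Real.pi * k j : ℝ)) * h j k) :=
  HasFourier.sum _ fun j => (H j).lineDeriv j

lemma HasFourier.iteratedLineDeriv {T : Dist} {h : Space → ℂ} (hT : HasFourier T h) {M : ℕ}
    (β : Fin M → Fin 3) : HasFourier (∂^{fun j => basisVec (β j)} T)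
      (fun k => (∏ j, (Complex.I * (2 * Real.pi * k (β j) : ℝ))) * h k) := by
  induction M with
  | zero => simpa using hT
  | succ n ih =>
    rw [LineDeriv.iteratedLineDerivOp_succ_left]
    refine ((ih (fun j => β j.succ)).lineDeriv (β 0)).congr (.of_forall fun k => ?_)
    simp only [Fin.prod_univ_succ, mul_assoc]

lemma toTemperedDistribution_apply_fourier (V : Lp ℂ 2 (volume : Measure Space))
    (ψ : 𝓢(Space, ℂ)) : Lp.toTemperedDistribution V (𝓕 ψ) =
      ∫ k, ψ k * (𝓕 V : Lp ℂ 2 (volume : Measure Space)) k := by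
  have := congrArg (fun T : Dist => T ψ) (Lp.fourier_toTemperedDistribution_eq V)
  simpa [TemperedDistribution.fourier_apply, Lp.toTemperedDistribution_apply] using this

lemma hasFourier_toTemperedDistribution (V : Lp ℂ 2 (volume : Measure Space)) :
    HasFourier (Lp.toTemperedDistribution V) (𝓕 V : Lp ℂ 2 (volume : Measure Space)) :=
  ⟨(Lp.memLp _).locallyIntegrable (by norm_num),
    fun ψ _ => toTemperedDistribution_apply_fourier V ψ⟩

/-- If the Fourier transform of a derivative of an `L^2` function is square integrable, then the
derivative is an `L^2` function. -/
lemma iteratedLineDeriv_toTemperedDistribution (V : Lp ℂ 2 (volume : Measure Space)) {M : ℕ}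
    (β : Fin M → Fin 3) (h2 : MemLp (fun k => (∏ j, (Complex.I * (2 * Real.pi * k (β j) : ℝ))) *
      (𝓕 V : Lp ℂ 2 (volume : Measure Space)) k) 2 volume) :
    ∂^{fun j => basisVec (β j)} (Lp.toTemperedDistribution V) =
      Lp.toTemperedDistribution (𝓕⁻ h2.toLp) := by
  have key : ∀ ψ : 𝓢(Space, ℂ),
      (∂^{fun j => basisVec (β j)} (Lp.toTemperedDistribution V)) (𝓕 ψ) =
      ∫ k, ψ k * ((∏ j, (Complex.I * (2 * Real.pi * k (β j) : ℝ))) *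
      (𝓕 V : Lp ℂ 2 (volume : Measure Space)) k) := by
    -- The induction passes through shorter multi-indices, for which square integrability is not
    -- assumed. The identity on compactly or rapidly decaying test functions `ψ` is therefore proved
    -- without it.
    clear h2
    induction M with
    | zero => intro ψ; simpa using toTemperedDistribution_apply_fourier V ψ
    | succ n ih =>
      intro ψ
      rw [LineDeriv.iteratedLineDerivOp_succ_left, lineDerivOp_apply_fourier]
      refine (ih (fun j => β j.succ) (mulFreq (β 0) ψ)).trans ?_
      refine integral_congr_ae (.of_forall fun k => ?_)
      simp only [mulFreq_apply, Fin.prod_univ_succ]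
      ring
  ext φ
  have e := key (𝓕⁻ φ)
  rw [FourierTransform.fourier_fourierInv_eq] at e
  rw [e]
  have e' := toTemperedDistribution_apply_fourier (𝓕⁻ h2.toLp) (𝓕⁻ φ)
  rw [FourierTransform.fourier_fourierInv_eq, FourierTransform.fourier_fourierInv_eq] at e'
  rw [e']
  refine integral_congr_ae ?_
  filter_upwards [h2.coeFn_toLp] with k hk
  rw [hk]

/-! ### Recognizing `L^q` functions by duality -/

lemma enorm_integral_mul_le {p q : ℝ≥0∞} [ENNReal.HolderConjugate p q] {f g : Space → ℂ}
    (hf : AEStronglyMeasurable f volume) (hg : AEStronglyMeasurable g volume) :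
    ‖∫ x, f x * g x‖ₑ ≤ eLpNorm f p volume * eLpNorm g q volume := by
  refine (enorm_integral_le_lintegral_enorm _).trans ?_
  have := eLpNorm_smul_le_mul_eLpNorm (p := p) (q := q) (r := 1) hg hf
  rw [eLpNorm_one_eq_lintegral_enorm] at this
  exact this

instance : ENNReal.HolderConjugate 2 2 := ⟨by rw [ENNReal.inv_two_add_inv_two, inv_one]⟩

lemma eLpNorm_indicator_ball_le {p : ℝ≥0∞} (hp : p ≤ 2) {f : Space → ℂ}
    (hf : AEStronglyMeasurable f volume) {R : ℝ} (h0 : ∀ x, R < ‖x‖ → f x = 0) :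
    eLpNorm f p volume ≤ eLpNorm f 2 volume *
      volume (Metric.closedBall (0 : Space) R) ^ (1 / p.toReal - 1 / (2 : ℝ≥0∞).toReal) := by
  have hs : f = (Metric.closedBall (0 : Space) R).indicator f := by
    ext x
    by_cases hx : x ∈ Metric.closedBall (0 : Space) R
    · rw [Set.indicator_of_mem hx]
    · rw [Set.indicator_of_notMem hx]
      exact h0 x (by simpa using hx)
  have e : ∀ s : ℝ≥0∞, eLpNorm f s volume =
      eLpNorm f s (volume.restrict (Metric.closedBall (0 : Space) R)) := fun s => by
    conv_lhs => rw [hs]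
    exact eLpNorm_indicator_eq_eLpNorm_restrict Metric.isClosed_closedBall.measurableSet
  rw [e p, e 2]
  simpa using eLpNorm_le_eLpNorm_mul_rpow_measure_univ hp (hf.restrict
    (s := Metric.closedBall (0 : Space) R))

/-- A bound on Schwartz test functions with compact support extends to `L^2` test functions with
bounded support. -/
lemma enorm_integral_mul_le_of_bounded_support {g : Space → ℂ} (hg : MemLp g 2 volume) {p : ℝ≥0∞}
    (hp1 : 1 ≤ p) (hp : p ≤ 2) {A : ℝ≥0∞} (hA : A ≠ ⊤)
    (H : ∀ φ : 𝓢(Space, ℂ), HasCompactSupport φ → ‖∫ x, φ x * g x‖ₑ ≤ A * eLpNorm φ p volume)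
    {ψ : Space → ℂ} (hψ : MemLp ψ 2 volume) {R : ℝ} (hR : 0 < R) (h0 : ∀ x, R < ‖x‖ → ψ x = 0) :
    ‖∫ x, ψ x * g x‖ₑ ≤ A * eLpNorm ψ p volume := by
  -- The cutoff is 1 on the support of `ψ`. Multiplying a smooth L² approximation of `ψ` by it
  -- confines the error to a fixed ball, where smallness in L² implies smallness in L^p because p ≤
  -- 2.
  let b : ContDiffBump (0 : Space) := ⟨R, 2 * R, hR, by linarith⟩
  set K : ℝ≥0∞ :=
    volume (Metric.closedBall (0 : Space) (2 * R)) ^ (1 / p.toReal - 1 / (2 : ℝ≥0∞).toReal) with hK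
  have hKt : K ≠ ⊤ := by
    refine ENNReal.rpow_ne_top_of_nonneg ?_ measure_closedBall_lt_top.ne
    have h1 : 0 < p.toReal := ENNReal.toReal_pos (by positivity) (hp.trans_lt (by simp)).ne
    have h2 : p.toReal ≤ (2 : ℝ≥0∞).toReal := ENNReal.toReal_mono (by simp) hp
    exact sub_nonneg.2 (one_div_le_one_div_of_le h1 h2)
  set G : ℝ≥0∞ := eLpNorm g 2 volume with hG
  have hGt : G ≠ ⊤ := hg.2.ne
  have key : ∀ ε : ℝ, 0 < ε → ‖∫ x, ψ x * g x‖ₑ ≤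
      A * eLpNorm ψ p volume + ENNReal.ofReal ε * (A * K + G) := by
    intro ε hε
    obtain ⟨φ, hφc, hφs, hφ⟩ := hψ.exist_eLpNorm_sub_le (by simp) (by norm_num) hε
    obtain ⟨χ, hχc, hχ⟩ := exists_schwartzMap_of_contDiff (g := fun x => (b x : ℂ) * φ x)
      (hφc.mul_left) (((Complex.ofRealCLM.contDiff).comp b.contDiff).mul hφs)
    set d : Space → ℂ := fun x => ψ x - χ x with hd
    have hdm : AEStronglyMeasurable d volume :=
      hψ.1.sub χ.continuous.aestronglyMeasurable
    have hdb : ∀ x, d x = (b x : ℂ) * (ψ x - φ x) := by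
      intro x
      simp only [hd, hχ]
      by_cases hx : R < ‖x‖
      · rw [h0 x hx]; ring
      · rw [b.one_of_mem_closedBall (by simpa [b] using not_lt.1 hx)]; simp
    have hd2 : eLpNorm d 2 volume ≤ ENNReal.ofReal ε := by
      refine le_trans (eLpNorm_mono fun x => ?_) hφ
      rw [hdb x, norm_mul]
      refine mul_le_of_le_one_left (norm_nonneg _) ?_
      rw [Complex.norm_real, Real.norm_eq_abs, abs_of_nonneg b.nonneg]
      exact b.le_one
    have hdp : eLpNorm d p volume ≤ ENNReal.ofReal ε * K := by
      refine (eLpNorm_indicator_ball_le hp hdm (R := 2 * R) fun x hx => ?_).trans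
        (mul_le_mul_left hd2 _)
      rw [hdb x, b.zero_of_le_dist (by simpa [b] using hx.le)]
      simp
    have hχp : eLpNorm χ p volume ≤ eLpNorm ψ p volume + ENNReal.ofReal ε * K := by
      have : (χ : Space → ℂ) = ψ - d := by ext x; simp [hd]
      rw [this]
      exact (eLpNorm_sub_le hψ.1 hdm hp1).trans (by gcongr)
    have hd2' : MemLp d 2 volume := hψ.sub (χ.memLp 2)
    have e1 : ∫ x, ψ x * g x = (∫ x, χ x * g x) + ∫ x, d x * g x := by
      rw [← integral_add]
      · refine integral_congr_ae (.of_forall fun x => ?_)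
        simp only [hd]; ring
      · exact (χ.memLp 2).integrable_mul hg
      · exact hd2'.integrable_mul hg
    rw [e1]
    calc _ ≤ ‖∫ x, χ x * g x‖ₑ + ‖∫ x, d x * g x‖ₑ := enorm_add_le _ _
      _ ≤ A * (eLpNorm ψ p volume + ENNReal.ofReal ε * K) + ENNReal.ofReal ε * G := by
        gcongr
        · exact (H χ hχc).trans (by gcongr)
        · exact (enorm_integral_mul_le (p := 2) (q := 2) hdm hg.1).trans (by gcongr)
      _ = _ := by ring
  have hL : A * K + G ≠ ⊤ := by finiteness
  refine ENNReal.le_of_forall_pos_le_add fun ε hε _ => ?_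
  refine (key (ε / ((A * K + G).toReal + 1)) (by positivity)).trans ?_
  gcongr
  rw [← ENNReal.ofReal_toReal hL, ← ENNReal.ofReal_mul (by positivity)]
  rw [← ENNReal.ofReal_coe_nnreal]
  refine ENNReal.ofReal_le_ofReal ?_
  rw [div_mul_eq_mul_div, div_le_iff₀ (by positivity)]
  have : 0 ≤ (ε : ℝ) := ε.2
  simp only [ENNReal.toReal_ofReal ENNReal.toReal_nonneg]
  nlinarith [(A * K + G).toReal_nonneg]

/-- The product of the conjugate sign of `z` with `z` is the absolute value of `z`. -/
lemma conj_div_norm_mul_self (z : ℂ) : (starRingEnd ℂ z / ‖z‖) * z = (‖z‖ : ℂ) := by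
  by_cases hz : z = 0
  · simp [hz]
  · have : (‖z‖ : ℂ) ≠ 0 := by simpa using hz
    rw [div_mul_eq_mul_div, div_eq_iff this, Complex.conj_mul', sq]

lemma enorm_integral_ofReal_of_nonneg {w : Space → ℝ} (hw : ∀ x, 0 ≤ w x)
    (hi : Integrable w volume) : ‖∫ x, (w x : ℂ)‖ₑ = ∫⁻ x, ENNReal.ofReal (w x) := by
  rw [show ∫ x, (w x : ℂ) = ((∫ x, w x : ℝ) : ℂ) from integral_ofReal, ← ofReal_norm, Complex.norm_real, Real.norm_eq_abs,
    abs_of_nonneg (integral_nonneg hw),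
    ofReal_integral_eq_lintegral_ofReal hi (.of_forall hw)]

lemma memLp_of_bounded_support {w : Space → ℂ} (hw : Measurable w) {R C : ℝ}
    (hb : ∀ x, ‖w x‖ ≤ C) (h0 : ∀ x, R < ‖x‖ → w x = 0) : MemLp w 2 volume := by
  have hs : w = (Metric.closedBall (0 : Space) R).indicator w := by
    ext x
    by_cases hx : x ∈ Metric.closedBall (0 : Space) R
    · rw [Set.indicator_of_mem hx]
    · rw [Set.indicator_of_notMem hx]
      exact h0 x (by simpa using hx)
  rw [hs, memLp_indicator_iff_restrict Metric.isClosed_closedBall.measurableSet]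
  have : IsFiniteMeasure (volume.restrict (Metric.closedBall (0 : Space) R)) :=
    ⟨by rw [Measure.restrict_apply_univ]; exact measure_closedBall_lt_top⟩
  exact MemLp.of_bound hw.aestronglyMeasurable C (.of_forall hb)

/-- The converse of Hölder's inequality, proved with explicit bounded test functions of bounded
support: for q = ∞ the conjugate sign of `g` on a bounded piece of {|g| > A}, otherwise the
conjugate sign times the power q - 1 of a truncation of |g|. -/
lemma eLpNorm_le_of_forall_bounded_support {g : Space → ℂ} (hgm : Measurable g)
    (hg : MemLp g 2 volume) {p q : ℝ≥0∞} [hpq : ENNReal.HolderConjugate p q] (hp : p ≤ 2) (hq2 : 2 ≤ q)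
    {A : ℝ≥0∞} (hA : A ≠ ⊤)
    (H : ∀ (ψ : Space → ℂ) (R : ℝ), MemLp ψ 2 volume → 0 < R → (∀ x, R < ‖x‖ → ψ x = 0) →
      ‖∫ x, ψ x * g x‖ₑ ≤ A * eLpNorm ψ p volume) : eLpNorm g q volume ≤ A := by
  have hsgn : Measurable fun x => starRingEnd ℂ (g x) / (‖g x‖ : ℂ) := by fun_prop
  have hsgn1 : ∀ x, ‖starRingEnd ℂ (g x) / (‖g x‖ : ℂ)‖ ≤ 1 := by
    intro x
    rw [norm_div, RCLike.norm_conj, Complex.norm_real, norm_norm]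
    exact div_self_le_one _
  by_cases hq : q = ⊤
  · subst hq
    have hp1 : p = 1 := (ENNReal.HolderConjugate.eq_top_iff_eq_one ⊤ p).1 rfl
    subst hp1
    rw [eLpNorm_exponent_top]
    refine essSup_le_of_ae_le _ ?_
    by_contra hcon
    have hpos : volume {x | A < ‖g x‖ₑ} ≠ 0 := by
      intro h; apply hcon
      rw [Filter.EventuallyLE, ae_iff]; simpa using h
    have hcov : {x | A < ‖g x‖ₑ} = ⋃ n : ℕ, {x | A < ‖g x‖ₑ ∧ ‖x‖ ≤ n} := by
      ext x
      simp only [Set.mem_ofPred_eq, Set.mem_iUnion, exists_and_left]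
      exact ⟨fun h => ⟨h, exists_nat_ge _⟩, fun h => h.1⟩
    rw [hcov] at hpos
    obtain ⟨n, hn⟩ : ∃ n : ℕ, volume {x | A < ‖g x‖ₑ ∧ ‖x‖ ≤ n} ≠ 0 := by
      by_contra! h; exact hpos (measure_iUnion_null h)
    set S := {x | A < ‖g x‖ₑ ∧ ‖x‖ ≤ n} with hS
    have hSm : MeasurableSet S :=
      (measurableSet_lt measurable_const hgm.enorm).inter (measurableSet_le measurable_norm measurable_const)
    have hSf : volume S ≠ ⊤ := ((measure_mono fun x hx => by simpa using hx.2 :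
      volume S ≤ volume (Metric.closedBall (0 : Space) n)).trans_lt measure_closedBall_lt_top).ne
    set ψ : Space → ℂ := S.indicator fun x => starRingEnd ℂ (g x) / (‖g x‖ : ℂ) with hψ
    have hψm : Measurable ψ := hsgn.indicator hSm
    have hψn : ∀ x, ‖ψ x‖ ≤ S.indicator (fun _ => (1 : ℝ)) x := fun x => by
      rw [hψ, norm_indicator_eq_indicator_norm]
      exact Set.indicator_le_indicator (hsgn1 x)
    have hψ0 : ∀ x, (n : ℝ) + 1 < ‖x‖ → ψ x = 0 := fun x hx =>
      Set.indicator_of_notMem (fun h => by have := h.2; linarith) _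
    have h2 := memLp_of_bounded_support hψm (C := 1) (fun x => (hψn x).trans
      (Set.indicator_le_self' (fun _ _ => zero_le_one) x)) hψ0
    have := H ψ (n + 1) h2 (by positivity) hψ0
    have e1 : ∀ x, ψ x * g x = ((S.indicator (fun x => ‖g x‖) x : ℝ) : ℂ) := by
      intro x
      by_cases hx : x ∈ S
      · simp only [hψ, Set.indicator_of_mem hx, conj_div_norm_mul_self]
      · simp only [hψ, Set.indicator_of_notMem hx]; simp
    have hi : Integrable (S.indicator fun x => ‖g x‖) volume := by
      have := (h2.integrable_mul hg).norm
      refine this.congr (.of_forall fun x => ?_)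
      simp only [Pi.mul_apply, e1, Complex.norm_real, Real.norm_eq_abs]
      exact abs_of_nonneg (Set.indicator_nonneg (fun _ _ => norm_nonneg _) _)
    simp only [e1] at this
    rw [enorm_integral_ofReal_of_nonneg (fun x => Set.indicator_nonneg (fun _ _ => norm_nonneg _) _)
      hi] at this
    have e2 : ∫⁻ x, ENNReal.ofReal (S.indicator (fun x => ‖g x‖) x) = ∫⁻ x in S, ‖g x‖ₑ := by
      rw [← lintegral_indicator hSm]
      refine lintegral_congr fun x => ?_
      by_cases hx : x ∈ S
      · simp only [Set.indicator_of_mem hx, ofReal_norm]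
      · simp only [Set.indicator_of_notMem hx, ENNReal.ofReal_zero]
    have e3 : eLpNorm ψ 1 volume ≤ volume S := by
      rw [eLpNorm_one_eq_lintegral_enorm]
      calc ∫⁻ x, ‖ψ x‖ₑ ≤ ∫⁻ x, S.indicator (fun _ => 1) x := by
            refine lintegral_mono fun x => ?_
            rw [← ofReal_norm]
            refine (ENNReal.ofReal_le_ofReal (hψn x)).trans ?_
            by_cases hx : x ∈ S
            · simp [Set.indicator_of_mem hx]
            · simp [Set.indicator_of_notMem hx]
        _ = volume S := by rw [lintegral_indicator hSm]; simp
    rw [e2] at this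
    have h4 : ∫⁻ x in S, A < ∫⁻ x in S, ‖g x‖ₑ := by
      refine setLIntegral_strict_mono hSm hn hgm.enorm ?_ (.of_forall fun x hx => hx.1)
      rw [setLIntegral_const]
      exact ENNReal.mul_ne_top hA hSf
    rw [setLIntegral_const] at h4
    exact absurd (this.trans (by gcongr)) (not_le.2 h4)
  · have hq0 : q ≠ 0 := (lt_of_lt_of_le (by simp) hq2).ne'
    have hp0 : p ≠ 0 := ENNReal.HolderConjugate.ne_zero p q
    have hpt : p ≠ ⊤ := (hp.trans_lt (by simp)).ne
    set a := p.toReal with ha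
    set b := q.toReal with hb
    have hb2 : 2 ≤ b := by
      have := ENNReal.toReal_mono hq hq2
      simpa using this
    have ha0 : 0 < a := ENNReal.toReal_pos hp0 hpt
    have hab : a⁻¹ + b⁻¹ = 1 := by
      have := congrArg ENNReal.toReal (ENNReal.HolderConjugate.inv_add_inv_eq_one p q)
      rwa [ENNReal.toReal_add (by simpa) (by simpa), ENNReal.toReal_inv, ENNReal.toReal_inv,
        ENNReal.toReal_one] at this
    have hab' : (b - 1) * a = b := by
      field_simp at hab
      linarith
    -- Truncation in size and in space makes I = ∫ wᵇ finite. Testing gives I ≤ A I^(1/a), and only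
    -- for finite I may the factor I^(1/a) be cancelled. Monotone convergence then removes the
    -- truncation.
    set w : ℕ → Space → ℝ := fun n => (Metric.closedBall (0 : Space) n).indicator
      fun x => min ‖g x‖ n with hw
    have hwm : ∀ n, Measurable (w n) := fun n =>
      (hgm.norm.min measurable_const).indicator Metric.isClosed_closedBall.measurableSet
    have hw0 : ∀ n x, 0 ≤ w n x := fun n x => Set.indicator_nonneg (fun _ _ => by positivity) _
    have hwg : ∀ n x, w n x ≤ ‖g x‖ := fun n x =>
      (Set.indicator_le_self' (fun _ _ => by positivity) x).trans (min_le_left _ _)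
    have hwn : ∀ n x, w n x ≤ n := fun n x =>
      (Set.indicator_le_self' (fun _ _ => by positivity) x).trans (min_le_right _ _)
    have hwb : ∀ (n : ℕ) (x : Space), (n : ℝ) + 1 < ‖x‖ → w n x = 0 := fun n x hx =>
      Set.indicator_of_notMem (fun h => by
        rw [mem_closedBall_zero_iff] at h
        linarith) _
    have key : ∀ n, ∫⁻ x, ENNReal.ofReal (w n x) ^ b ≤ A ^ b := by
      intro n
      set I := ∫⁻ x, ENNReal.ofReal (w n x) ^ b with hI
      have hIt : I ≠ ⊤ := by
        refine ne_of_lt (lt_of_le_of_lt (b := ∫⁻ x, (Metric.closedBall (0 : Space) n).indicator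
          (fun _ => ENNReal.ofReal n ^ b) x) (lintegral_mono fun x => ?_) ?_)
        · by_cases hx : x ∈ Metric.closedBall (0 : Space) n
          · rw [Set.indicator_of_mem hx]
            gcongr; exact hwn n x
          · rw [Set.indicator_of_notMem hx]
            simp only [hw, Set.indicator_of_notMem hx]
            simp [show (0 : ℝ) < b by linarith]
        · rw [lintegral_indicator Metric.isClosed_closedBall.measurableSet, setLIntegral_const]
          exact ENNReal.mul_lt_top (by finiteness) measure_closedBall_lt_top
      set ψ : Space → ℂ := fun x => starRingEnd ℂ (g x) / (‖g x‖ : ℂ) * ((w n x ^ (b - 1) : ℝ) : ℂ)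
        with hψ
      have hψm : Measurable ψ := hsgn.mul (Complex.measurable_ofReal.comp ((hwm n).pow_const _))
      have hψn : ∀ x, ‖ψ x‖ ≤ w n x ^ (b - 1) := fun x => by
        rw [hψ, norm_mul, Complex.norm_real, Real.norm_eq_abs,
          abs_of_nonneg (Real.rpow_nonneg (hw0 n x) _)]
        exact mul_le_of_le_one_left (Real.rpow_nonneg (hw0 n x) _) (hsgn1 x)
      have hψ0 : ∀ x, (n : ℝ) + 1 < ‖x‖ → ψ x = 0 := fun x hx => by
        simp only [hψ, hwb n x hx]
        rw [Real.zero_rpow (by linarith)]; simp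
      have h2 := memLp_of_bounded_support hψm (C := (n : ℝ) ^ (b - 1)) (fun x => (hψn x).trans
        (Real.rpow_le_rpow (hw0 n x) (hwn n x) (by linarith))) hψ0
      have hmain := H ψ (n + 1) h2 (by positivity) hψ0
      have e1 : ∀ x, ψ x * g x = ((‖g x‖ * w n x ^ (b - 1) : ℝ) : ℂ) := fun x => by
        simp only [hψ]
        rw [mul_right_comm, conj_div_norm_mul_self]; push_cast; rfl
      have hnn : ∀ x, 0 ≤ ‖g x‖ * w n x ^ (b - 1) := fun x =>
        mul_nonneg (norm_nonneg _) (Real.rpow_nonneg (hw0 n x) _)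
      have hi : Integrable (fun x => ‖g x‖ * w n x ^ (b - 1)) volume := by
        refine (h2.integrable_mul hg).norm.congr (.of_forall fun x => ?_)
        simp only [Pi.mul_apply, e1, Complex.norm_real, Real.norm_eq_abs]
        exact abs_of_nonneg (hnn x)
      simp only [e1] at hmain
      rw [enorm_integral_ofReal_of_nonneg hnn hi] at hmain
      have l1 : I ≤ ∫⁻ x, ENNReal.ofReal (‖g x‖ * w n x ^ (b - 1)) := by
        refine lintegral_mono fun x => ?_
        rw [ENNReal.ofReal_rpow_of_nonneg (hw0 n x) (by linarith)]
        refine ENNReal.ofReal_le_ofReal ?_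
        calc w n x ^ b = w n x ^ (1 + (b - 1)) := by ring_nf
          _ = w n x * w n x ^ (b - 1) := by
            rw [Real.rpow_add_of_nonneg (hw0 n x) zero_le_one (by linarith), Real.rpow_one]
          _ ≤ _ := mul_le_mul_of_nonneg_right (hwg n x) (Real.rpow_nonneg (hw0 n x) _)
      have l2 : eLpNorm ψ p volume ≤ I ^ (1 / a) := by
        rw [eLpNorm_eq_lintegral_rpow_enorm_toReal hp0 hpt]
        gcongr
        refine lintegral_mono fun x => ?_
        rw [← ofReal_norm]
        calc ENNReal.ofReal ‖ψ x‖ ^ p.toReal ≤ ENNReal.ofReal (w n x ^ (b - 1)) ^ p.toReal := by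
              gcongr; exact hψn x
          _ = ENNReal.ofReal (w n x) ^ b := by
            rw [← ENNReal.ofReal_rpow_of_nonneg (hw0 n x) (by linarith), ← ENNReal.rpow_mul, hab']
      have l3 : I ≤ A * I ^ (1 / a) := l1.trans (hmain.trans (by gcongr))
      by_cases hI0 : I = 0
      · simp [hI0]
      have l4 : I ^ (1 / b) ≤ A := by
        have e : I = I ^ (1 / b) * I ^ (1 / a) := by
          rw [← ENNReal.rpow_add _ _ hI0 hIt, one_div, one_div, add_comm, hab, ENNReal.rpow_one]
        have ht : I ^ (1 / a) ≠ ⊤ := ENNReal.rpow_ne_top_of_nonneg (by positivity) hIt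
        have h0 : I ^ (1 / a) ≠ 0 := by simp [hI0, hIt]
        exact (ENNReal.mul_le_mul_iff_left h0 ht).1 (e.symm.trans_le l3)
      calc I = (I ^ (1 / b)) ^ b := by
            rw [← ENNReal.rpow_mul, one_div, inv_mul_cancel₀ (by linarith), ENNReal.rpow_one]
        _ ≤ A ^ b := by gcongr
    rw [eLpNorm_eq_lintegral_rpow_enorm_toReal hq0 hq, ← hb]
    have hsup : ∀ x, ‖g x‖ₑ ^ b ≤ ⨆ n, ENNReal.ofReal (w n x) ^ b := fun x => by
      obtain ⟨n, hn⟩ := exists_nat_ge (max ‖x‖ ‖g x‖)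
      refine le_iSup_of_le n ?_
      have hx : x ∈ Metric.closedBall (0 : Space) n := by simpa using (le_max_left _ _).trans hn
      simp only [hw, Set.indicator_of_mem hx, min_eq_left ((le_max_right _ _).trans hn),
        ofReal_norm, le_refl]
    have hmono : Monotone fun n x => ENNReal.ofReal (w n x) ^ b := by
      intro n m hnm x
      refine ENNReal.rpow_le_rpow (ENNReal.ofReal_le_ofReal ?_) (by linarith)
      have hnm' : (n : ℝ) ≤ m := by exact_mod_cast hnm
      refine (Set.indicator_le_indicator (g := fun x => min ‖g x‖ (m : ℝ))
        (min_le_min_left _ hnm')).trans ?_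
      exact Set.indicator_le_indicator_of_subset (Metric.closedBall_subset_closedBall hnm')
        (fun _ => by positivity) x
    calc (∫⁻ x, ‖g x‖ₑ ^ b) ^ (1 / b) ≤ (∫⁻ x, ⨆ n, ENNReal.ofReal (w n x) ^ b) ^ (1 / b) := by
          gcongr with x; exact hsup x
      _ = (⨆ n, ∫⁻ x, ENNReal.ofReal (w n x) ^ b) ^ (1 / b) := by
        rw [lintegral_iSup (fun n => ((hwm n).ennreal_ofReal.pow_const _)) hmono]
      _ ≤ (A ^ b) ^ (1 / b) := by gcongr; exact iSup_le key
      _ = A := by rw [← ENNReal.rpow_mul, mul_one_div_cancel (by linarith), ENNReal.rpow_one]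

/-- A square integrable function belongs to `L^q`, `2 ≤ q ≤ ∞`, if its pairing with test functions
is controlled by the dual norm. -/
theorem eLpNorm_le_of_forall_schwartz {g : Space → ℂ} (hg : MemLp g 2 volume) {p q : ℝ≥0∞}
    [hpq : ENNReal.HolderConjugate p q] (hq2 : 2 ≤ q) {A : ℝ≥0∞}
    (H : ∀ φ : 𝓢(Space, ℂ), HasCompactSupport φ → ‖∫ x, φ x * g x‖ₑ ≤ A * eLpNorm φ p volume) :
    eLpNorm g q volume ≤ A := by
  by_cases hA : A = ⊤
  · simp [hA]
  have hp : p ≤ 2 := by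
    have h1 := ENNReal.HolderConjugate.one_sub_inv q p
    rw [← inv_inv p, ← h1, ENNReal.inv_le_iff_inv_le]
    have : q⁻¹ ≤ 2⁻¹ := ENNReal.inv_le_inv.2 hq2
    calc (2 : ℝ≥0∞)⁻¹ = 1 - 2⁻¹ := ENNReal.one_sub_inv_two.symm
      _ ≤ 1 - q⁻¹ := by gcongr
  have hae := hg.1.ae_eq_mk
  rw [eLpNorm_congr_ae hae]
  have hg' := hg.ae_eq hae
  refine eLpNorm_le_of_forall_bounded_support hg.1.stronglyMeasurable_mk.measurable hg' hp hq2 hA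
    fun ψ R hψ hR h0 => ?_
  refine enorm_integral_mul_le_of_bounded_support hg' (ENNReal.HolderConjugate.one_le p q) hp hA
    (fun φ hφ => ?_) hψ hR h0
  rw [← integral_congr_ae (f := fun x => φ x * g x) (hae.mono fun x hx => by simp only [hx])]
  exact H φ hφ

/-! ### Gaussian-weighted bounds for Fourier transforms of `L^p` functions -/

/-- From |G|^q ≤ M^(q-2)|G|², an elementary interpolation between L² and L^∞ that suffices here. -/
lemma eLpNorm_le_interpolation {G : Space → ℂ} {q : ℝ≥0∞} (hq : 2 ≤ q) {M S : ℝ≥0∞}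
    (hM : ∀ x, ‖G x‖ₑ ≤ M) (hMt : M ≠ ⊤) (hS : eLpNorm G 2 volume ≤ S) :
    eLpNorm G q volume ≤ M ^ (1 - 2 * (q⁻¹).toReal) * S ^ (2 * (q⁻¹).toReal) := by
  by_cases hqt : q = ⊤
  · subst hqt
    simpa using eLpNormEssSup_le_of_ae_enorm_bound (.of_forall hM)
  have hq0 : q ≠ 0 := (lt_of_lt_of_le (by simp) hq).ne'
  set b := q.toReal with hb
  have hb2 : 2 ≤ b := by simpa using ENNReal.toReal_mono hqt hq
  have hS2 : ∫⁻ x, ‖G x‖ₑ ^ (2 : ℝ) ≤ S ^ (2 : ℝ) := by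
    have h := eLpNorm_eq_lintegral_rpow_enorm_toReal (f := G) (μ := volume) (p := 2) (by simp)
      (by simp)
    rw [ENNReal.toReal_ofNat] at h
    calc _ = ((∫⁻ x, ‖G x‖ₑ ^ (2 : ℝ)) ^ (1 / 2 : ℝ)) ^ (2 : ℝ) := by
          rw [← ENNReal.rpow_mul]; norm_num
      _ ≤ S ^ (2 : ℝ) := by rw [← h]; gcongr
  rw [eLpNorm_eq_lintegral_rpow_enorm_toReal hq0 hqt, ← hb, ENNReal.toReal_inv, ← hb]
  calc (∫⁻ x, ‖G x‖ₑ ^ b) ^ (1 / b) ≤ (∫⁻ x, M ^ (b - 2) * ‖G x‖ₑ ^ (2 : ℝ)) ^ (1 / b) := by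
        gcongr with x
        calc ‖G x‖ₑ ^ b = ‖G x‖ₑ ^ ((b - 2) + 2) := by ring_nf
          _ = ‖G x‖ₑ ^ (b - 2) * ‖G x‖ₑ ^ (2 : ℝ) :=
            ENNReal.rpow_add_of_nonneg _ _ (by linarith) (by norm_num)
          _ ≤ _ := by gcongr; exact hM x
    _ = (M ^ (b - 2) * ∫⁻ x, ‖G x‖ₑ ^ (2 : ℝ)) ^ (1 / b) := by
      rw [lintegral_const_mul' _ _ (ENNReal.rpow_ne_top_of_nonneg (by linarith) hMt)]
    _ ≤ (M ^ (b - 2) * S ^ (2 : ℝ)) ^ (1 / b) := by gcongr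
    _ = _ := by
      rw [ENNReal.mul_rpow_of_nonneg _ _ (by positivity), ← ENNReal.rpow_mul, ← ENNReal.rpow_mul]
      rw [show (b - 2) * (1 / b) = 1 - 2 * b⁻¹ by field_simp, one_div]

/-- The constant `(π / 2 a)^{(3/2)(1/p - 1/2)}` in Gaussian-weighted bounds. -/
noncomputable def gaussConst (p : ℝ≥0∞) (a : ℝ) : ℝ≥0∞ :=
  ENNReal.ofReal ((Real.pi / (2 * a)) ^ ((3 / 2 : ℝ) * ((p⁻¹).toReal - 1 / 2)))

lemma eLpNorm_gaussian {a : ℝ} (ha : 0 < a) :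
    eLpNorm (fun k : Space => (Real.exp (-(a * ‖k‖ ^ 2)) : ℂ)) 2 volume =
      ENNReal.ofReal ((Real.pi / (2 * a)) ^ (3 / 4 : ℝ)) := by
  have h := GaussianFourier.integral_rexp_neg_mul_sq_norm (V := Space) (b := 2 * a) (by positivity)
  have hi : Integrable (fun k : Space => Real.exp (-(2 * a) * ‖k‖ ^ 2)) := by
    by_contra hc
    rw [integral_undef hc] at h
    exact absurd h (by positivity)
  rw [eLpNorm_eq_lintegral_rpow_enorm_toReal (by simp) (by simp), ENNReal.toReal_ofNat]
  have e : ∀ k : Space, ‖(Real.exp (-(a * ‖k‖ ^ 2)) : ℂ)‖ₑ ^ (2 : ℝ) =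
      ENNReal.ofReal (Real.exp (-(2 * a) * ‖k‖ ^ 2)) := fun k => by
    rw [← ofReal_norm, Complex.norm_real, Real.norm_of_nonneg (Real.exp_nonneg _),
      ENNReal.ofReal_rpow_of_nonneg (Real.exp_nonneg _) (by norm_num), ← Real.exp_mul]
    ring_nf
  simp only [e]
  rw [← ofReal_integral_eq_lintegral_ofReal hi (.of_forall fun k => Real.exp_nonneg _), h,
    ENNReal.ofReal_rpow_of_nonneg (by positivity) (by positivity), ← Real.rpow_mul (by positivity)]
  simp
  norm_num

lemma eLpNorm_fourier_two (ψ : 𝓢(Space, ℂ)) :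
    eLpNorm (𝓕 ψ : 𝓢(Space, ℂ)) 2 volume = eLpNorm ψ 2 volume := by
  have h := SchwartzMap.norm_fourier_toL2_eq ψ
  have h1 : eLpNorm (𝓕 ψ : 𝓢(Space, ℂ)) 2 volume ≠ ⊤ :=
    (SchwartzMap.memLp (𝓕 ψ : 𝓢(Space, ℂ)) 2 volume).eLpNorm_ne_top
  have h2 : eLpNorm ψ 2 volume ≠ ⊤ := (SchwartzMap.memLp ψ 2 volume).eLpNorm_ne_top
  rw [SchwartzMap.norm_toLp, SchwartzMap.norm_toLp] at h
  rwa [ENNReal.toReal_eq_toReal_iff' h1 h2] at h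

/-- The predual form of the Gaussian bound. The transform of ψ is bounded in L² by Plancherel, since
the weight is at least 1, and in L^∞ by Cauchy–Schwarz against the reciprocal Gaussian;
interpolation gives L^q, with the constant expressed through the conjugate exponent `p`. -/
lemma eLpNorm_fourier_le {ψ : 𝓢(Space, ℂ)} {a : ℝ} (ha : 0 < a)
    (hψ : MemLp (fun k => (Real.exp (a * ‖k‖ ^ 2) : ℂ) * ψ k) 2 volume)
    {p q : ℝ≥0∞} [ENNReal.HolderConjugate p q] (hq : 2 ≤ q) :
    eLpNorm (𝓕 ψ : 𝓢(Space, ℂ)) q volume ≤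
      gaussConst p a * eLpNorm (fun k => (Real.exp (a * ‖k‖ ^ 2) : ℂ) * ψ k) 2 volume := by
  set S := eLpNorm (fun k => (Real.exp (a * ‖k‖ ^ 2) : ℂ) * ψ k) 2 volume with hS
  set g := ENNReal.ofReal ((Real.pi / (2 * a)) ^ (3 / 4 : ℝ)) with hg
  have h2 : eLpNorm (𝓕 ψ : 𝓢(Space, ℂ)) 2 volume ≤ S := by
    rw [eLpNorm_fourier_two]
    refine eLpNorm_mono fun k => ?_
    rw [norm_mul, Complex.norm_real, Real.norm_of_nonneg (Real.exp_nonneg _)]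
    exact le_mul_of_one_le_left (norm_nonneg _) (Real.one_le_exp (by positivity))
  have hM : ∀ x, ‖(𝓕 ψ : 𝓢(Space, ℂ)) x‖ₑ ≤ g * S := by
    intro x
    have h1 : ‖(𝓕 ψ : 𝓢(Space, ℂ)) x‖ₑ ≤ ∫⁻ k, ‖ψ k‖ₑ := by
      rw [SchwartzMap.fourier_coe, Real.fourier_eq]
      refine (enorm_integral_le_lintegral_enorm _).trans (le_of_eq (lintegral_congr fun k => ?_))
      rw [← ofReal_norm, ← ofReal_norm, Circle.norm_smul]
    refine h1.trans ?_
    have hgm : AEStronglyMeasurable (fun k : Space => (Real.exp (-(a * ‖k‖ ^ 2)) : ℂ)) volume :=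
      (by fun_prop : Continuous _).aestronglyMeasurable
    have h := eLpNorm_smul_le_mul_eLpNorm (p := 2) (q := 2) (r := 1) hψ.1 hgm
    rw [eLpNorm_gaussian ha, eLpNorm_one_eq_lintegral_enorm] at h
    refine le_trans (le_of_eq (lintegral_congr fun k => ?_)) h
    simp only [Pi.smul_apply', smul_eq_mul, ← mul_assoc]
    rw [← Complex.ofReal_mul, ← Real.exp_add]
    simp
  have hSt : S ≠ ⊤ := hψ.2.ne
  refine (eLpNorm_le_interpolation hq hM (by finiteness) h2).trans (le_of_eq ?_)
  have hpq : (p⁻¹).toReal + (q⁻¹).toReal = 1 := by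
    have h0 := ENNReal.HolderConjugate.inv_add_inv_eq_one p q
    have h := congrArg ENNReal.toReal h0
    have hs : p⁻¹ + q⁻¹ ≠ ⊤ := by rw [h0]; simp
    rwa [ENNReal.toReal_add (ENNReal.add_ne_top.1 hs).1 (ENNReal.add_ne_top.1 hs).2,
      ENNReal.toReal_one] at h
  have hq2 : (q⁻¹).toReal ≤ 1 / 2 := by
    have := ENNReal.toReal_mono (by simp) (ENNReal.inv_le_inv.2 hq)
    simpa using this
  have hq0 : 0 ≤ (q⁻¹).toReal := ENNReal.toReal_nonneg
  rw [ENNReal.mul_rpow_of_nonneg _ _ (by linarith), mul_assoc,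
    ← ENNReal.rpow_add_of_nonneg _ _ (by linarith) (by linarith), sub_add_cancel,
    ENNReal.rpow_one, gaussConst, hg, ENNReal.ofReal_rpow_of_nonneg (by positivity) (by linarith),
    ← Real.rpow_mul (by positivity)]
  rw [show (3 / 4 : ℝ) * (1 - 2 * (q⁻¹).toReal) = 3 / 2 * ((p⁻¹).toReal - 1 / 2) by linarith]

/-- Compactly supported Schwartz functions. -/
def compactSchwartz : Submodule ℂ 𝓢(Space, ℂ) where
  carrier := {ψ | HasCompactSupport ψ}
  add_mem' := fun h h' => h.add h'
  zero_mem' := HasCompactSupport.zero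
  smul_mem' := fun c ψ h => (h : HasCompactSupport ψ).mono fun x hx => by
    contrapose! hx
    simp only [Function.mem_support, not_not] at hx ⊢
    simp [hx]

lemma memLp_continuous_mul_schwartz (g : Space → ℂ) (hg : Continuous g) (ψ : 𝓢(Space, ℂ))
    (hψ : HasCompactSupport ψ) : MemLp (fun k => g k * ψ k) 2 volume :=
  (hg.mul ψ.continuous).memLp_of_hasCompactSupport hψ.mul_left

/-- Multiplication of compactly supported Schwartz functions by a continuous function. -/
noncomputable def mulToLp (g : Space → ℂ) (hg : Continuous g) :
    compactSchwartz →ₗ[ℂ] Lp ℂ 2 (volume : Measure Space) where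
  toFun ψ := (memLp_continuous_mul_schwartz g hg ψ ψ.2).toLp
  map_add' ψ φ := by
    rw [← MemLp.toLp_add]
    refine MemLp.toLp_congr _ _ (.of_forall fun k => ?_)
    simp [mul_add]
  map_smul' c ψ := by
    rw [RingHom.id_apply, ← MemLp.toLp_const_smul]
    refine MemLp.toLp_congr _ _ (.of_forall fun k => ?_)
    simp only [Submodule.coe_smul, smul_apply, Pi.smul_apply, smul_eq_mul]
    ring

/-- A smooth compactly supported approximant stays one after division by the smooth nonvanishing
`g`. -/
lemma denseRange_mulToLp (g : Space → ℂ) (hg : ContDiff ℝ (⊤ : ℕ∞) g) (h0 : ∀ k, g k ≠ 0) :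
    DenseRange (mulToLp g hg.continuous) := by
  intro f
  refine (mem_closure_iff_nhds_basis Metric.nhds_basis_closedBall).2 fun ε hε ↦ ?_
  obtain ⟨φ, hφc, hφs, hφ⟩ := (Lp.memLp f).exist_eLpNorm_sub_le (by simp) (by norm_num) hε
  obtain ⟨ψ, hψ, hψφ⟩ := exists_schwartzMap_of_contDiff (g := fun k => (g k)⁻¹ * φ k)
    hφc.mul_left ((hg.inv h0).mul hφs)
  refine ⟨_, ⟨⟨ψ, hψ⟩, rfl⟩, ?_⟩
  rw [Metric.mem_closedBall, dist_comm, Lp.dist_def]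
  refine ENNReal.toReal_le_of_le_ofReal hε.le (le_trans (le_of_eq (eLpNorm_congr_ae ?_)) hφ)
  filter_upwards [(memLp_continuous_mul_schwartz g hg.continuous ψ hψ).coeFn_toLp] with k hk
  simp only [Pi.sub_apply]
  congr 1
  refine hk.trans ?_
  rw [hψφ, mul_inv_cancel_left₀ (h0 k)]

/-- By Hölder and `eLpNorm_fourier_le`, the functional ψ ↦ T(𝓕ψ) is bounded for the norm
‖exp(a|k|²)ψ‖₂. It extends to L² by density, and the Riesz representative, conjugated and multiplied
by exp(a|k|²), is the transform of T; its norm is the asserted weighted bound. -/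
lemma exists_hasFourier_gaussian {T : Dist} {F : Space → ℂ} {p : ℝ≥0∞} (hp1 : 1 ≤ p) (hp2 : p ≤ 2)
    (hF : MemLp F p volume) (hT : ∀ φ : 𝓢(Space, ℂ), T φ = ∫ x, φ x * F x) {a : ℝ} (ha : 0 < a) :
    ∃ h, HasFourier T h ∧ eLpNorm (fun k => (Real.exp (-(a * ‖k‖ ^ 2)) : ℂ) * h k) 2 volume ≤
      gaussConst p a * eLpNorm F p volume := by
  have : ENNReal.HolderConjugate p (1 - p⁻¹)⁻¹ := ENNReal.HolderConjugate.inv_one_sub_inv' hp1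
  set q := (1 - p⁻¹)⁻¹ with hq
  have hq2 : 2 ≤ q := by
    rw [hq, ENNReal.le_inv_iff_le_inv, tsub_le_iff_right]
    calc (1 : ℝ≥0∞) = 2⁻¹ + 2⁻¹ := ENNReal.inv_two_add_inv_two.symm
      _ ≤ 2⁻¹ + p⁻¹ := by gcongr
  have hgs : ContDiff ℝ (⊤ : ℕ∞) fun k : Space => (Real.exp (a * ‖k‖ ^ 2) : ℂ) :=
    Complex.ofRealCLM.contDiff.comp (Real.contDiff_exp.comp (contDiff_const.mul (contDiff_norm_sq ℝ)))
  have hg0 : ∀ k : Space, (Real.exp (a * ‖k‖ ^ 2) : ℂ) ≠ 0 := fun k => by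
    exact_mod_cast (Real.exp_pos _).ne'
  set e := mulToLp _ hgs.continuous with he
  have hd : DenseRange e := denseRange_mulToLp _ hgs hg0
  have hFt : eLpNorm F p volume ≠ ⊤ := hF.2.ne
  have hgt : gaussConst p a ≠ ⊤ := ENNReal.ofReal_ne_top
  set A : ℝ := (gaussConst p a * eLpNorm F p volume).toReal with hA
  let Λ : compactSchwartz →ₗ[ℂ] ℂ :=
    { toFun := fun ψ => T (𝓕 (ψ : 𝓢(Space, ℂ)))
      map_add' := fun ψ φ => by
        rw [Submodule.coe_add, FourierTransform.fourier_add, map_add]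
      map_smul' := fun c ψ => by
        rw [Submodule.coe_smul, FourierTransform.fourier_smul, map_smul, RingHom.id_apply] }
  have hΛ : ∀ ψ, ‖Λ ψ‖ ≤ A * ‖e ψ‖ := by
    intro ψ
    have hm := memLp_continuous_mul_schwartz _ hgs.continuous ψ ψ.2
    have h1 : ‖Λ ψ‖ₑ ≤ gaussConst p a * eLpNorm F p volume *
        eLpNorm (fun k => (Real.exp (a * ‖k‖ ^ 2) : ℂ) * (ψ : 𝓢(Space, ℂ)) k) 2 volume := by
      change ‖T (𝓕 (ψ : 𝓢(Space, ℂ)))‖ₑ ≤ _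
      rw [hT]
      simp only [mul_comm _ (F _)]
      refine (enorm_integral_mul_le (p := p) (q := q) hF.1
        (SchwartzMap.continuous _).aestronglyMeasurable).trans ?_
      calc _ ≤ _ := mul_le_mul_right (eLpNorm_fourier_le (p := p) ha hm hq2) _
        _ = _ := by ring
    have h2 := ENNReal.toReal_mono (by have := hm.2.ne; finiteness) h1
    rw [toReal_enorm, ENNReal.toReal_mul, ← hA] at h2
    rwa [he, show mulToLp _ hgs.continuous ψ = hm.toLp from rfl, Lp.norm_toLp]
  set Λ' := Λ.extendOfNorm e with hΛ'
  set W := (InnerProductSpace.toDual ℂ (Lp ℂ 2 (volume : Measure Space))).symm Λ' with hW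
  have hWn : ‖W‖ ≤ A := by
    rw [hW, LinearIsometryEquiv.norm_map]
    exact LinearMap.opNorm_extendOfNorm_le hd ENNReal.toReal_nonneg hΛ
  have hWa : ∀ ψ : 𝓢(Space, ℂ), HasCompactSupport ψ → T (𝓕 ψ) =
      ∫ k, ψ k * ((Real.exp (a * ‖k‖ ^ 2) : ℂ) * starRingEnd ℂ (W k)) := by
    intro ψ hψ
    have h1 : Λ' (e ⟨ψ, hψ⟩) = T (𝓕 ψ) := LinearMap.extendOfNorm_eq hd ⟨A, hΛ⟩ _
    have h2 : inner ℂ W (e ⟨ψ, hψ⟩) = Λ' (e ⟨ψ, hψ⟩) := InnerProductSpace.toDual_symm_apply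
    rw [← h1, ← h2, L2.inner_def]
    refine integral_congr_ae ?_
    filter_upwards [(memLp_continuous_mul_schwartz _ hgs.continuous ψ hψ).coeFn_toLp] with k hk
    rw [show e ⟨ψ, hψ⟩ = (memLp_continuous_mul_schwartz _ hgs.continuous ψ hψ).toLp from rfl, hk,
      RCLike.inner_apply]
    ring
  have hWc : MemLp (fun k => starRingEnd ℂ (W k)) 2 volume :=
    (Lp.memLp W).of_le (Complex.continuous_conj.comp_aestronglyMeasurable (Lp.memLp W).1)
      (.of_forall fun k => by simp)
  refine ⟨fun k => (Real.exp (a * ‖k‖ ^ 2) : ℂ) * starRingEnd ℂ (W k),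
    ⟨LocallyIntegrable.continuous_mul (hWc.locallyIntegrable (by norm_num)) hgs.continuous, hWa⟩, ?_⟩
  have e1 : eLpNorm (fun k => (Real.exp (-(a * ‖k‖ ^ 2)) : ℂ) *
      ((Real.exp (a * ‖k‖ ^ 2) : ℂ) * starRingEnd ℂ (W k))) 2 volume = eLpNorm W 2 volume := by
    refine eLpNorm_congr_norm_ae (.of_forall fun k => ?_)
    rw [← mul_assoc, ← Complex.ofReal_mul, ← Real.exp_add]
    simp
  rw [e1]
  rw [Lp.norm_def] at hWn
  exact (ENNReal.toReal_le_toReal (Lp.memLp W).2.ne (by finiteness)).1 hWn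

/-- The Fourier transform of an `L^p` function, `1 ≤ p ≤ 2`, is a function whose product with any
Gaussian is square integrable, with a bound. -/
theorem exists_hasFourier {T : Dist} {F : Space → ℂ} {p : ℝ≥0∞} (hp1 : 1 ≤ p) (hp2 : p ≤ 2)
    (hF : MemLp F p volume) (hT : ∀ φ : 𝓢(Space, ℂ), T φ = ∫ x, φ x * F x) :
    ∃ h, HasFourier T h ∧ ∀ a, 0 < a →
      eLpNorm (fun k => (Real.exp (-(a * ‖k‖ ^ 2)) : ℂ) * h k) 2 volume ≤
        gaussConst p a * eLpNorm F p volume := by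
  -- The construction depends on `a`, but the transform is unique almost everywhere, so the function
  -- built for a = 1 satisfies the bound for every `a`.
  obtain ⟨h, hh, -⟩ := exists_hasFourier_gaussian hp1 hp2 hF hT one_pos
  refine ⟨h, hh, fun a ha => ?_⟩
  obtain ⟨h', hh', hb⟩ := exists_hasFourier_gaussian hp1 hp2 hF hT ha
  refine le_of_eq_of_le (eLpNorm_congr_ae ?_) hb
  filter_upwards [hh.ae_eq hh'] with k hk
  rw [hk]

/-! ### Bilinear estimates on the Fourier side -/

/-- The length of the frequency `2 π k`. -/
noncomputable def freq (k : Space) : ℝ := 2 * Real.pi * ‖k‖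

lemma freq_nonneg (k : Space) : 0 ≤ freq k := by unfold freq; positivity

lemma continuous_freq : Continuous freq := by unfold freq; fun_prop

/-- `H` satisfies the Gaussian-weighted bounds of the Fourier transform of a function with `L^p`
norm `N`. -/
structure GaussBound (p : ℝ≥0∞) (H : Space → ℝ) (N : ℝ≥0∞) : Prop where
  meas : AEStronglyMeasurable H volume
  bound : ∀ a, 0 < a → eLpNorm (fun k => Real.exp (-(a * ‖k‖ ^ 2)) * H k) 2 volume ≤
    gaussConst p a * N

lemma GaussBound.of_norm {p N : ℝ≥0∞} {h : Space → ℂ} (hm : AEStronglyMeasurable h volume)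
    (hb : ∀ a, 0 < a → eLpNorm (fun k => (Real.exp (-(a * ‖k‖ ^ 2)) : ℂ) * h k) 2 volume ≤
      gaussConst p a * N) : GaussBound p (fun k => ‖h k‖) N :=
  ⟨hm.norm, fun a ha => by
    refine le_of_eq_of_le (eLpNorm_congr_norm_ae (.of_forall fun k => ?_)) (hb a ha)
    rw [norm_mul, norm_mul, norm_norm, Complex.norm_real]⟩

lemma GaussBound.sum {ι : Type*} [Fintype ι] {p : ℝ≥0∞} {H : ι → Space → ℝ} {N : ι → ℝ≥0∞}
    (h : ∀ i, GaussBound p (H i) (N i)) : GaussBound p (fun k => ∑ i, H i k) (∑ i, N i) := by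
  refine ⟨Finset.aestronglyMeasurable_fun_sum _ fun i _ => (h i).1, fun a ha => ?_⟩
  have e : (fun k : Space => Real.exp (-(a * ‖k‖ ^ 2)) * ∑ i, H i k) =
      ∑ i, fun k => Real.exp (-(a * ‖k‖ ^ 2)) * H i k := by
    ext k; simp [Finset.mul_sum]
  rw [e, Finset.mul_sum]
  refine (eLpNorm_sum_le (fun i _ => ?_) (by norm_num)).trans (Finset.sum_le_sum fun i _ =>
    (h i).2 a ha)
  exact ((by fun_prop : Continuous fun k : Space =>
    Real.exp (-(a * ‖k‖ ^ 2))).aestronglyMeasurable).mul (h i).1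

lemma GaussBound.mono {p N N' : ℝ≥0∞} {H H' : Space → ℝ} (h : GaussBound p H N)
    (hm : AEStronglyMeasurable H' volume) (hH : ∀ᵐ k, |H' k| ≤ |H k|) (hN : N ≤ N') :
    GaussBound p H' N' :=
  ⟨hm, fun a ha => (eLpNorm_mono_ae (hH.mono fun k hk => by
    rw [norm_mul, norm_mul]; exact mul_le_mul_of_nonneg_left hk (norm_nonneg _))).trans
      ((h.2 a ha).trans (by gcongr))⟩

lemma GaussBound.const_mul {p N : ℝ≥0∞} {H : Space → ℝ} (h : GaussBound p H N) {c : ℝ}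
    (hc : 0 ≤ c) : GaussBound p (fun k => c * H k) (ENNReal.ofReal c * N) :=
  ⟨h.1.const_mul c, fun a ha => by
    simp only [mul_left_comm _ c]
    refine (eLpNorm_const_smul_le (c := c)
      (f := fun k : Space => Real.exp (-(a * ‖k‖ ^ 2)) * H k)).trans ?_
    rw [Real.enorm_eq_ofReal hc, mul_left_comm]
    gcongr
    exact h.2 a ha⟩

lemma lintegral_mul_le_eLpNorm_two {f g : Space → ℝ} (hf : AEStronglyMeasurable f volume)
    (hg : AEStronglyMeasurable g volume) :
    ∫⁻ k, ‖f k‖ₑ * ‖g k‖ₑ ≤ eLpNorm f 2 volume * eLpNorm g 2 volume := by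
  have := eLpNorm_smul_le_mul_eLpNorm (p := 2) (q := 2) (r := 1) hg hf
  rw [eLpNorm_one_eq_lintegral_enorm] at this
  simpa [enorm_mul] using this

lemma exists_rpow_mul_exp_le (b : ℝ) (hb : 0 ≤ b) {lam : ℝ} (hl : 0 < lam) :
    ∃ C, 0 < C ∧ ∀ x, 0 ≤ x → x ^ b * Real.exp (-lam * x) ≤ C := by
  obtain ⟨n, hn⟩ := exists_nat_ge b
  refine ⟨n.factorial / lam ^ n * Real.exp lam, by positivity, fun x hx => ?_⟩
  have h1 : x ^ b ≤ (1 + x) ^ n := by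
    rw [← Real.rpow_natCast]
    exact (Real.rpow_le_rpow hx (by linarith) hb).trans
      (Real.rpow_le_rpow_of_exponent_le (by linarith) hn)
  have h2 := Real.pow_div_factorial_le_exp (lam * (1 + x)) (by positivity) n
  rw [mul_pow, div_le_iff₀ (by positivity)] at h2
  have h3 : (1 + x) ^ n ≤ n.factorial / lam ^ n * Real.exp (lam * (1 + x)) := by
    rw [div_mul_eq_mul_div, le_div_iff₀ (by positivity)]
    linarith
  calc x ^ b * Real.exp (-lam * x) ≤
        n.factorial / lam ^ n * Real.exp (lam * (1 + x)) * Real.exp (-lam * x) := by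
        gcongr; exact h1.trans h3
    _ = _ := by rw [mul_assoc, ← Real.exp_add]; ring_nf

/-- The source of the rate (1+t)^(-(3/2)(1/p-1/q)): one Gaussian of width parameter c(1+t) goes to
the data, one to the test function, and (1/p - 1/2) + (1/p' - 1/2) = 1/p - 1/q. -/
lemma gaussConst_mul_gaussConst {p p' q : ℝ≥0∞} (hpq : (p'⁻¹).toReal + (q⁻¹).toReal = 1)
    {c t : ℝ} (hc : 0 < c) (ht : 0 ≤ t) :
    gaussConst p (c * (1 + t)) * gaussConst p' (c * (1 + t)) =
      ENNReal.ofReal ((Real.pi / (2 * c)) ^ ((3 / 2 : ℝ) * ((p⁻¹).toReal - (q⁻¹).toReal))) *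
        polyRate p q 0 t := by
  have h1 : (3 / 2 : ℝ) * ((p'⁻¹).toReal - 1 / 2) = 3 / 2 * (1 / 2 - (q⁻¹).toReal) := by linarith
  have e : Real.pi / (2 * (c * (1 + t))) = Real.pi / (2 * c) * (1 + t)⁻¹ := by field_simp
  rw [gaussConst, gaussConst, polyRate, ← ENNReal.ofReal_mul (by positivity),
    ← ENNReal.ofReal_mul (by positivity), ← Real.rpow_add (by positivity), h1, e,
    Real.mul_rpow (by positivity) (by positivity), Real.inv_rpow (by positivity),
    ← Real.rpow_neg (by positivity)]
  congr 3 <;> · push_cast; ring_nf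

lemma polyRate_mul (p q : ℝ≥0∞) (n : ℕ) {t : ℝ} (ht : 0 ≤ t) :
    ENNReal.ofReal ((1 + t) ^ (-(n / 2 : ℝ))) * polyRate p q 0 t = polyRate p q n t := by
  rw [polyRate, polyRate, ← ENNReal.ofReal_mul (by positivity), ← Real.rpow_add (by positivity)]
  congr 2
  push_cast; ring

/-- The low-frequency bilinear estimate. -/
lemma exists_low_frequency_bound (p p' q : ℝ≥0∞) (hpq : (p'⁻¹).toReal + (q⁻¹).toReal = 1) (n : ℕ)
    {lam r : ℝ} (hl : 0 < lam) : ∃ C : ℝ≥0∞, C ≠ ⊤ ∧ ∀ (H G : Space → ℝ) (N M : ℝ≥0∞),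
      GaussBound p H N → GaussBound p' G M → ∀ t, 0 ≤ t →
      ∫⁻ k in {k | freq k ≤ r}, ENNReal.ofReal (freq k ^ n * Real.exp (-lam * freq k ^ 2 * t)) *
        (‖H k‖ₑ * ‖G k‖ₑ) ≤ C * polyRate p q n t * (N * M) := by
  obtain ⟨C₁, hC₁, hb⟩ := exists_rpow_mul_exp_le (n / 2 : ℝ) (by positivity) (half_pos hl)
  -- For |ξ| = 2π|k| the two Gaussians with a = c(1+t) multiply to exp(-(λ/2)|ξ|²(1+t)). The other
  -- half of the exponent turns |ξ|ⁿ into (1+t)^(-n/2). Replacing t by 1+t costs exp(λ|ξ|²), bounded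
  -- because |ξ| ≤ r.
  set c := lam * Real.pi ^ 2 with hc
  have hc0 : 0 < c := by positivity
  set D := ENNReal.ofReal ((Real.pi / (2 * c)) ^ ((3 / 2 : ℝ) * ((p⁻¹).toReal - (q⁻¹).toReal)))
  refine ⟨ENNReal.ofReal (Real.exp (lam * r ^ 2) * C₁) * D, by finiteness,
    fun H G N M hH hG t ht => ?_⟩
  set a := c * (1 + t) with ha
  have ha0 : 0 < a := by positivity
  set H' : Space → ℝ := fun k => Real.exp (-(a * ‖k‖ ^ 2)) * H k with hH'
  set G' : Space → ℝ := fun k => Real.exp (-(a * ‖k‖ ^ 2)) * G k with hG'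
  have hexp : AEStronglyMeasurable (fun k : Space => Real.exp (-(a * ‖k‖ ^ 2))) volume :=
    (by fun_prop : Continuous _).aestronglyMeasurable
  have hmeas : MeasurableSet {k | freq k ≤ r} := measurableSet_le continuous_freq.measurable
    measurable_const
  have hpt : ∀ k, freq k ≤ r → freq k ^ n * Real.exp (-lam * freq k ^ 2 * t) ≤
      Real.exp (lam * r ^ 2) * C₁ * (1 + t) ^ (-(n / 2 : ℝ)) *
        (Real.exp (-(a * ‖k‖ ^ 2)) * Real.exp (-(a * ‖k‖ ^ 2))) := by
    intro k hk
    have hκ := freq_nonneg k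
    set κ := freq k with hκd
    have h1 := hb (κ ^ 2 * (1 + t)) (by positivity)
    rw [Real.mul_rpow (by positivity) (by positivity), ← Real.rpow_natCast κ 2, ← Real.rpow_mul hκ,
      show ((2 : ℕ) : ℝ) * (n / 2 : ℝ) = n by push_cast; ring, Real.rpow_natCast,
      Real.rpow_natCast] at h1
    have e1 : Real.exp (-(a * ‖k‖ ^ 2)) * Real.exp (-(a * ‖k‖ ^ 2)) =
        Real.exp (-(lam / 2) * (κ ^ 2 * (1 + t))) := by
      rw [← Real.exp_add, hκd, freq, ha, hc]; ring_nf
    have e2 : Real.exp (-lam * κ ^ 2 * t) = Real.exp (lam * κ ^ 2) *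
        (Real.exp (-(lam / 2) * (κ ^ 2 * (1 + t))) * Real.exp (-(lam / 2) * (κ ^ 2 * (1 + t)))) := by
      rw [← Real.exp_add, ← Real.exp_add]; ring_nf
    have h2 : Real.exp (lam * κ ^ 2) ≤ Real.exp (lam * r ^ 2) := by gcongr
    have hT : 0 < (1 + t) ^ (n / 2 : ℝ) := by positivity
    rw [e1, e2, Real.rpow_neg (by positivity)]
    set X := Real.exp (-(lam / 2) * (κ ^ 2 * (1 + t)))
    have h3 : κ ^ n * X ≤ C₁ * ((1 + t) ^ (n / 2 : ℝ))⁻¹ := by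
      rw [← div_eq_mul_inv, le_div_iff₀ hT]; linarith
    calc κ ^ n * (Real.exp (lam * κ ^ 2) * (X * X)) = Real.exp (lam * κ ^ 2) * (κ ^ n * X) * X := by
          ring
      _ ≤ Real.exp (lam * r ^ 2) * (C₁ * ((1 + t) ^ (n / 2 : ℝ))⁻¹) * X := by gcongr
      _ = _ := by ring
  calc _ ≤ ∫⁻ k in {k | freq k ≤ r}, ENNReal.ofReal (Real.exp (lam * r ^ 2) * C₁ *
        (1 + t) ^ (-(n / 2 : ℝ))) * (‖H' k‖ₑ * ‖G' k‖ₑ) := by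
        refine setLIntegral_mono' hmeas fun k hk => ?_
        refine (mul_le_mul_left (ENNReal.ofReal_le_ofReal (hpt k hk)) _).trans (le_of_eq ?_)
        simp only [hH', hG', enorm_mul, Real.enorm_eq_ofReal (Real.exp_nonneg _)]
        rw [ENNReal.ofReal_mul (by positivity), ENNReal.ofReal_mul (Real.exp_nonneg _)]
        ring
    _ ≤ ∫⁻ k, ENNReal.ofReal (Real.exp (lam * r ^ 2) * C₁ *
        (1 + t) ^ (-(n / 2 : ℝ))) * (‖H' k‖ₑ * ‖G' k‖ₑ) := setLIntegral_le_lintegral _ _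
    _ = ENNReal.ofReal (Real.exp (lam * r ^ 2) * C₁ *
        (1 + t) ^ (-(n / 2 : ℝ))) * ∫⁻ k, ‖H' k‖ₑ * ‖G' k‖ₑ :=
      lintegral_const_mul' _ _ ENNReal.ofReal_ne_top
    _ ≤ ENNReal.ofReal (Real.exp (lam * r ^ 2) * C₁ *
        (1 + t) ^ (-(n / 2 : ℝ))) * ((gaussConst p a * N) * (gaussConst p' a * M)) := by
      gcongr
      refine (lintegral_mul_le_eLpNorm_two (hexp.mul hH.1) (hexp.mul hG.1)).trans ?_
      gcongr
      · exact hH.2 a ha0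
      · exact hG.2 a ha0
    _ = _ := by
      rw [mul_mul_mul_comm (gaussConst p a), ha, gaussConst_mul_gaussConst hpq hc0 ht,
        ENNReal.ofReal_mul (by positivity), ← polyRate_mul p q n ht]
      ring

lemma sq_eLpNorm_two (f : Space → ℝ) : eLpNorm f 2 volume ^ 2 = ∫⁻ k, ‖f k‖ₑ ^ 2 := by
  rw [eLpNorm_eq_lintegral_rpow_enorm_toReal (by simp) (by simp), ENNReal.toReal_ofNat,
    ← ENNReal.rpow_natCast, ← ENNReal.rpow_mul]
  norm_num

lemma gaussConst_two (a : ℝ) : gaussConst 2 a = 1 := by simp [gaussConst]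

/-- For p = 2 the Gaussian constant is 1, so the weight can be removed by letting a → 0 with Fatou's
lemma. -/
lemma GaussBound.eLpNorm_two_le {H : Space → ℝ} {N : ℝ≥0∞} (h : GaussBound 2 H N) :
    eLpNorm H 2 volume ≤ N := by
  have h1 : ∀ n : ℕ, eLpNorm (fun k => Real.exp (-((n + 1 : ℝ)⁻¹ * ‖k‖ ^ 2)) * H k) 2 volume ≤ N :=
    fun n => by simpa [gaussConst_two] using h.2 (n + 1 : ℝ)⁻¹ (by positivity)
  refine (Lp.eLpNorm_lim_le_liminf_eLpNorm (f := fun (n : ℕ) k =>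
    Real.exp (-((n + 1 : ℝ)⁻¹ * ‖k‖ ^ 2)) * H k) (fun n => ?_) H (.of_forall fun k => ?_)).trans ?_
  · exact ((by fun_prop : Continuous fun k : Space =>
      Real.exp (-((n + 1 : ℝ)⁻¹ * ‖k‖ ^ 2))).aestronglyMeasurable).mul h.1
  · have h2 : Filter.Tendsto (fun n : ℕ => (n + 1 : ℝ)⁻¹) Filter.atTop (nhds 0) := by
      simpa [one_div] using tendsto_one_div_add_atTop_nhds_zero_nat (𝕜 := ℝ)
    have := ((Real.continuous_exp.tendsto _).comp (h2.mul_const (‖k‖ ^ 2)).neg).mul_const (H k)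
    simpa using this
  · exact Filter.liminf_le_of_le (by isBoundedDefault) fun b hb => by
      obtain ⟨n, hn⟩ := hb.exists
      exact hn.trans (h1 n)

/-- Exponents `s` for which the weight `|ξ|^{-s}` at high frequencies maps Fourier transforms of
`L^p` functions into `L^2`. -/
def IsHighExponent (p : ℝ≥0∞) (s : ℝ) : Prop :=
  0 ≤ s ∧ (3 * ((p⁻¹).toReal - 1 / 2) < s ∨ p = 2)

/-- A dyadic argument: on the shell |ξ| ~ 2ⁿ the Gaussian exp(-4⁻ⁿ|ξ|²) is bounded below, so the
Gaussian bound controls the L² mass there by a multiple of 4^(3n(1/p-1/2)). The weight contributes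
4^(-ns) to the square, and the sum over n is geometric with ratio below 1. For p = 2 no sum is
needed. -/
lemma exists_high_weight_bound {p : ℝ≥0∞} {s r : ℝ} (hs : IsHighExponent p s) (hr : 0 < r) :
    ∃ C : ℝ≥0∞, C ≠ ⊤ ∧ ∀ (H : Space → ℝ) (N : ℝ≥0∞), GaussBound p H N →
      eLpNorm ({k | r ≤ freq k}.indicator fun k => freq k ^ (-s) * H k) 2 volume ≤ C * N := by
  obtain ⟨hs0, hs | rfl⟩ := hs
  · set θ := (p⁻¹).toReal - 1 / 2 with hθ
    set C₀ := Real.exp 8 * (1 + r ^ (-(2 * s))) with hC₀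
    -- Chosen so that a(n)|k|² = 4⁻ⁿ|ξ|².
    set a : ℕ → ℝ := fun n => 4 * Real.pi ^ 2 * (1 / 4) ^ n with ha
    have ha0 : ∀ n, 0 < a n := fun n => by positivity
    set x : ℝ := 4 ^ (3 * θ - s) with hx
    have hx1 : x < 1 := Real.rpow_lt_one_of_one_lt_of_neg (by norm_num) (by linarith)
    have hx0 : 0 < x := by positivity
    set c₁ : ℝ := (8 * Real.pi)⁻¹ ^ (3 * θ) with hc₁
    set D : ℝ≥0∞ := ENNReal.ofReal C₀ * (ENNReal.ofReal c₁ * (1 - ENNReal.ofReal x)⁻¹) with hD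
    have hDt : D ≠ ⊤ := by
      refine ENNReal.mul_ne_top ENNReal.ofReal_ne_top (ENNReal.mul_ne_top ENNReal.ofReal_ne_top ?_)
      rw [ENNReal.inv_ne_top]
      exact (tsub_pos_of_lt (by rw [ENNReal.ofReal_lt_one]; exact hx1)).ne'
    refine ⟨D ^ (1 / 2 : ℝ), ENNReal.rpow_ne_top_of_nonneg (by norm_num) hDt, fun H N hH => ?_⟩
    have hgauss : ∀ n, ENNReal.ofReal ((4 : ℝ) ^ (-s)) ^ n * gaussConst p (a n) ^ 2 =
        ENNReal.ofReal c₁ * ENNReal.ofReal x ^ n := by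
      intro n
      have e : Real.pi / (2 * a n) = (8 * Real.pi)⁻¹ * 4 ^ n := by
        simp only [ha]; field_simp; rw [mul_assoc, ← mul_pow]; norm_num
      rw [gaussConst, ← ENNReal.ofReal_pow (by positivity), ← ENNReal.ofReal_pow (by positivity),
        ← ENNReal.ofReal_pow (by positivity), ← ENNReal.ofReal_mul (by positivity),
        ← ENNReal.ofReal_mul (by positivity), e, Real.mul_rpow (by positivity) (by positivity),
        mul_pow, ← Real.rpow_mul_natCast (by positivity), ← Real.rpow_mul_natCast (by positivity),
        ← Real.rpow_natCast_mul (by norm_num), ← Real.rpow_mul_natCast (by norm_num), hx,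
        ← Real.rpow_mul_natCast (by norm_num), mul_left_comm, ← Real.rpow_add (by norm_num)]
      congr 3 <;> · push_cast; ring
    -- For κ ≥ 1 take 2ⁿ ≤ κ < 2ⁿ⁺¹, so the squared Gaussian is at least exp(-8). For r ≤ κ < 1 take
    -- n = 0, at the price of the constant r^(-2s).
    have hpt : ∀ κ, r ≤ κ → ∃ n : ℕ, (κ ^ (-s)) ^ 2 ≤
        C₀ * ((4 : ℝ) ^ (-s)) ^ n * Real.exp (-((1 / 4) ^ n * κ ^ 2)) ^ 2 := by
      intro κ hκ
      have hκ0 : 0 < κ := hr.trans_le hκ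
      have hr0 : 0 < r ^ (-(2 * s)) := by positivity
      have e2 : (κ ^ (-s)) ^ 2 = κ ^ (-(2 * s)) := by
        rw [← Real.rpow_mul_natCast hκ0.le]; push_cast; ring_nf
      rw [e2]
      rcases le_or_gt 1 κ with h1 | h1
      · obtain ⟨n, hn1, hn2⟩ := exists_nat_pow_near h1 (by norm_num : (1 : ℝ) < 2)
        refine ⟨n, ?_⟩
        have e3 : κ ^ (-(2 * s)) ≤ ((4 : ℝ) ^ (-s)) ^ n := by
          calc κ ^ (-(2 * s)) ≤ ((2 : ℝ) ^ n) ^ (-(2 * s)) :=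
                Real.rpow_le_rpow_of_nonpos (by positivity) hn1 (by linarith)
            _ = _ := by
              rw [← Real.rpow_natCast_mul (by norm_num), ← Real.rpow_mul_natCast (by norm_num),
                show (4 : ℝ) = 2 ^ (2 : ℝ) by norm_num, ← Real.rpow_mul (by norm_num)]
              congr 1; ring
        have e4 : Real.exp (-8) ≤ Real.exp (-((1 / 4) ^ n * κ ^ 2)) ^ 2 := by
          rw [← Real.exp_nat_mul]
          refine Real.exp_le_exp.2 ?_
          have h5 : κ ^ 2 ≤ 4 * 4 ^ n := by
            calc κ ^ 2 ≤ (2 ^ (n + 1)) ^ 2 := by gcongr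
              _ = 4 * 4 ^ n := by rw [← pow_mul, mul_comm, pow_mul]; ring
          have h6 : (1 / 4 : ℝ) ^ n * κ ^ 2 ≤ 4 := by
            rw [one_div, inv_pow, inv_mul_le_iff₀ (by positivity)]; linarith
          push_cast; linarith
        calc κ ^ (-(2 * s)) ≤ ((4 : ℝ) ^ (-s)) ^ n := e3
          _ = (Real.exp 8 * 1) * ((4 : ℝ) ^ (-s)) ^ n * Real.exp (-8) := by
            rw [mul_one, mul_right_comm, ← Real.exp_add]; simp
          _ ≤ _ := by rw [hC₀]; gcongr; linarith
      · refine ⟨0, ?_⟩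
        have e4 : Real.exp (-8) ≤ Real.exp (-((1 / 4) ^ 0 * κ ^ 2)) ^ 2 := by
          rw [← Real.exp_nat_mul]
          refine Real.exp_le_exp.2 ?_
          push_cast; nlinarith
        calc κ ^ (-(2 * s)) ≤ r ^ (-(2 * s)) :=
              Real.rpow_le_rpow_of_nonpos hr hκ (by linarith)
          _ = (Real.exp 8 * r ^ (-(2 * s))) * ((4 : ℝ) ^ (-s)) ^ 0 * Real.exp (-8) := by
            rw [pow_zero, mul_one, mul_right_comm, ← Real.exp_add]; simp
          _ ≤ _ := by rw [hC₀]; gcongr; linarith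
    have hexp : ∀ n : ℕ, AEStronglyMeasurable
        (fun k : Space => Real.exp (-(a n * ‖k‖ ^ 2)) * H k) volume := fun n =>
      (by fun_prop : Continuous fun k : Space =>
        Real.exp (-(a n * ‖k‖ ^ 2))).aestronglyMeasurable.mul hH.1
    have hsq : eLpNorm ({k | r ≤ freq k}.indicator fun k => freq k ^ (-s) * H k) 2 volume ^ 2 ≤
        D * N ^ 2 := by
      rw [sq_eLpNorm_two]
      calc _ ≤ ∫⁻ k, ∑' n : ℕ, ENNReal.ofReal C₀ * (ENNReal.ofReal ((4 : ℝ) ^ (-s)) ^ n *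
            ‖Real.exp (-(a n * ‖k‖ ^ 2)) * H k‖ₑ ^ 2) := by
            refine lintegral_mono fun k => ?_
            by_cases hk : k ∈ {k | r ≤ freq k}
            · rw [Set.indicator_of_mem hk]
              obtain ⟨n, hn⟩ := hpt (freq k) hk
              refine le_trans ?_ (ENNReal.le_tsum n)
              have e : (1 / 4 : ℝ) ^ n * freq k ^ 2 = a n * ‖k‖ ^ 2 := by
                simp only [ha, freq]; ring
              rw [e] at hn
              rw [enorm_mul, enorm_mul, mul_pow, mul_pow, Real.enorm_eq_ofReal (Real.exp_nonneg _),
                Real.enorm_eq_ofReal (Real.rpow_nonneg (freq_nonneg k) _), ← mul_assoc, ← mul_assoc,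
                ← ENNReal.ofReal_pow (Real.rpow_nonneg (freq_nonneg k) _),
                ← ENNReal.ofReal_pow (by positivity), ← ENNReal.ofReal_pow (by positivity),
                ← ENNReal.ofReal_mul (by positivity), ← ENNReal.ofReal_mul (by positivity)]
              gcongr
            · rw [Set.indicator_of_notMem hk]; simp
        _ = ∑' n : ℕ, ENNReal.ofReal C₀ * (ENNReal.ofReal ((4 : ℝ) ^ (-s)) ^ n *
            eLpNorm (fun k => Real.exp (-(a n * ‖k‖ ^ 2)) * H k) 2 volume ^ 2) := by
            rw [lintegral_tsum fun n => (((hexp n).enorm.pow_const 2).const_mul _).const_mul _]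
            refine tsum_congr fun n => ?_
            rw [lintegral_const_mul' _ _ ENNReal.ofReal_ne_top,
              lintegral_const_mul' _ _ (by finiteness), sq_eLpNorm_two]
        _ ≤ ∑' n : ℕ, ENNReal.ofReal C₀ * (ENNReal.ofReal ((4 : ℝ) ^ (-s)) ^ n *
            (gaussConst p (a n) * N) ^ 2) := by
            gcongr with n
            exact hH.2 (a n) (ha0 n)
        _ = _ := by
            simp only [mul_pow, ← mul_assoc _ _ (N ^ 2), hgauss]
            rw [ENNReal.tsum_mul_right, ENNReal.tsum_mul_left, ENNReal.tsum_mul_left,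
              ENNReal.tsum_geometric, hD]
    calc _ = (eLpNorm ({k | r ≤ freq k}.indicator fun k => freq k ^ (-s) * H k) 2 volume ^ 2) ^
          (1 / 2 : ℝ) := by rw [← ENNReal.rpow_natCast, ← ENNReal.rpow_mul]; norm_num
      _ ≤ (D * N ^ 2) ^ (1 / 2 : ℝ) := by gcongr
      _ = _ := by
        rw [ENNReal.mul_rpow_of_nonneg _ _ (by norm_num), ← ENNReal.rpow_natCast N,
          ← ENNReal.rpow_mul]
        norm_num
  · refine ⟨ENNReal.ofReal (r ^ (-s)), by finiteness, fun H N hH => ?_⟩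
    have h1 : eLpNorm (fun k => r ^ (-s) * H k) 2 volume ≤ ENNReal.ofReal (r ^ (-s)) * N :=
      (hH.const_mul (by positivity)).eLpNorm_two_le
    refine (eLpNorm_mono fun k => ?_).trans h1
    rw [norm_mul, Real.norm_of_nonneg (Real.rpow_nonneg hr.le _)]
    by_cases hk : k ∈ {k | r ≤ freq k}
    · have hk' : r ≤ freq k := hk
      rw [Set.indicator_of_mem hk, norm_mul,
        Real.norm_of_nonneg (Real.rpow_nonneg (freq_nonneg k) _)]
      exact mul_le_mul_of_nonneg_right
        (Real.rpow_le_rpow_of_nonpos hr hk' (neg_nonpos.2 hs0)) (norm_nonneg _)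
    · rw [Set.indicator_of_notMem hk, norm_zero]
      exact mul_nonneg (Real.rpow_nonneg hr.le _) (norm_nonneg _)

/-- The high-frequency bilinear estimate. -/
lemma exists_high_frequency_bound {p p' : ℝ≥0∞} {s s' : ℝ} (hs : IsHighExponent p s)
    (hs' : IsHighExponent p' s') {l : ℝ} (hl : 0 ≤ l) {m M : ℕ} (hM : m + l + s + s' ≤ M)
    {lam r : ℝ} (hlam : 0 < lam) (hr : 0 < r) :
    ∃ C : ℝ≥0∞, C ≠ ⊤ ∧ ∀ (H G : Space → ℝ) (A B : ℝ≥0∞),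
      GaussBound p (fun k => freq k ^ M * H k) A → GaussBound p' G B → ∀ t, 0 ≤ t →
      ∫⁻ k in {k | r ≤ freq k}, ENNReal.ofReal (freq k ^ m *
        Real.exp (-(lam * (freq k)⁻¹ ^ 2) * t)) * (‖H k‖ₑ * ‖G k‖ₑ) ≤
        C * regLossRate l t * (A * B) := by
  obtain ⟨C₁, hC₁, hb⟩ := exists_rpow_mul_exp_le (l / 2 : ℝ) (by positivity) hlam
  obtain ⟨C₂, hC₂, hw⟩ := exists_high_weight_bound hs hr
  obtain ⟨C₃, hC₃, hw'⟩ := exists_high_weight_bound hs' hr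
  -- The surplus of derivatives is harmless on |ξ| ≥ r, where (|ξ|/r)^δ ≥ 1.
  set δ := (M : ℝ) - (m + l + s + s') with hδ
  have hδ0 : 0 ≤ δ := by linarith
  set C₀ := Real.exp (lam * r⁻¹ ^ 2) * C₁ * r ^ (-δ) with hC₀
  have hC₀0 : 0 < C₀ := by positivity
  refine ⟨ENNReal.ofReal C₀ * (C₂ * C₃), by finiteness, fun H G A B hH hG t ht => ?_⟩
  set S := {k : Space | r ≤ freq k} with hS
  have hmeas : MeasurableSet S := measurableSet_le measurable_const continuous_freq.measurable
  set H' : Space → ℝ := S.indicator fun k => freq k ^ (-s) * (freq k ^ M * H k) with hH'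
  set G' : Space → ℝ := S.indicator fun k => freq k ^ (-s') * G k with hG'
  have hfm : ∀ b : ℝ, AEStronglyMeasurable (fun k => freq k ^ b) volume := fun b =>
    (continuous_freq.measurable.pow_const b).aestronglyMeasurable
  have hpt : ∀ κ, r ≤ κ → κ ^ m * Real.exp (-(lam * κ⁻¹ ^ 2) * t) ≤
      C₀ * (1 + t) ^ (-l / 2) * (κ ^ (-s) * κ ^ M * κ ^ (-s')) := by
    intro κ hκ
    have hκ0 : 0 < κ := hr.trans_le hκ
    have h1 := hb (κ⁻¹ ^ 2 * (1 + t)) (by positivity)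
    rw [Real.mul_rpow (by positivity) (by positivity), ← Real.rpow_natCast_mul (by positivity),
      show ((2 : ℕ) : ℝ) * (l / 2) = l by push_cast; ring, Real.inv_rpow hκ0.le] at h1
    have e2 : Real.exp (-(lam * κ⁻¹ ^ 2) * t) =
        Real.exp (lam * κ⁻¹ ^ 2) * Real.exp (-lam * (κ⁻¹ ^ 2 * (1 + t))) := by
      rw [← Real.exp_add]; ring_nf
    have h2 : Real.exp (lam * κ⁻¹ ^ 2) ≤ Real.exp (lam * r⁻¹ ^ 2) := by gcongr
    have hT : 0 < (1 + t) ^ (l / 2) := by positivity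
    set X := Real.exp (-lam * (κ⁻¹ ^ 2 * (1 + t)))
    -- The regularity loss: the degenerate exponential is bounded in x = κ⁻²(1+t) by a multiple of
    -- x^(-l/2), that is, `l` powers of κ buy (1+t)^(-l/2).
    have h3 : X ≤ C₁ * κ ^ l * (1 + t) ^ (-l / 2) := by
      rw [neg_div, Real.rpow_neg (by positivity), ← div_eq_mul_inv, le_div_iff₀ hT]
      have h4 : 0 < κ ^ l := by positivity
      calc X * (1 + t) ^ (l / 2) = ((κ ^ l)⁻¹ * (1 + t) ^ (l / 2) * X) * κ ^ l := by field_simp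
        _ ≤ C₁ * κ ^ l := by gcongr
    have h5 : 1 ≤ r ^ (-δ) * κ ^ δ := by
      rw [Real.rpow_neg hr.le, ← div_eq_inv_mul, ← Real.div_rpow hκ0.le hr.le]
      exact Real.one_le_rpow ((one_le_div hr).2 hκ) hδ0
    have e6 : κ ^ (-s) * κ ^ M * κ ^ (-s') = κ ^ m * κ ^ l * κ ^ δ := by
      rw [← Real.rpow_natCast κ M, ← Real.rpow_natCast κ m, ← Real.rpow_add hκ0,
        ← Real.rpow_add hκ0, ← Real.rpow_add hκ0, ← Real.rpow_add hκ0]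
      congr 1; rw [hδ]; ring
    rw [e2, e6]
    calc κ ^ m * (Real.exp (lam * κ⁻¹ ^ 2) * X) ≤
          κ ^ m * (Real.exp (lam * r⁻¹ ^ 2) * (C₁ * κ ^ l * (1 + t) ^ (-l / 2))) * 1 := by
          rw [mul_one]; gcongr
      _ ≤ κ ^ m * (Real.exp (lam * r⁻¹ ^ 2) * (C₁ * κ ^ l * (1 + t) ^ (-l / 2))) *
          (r ^ (-δ) * κ ^ δ) := by gcongr
      _ = _ := by rw [hC₀]; ring
  calc _ ≤ ∫⁻ k in S, ENNReal.ofReal (C₀ * (1 + t) ^ (-l / 2)) * (‖H' k‖ₑ * ‖G' k‖ₑ) := by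
        refine setLIntegral_mono' hmeas fun k hk => ?_
        refine (mul_le_mul_left (ENNReal.ofReal_le_ofReal (hpt (freq k) hk)) _).trans (le_of_eq ?_)
        simp only [hH', hG', Set.indicator_of_mem hk, enorm_mul,
          Real.enorm_eq_ofReal (Real.rpow_nonneg (freq_nonneg k) _),
          Real.enorm_eq_ofReal (pow_nonneg (freq_nonneg k) _)]
        have := freq_nonneg k
        have hs1 := Real.rpow_nonneg this (-s)
        rw [ENNReal.ofReal_mul (by positivity), ENNReal.ofReal_mul (mul_nonneg hs1 (by positivity)),
          ENNReal.ofReal_mul hs1]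
        ring
    _ ≤ ∫⁻ k, ENNReal.ofReal (C₀ * (1 + t) ^ (-l / 2)) * (‖H' k‖ₑ * ‖G' k‖ₑ) :=
      setLIntegral_le_lintegral _ _
    _ = ENNReal.ofReal (C₀ * (1 + t) ^ (-l / 2)) * ∫⁻ k, ‖H' k‖ₑ * ‖G' k‖ₑ :=
      lintegral_const_mul' _ _ ENNReal.ofReal_ne_top
    _ ≤ ENNReal.ofReal (C₀ * (1 + t) ^ (-l / 2)) * ((C₂ * A) * (C₃ * B)) := by
      gcongr
      refine (lintegral_mul_le_eLpNorm_two (((hfm _).mul hH.1).indicator hmeas)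
        (((hfm _).mul hG.1).indicator hmeas)).trans ?_
      gcongr
      · exact hw _ _ hH
      · exact hw' _ _ hG
    _ = _ := by
      rw [ENNReal.ofReal_mul hC₀0.le, regLossRate]
      ring

/-! ### The solution formula on the Fourier side -/

/-- Here `y n` plays the role of the n-th derivative of `y 0`. The remainder of order N + 1 for `y
n` has as its derivative the remainder of order N for `y (n + 1)`, so the induction is over N for
all n at once. -/
lemma norm_sub_taylor_le {y : ℕ → ℝ → ℂ} {t M C : ℝ}
    (hy : ∀ n s, 0 ≤ s → HasDerivWithinAt (y n) (y (n + 1) s) (Set.Ici s) s)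
    (hc : ∀ n, ContinuousOn (y n) (Set.Icc 0 t)) (hb : ∀ n, ∀ s ∈ Set.Icc 0 t, ‖y n s‖ ≤ M * C ^ n)
    (N : ℕ) : ∀ n, ∀ s ∈ Set.Icc 0 t,
      ‖y n s - ∑ i ∈ Finset.range N, ((s ^ i / i.factorial : ℝ) : ℂ) * y (n + i) 0‖ ≤
        M * C ^ (n + N) / N.factorial * s ^ N := by
  induction N with
  | zero => intro n s hs; simpa using hb n s hs
  | succ N ih =>
    intro n
    have hsum : ∀ s, HasDerivAt (fun s : ℝ => ∑ i ∈ Finset.range (N + 1),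
        ((s ^ i / i.factorial : ℝ) : ℂ) * y (n + i) 0)
        (∑ i ∈ Finset.range N, ((s ^ i / i.factorial : ℝ) : ℂ) * y (n + 1 + i) 0) s := by
      intro s
      have h1 : ∀ i ∈ Finset.range (N + 1), HasDerivAt (fun s : ℝ =>
          ((s ^ i / i.factorial : ℝ) : ℂ) * y (n + i) 0)
          (((i * s ^ (i - 1) / i.factorial : ℝ) : ℂ) * y (n + i) 0) s := fun i _ =>
        (((hasDerivAt_pow i s).div_const _).ofReal_comp).mul_const _
      refine (HasDerivAt.fun_sum h1).congr_deriv ?_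
      rw [Finset.sum_range_succ']
      simp only [Nat.cast_zero, zero_mul, zero_div, Complex.ofReal_zero, add_zero]
      refine Finset.sum_congr rfl fun i _ => ?_
      rw [show n + (i + 1) = n + 1 + i by ring, Nat.add_sub_cancel, Nat.factorial_succ]
      congr 2
      push_cast
      field_simp
    refine image_norm_le_of_norm_deriv_right_le_deriv_boundary
      (f' := fun s => y (n + 1) s - ∑ i ∈ Finset.range N,
        ((s ^ i / i.factorial : ℝ) : ℂ) * y (n + 1 + i) 0)
      (B' := fun s => M * C ^ (n + 1 + N) / N.factorial * s ^ N) ?_ ?_ ?_ ?_ ?_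
    · exact (hc n).sub fun s _ => (hsum s).continuousAt.continuousWithinAt
    · exact fun s hs => (hy n s hs.1).sub (hsum s).hasDerivWithinAt
    · rw [Finset.sum_range_succ']; simp
    · intro s
      refine ((hasDerivAt_pow (N + 1) s).const_mul _).congr_deriv ?_
      rw [show n + (N + 1) = n + 1 + N by ring, Nat.factorial_succ, Nat.add_sub_cancel]
      push_cast
      field_simp
    · exact fun s hs => ih (n + 1) s ⟨hs.1, hs.2.le⟩

/-- Geometric growth of the derivatives makes the Taylor remainder vanish. One-sided derivatives
suffice, as they must for solutions defined only for t ≥ 0. -/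
lemma hasSum_taylor {y : ℕ → ℝ → ℂ} {t M C : ℝ} (ht : 0 ≤ t)
    (hy : ∀ n s, 0 ≤ s → HasDerivWithinAt (y n) (y (n + 1) s) (Set.Ici s) s)
    (hc : ∀ n, ContinuousOn (y n) (Set.Icc 0 t))
    (hb : ∀ n, ∀ s ∈ Set.Icc 0 t, ‖y n s‖ ≤ M * C ^ n) :
    HasSum (fun n => ((t ^ n / n.factorial : ℝ) : ℂ) * y n 0) (y 0 t) := by
  have h1 := fun N => norm_sub_taylor_le hy hc hb N 0 t ⟨ht, le_rfl⟩
  simp only [zero_add] at h1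
  have hs : Summable fun n => ((t ^ n / n.factorial : ℝ) : ℂ) * y n 0 := by
    refine Summable.of_norm_bounded (g := fun n => M * ((C * t) ^ n / n.factorial))
      ((Real.summable_pow_div_factorial _).mul_left M) fun n => ?_
    rw [norm_mul, Complex.norm_real, Real.norm_of_nonneg (by positivity), mul_pow]
    calc t ^ n / n.factorial * ‖y n 0‖ ≤ t ^ n / n.factorial * (M * C ^ n) := by
          gcongr; exact hb n 0 ⟨le_rfl, ht⟩
      _ = _ := by ring
  have h2 : Filter.Tendsto (fun N => ∑ i ∈ Finset.range N,
      ((t ^ i / i.factorial : ℝ) : ℂ) * y i 0) Filter.atTop (nhds (y 0 t)) := by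
    rw [tendsto_iff_norm_sub_tendsto_zero]
    refine squeeze_zero (fun _ => norm_nonneg _) (fun N => (norm_sub_rev _ _).trans_le (h1 N)) ?_
    have := (FloorSemiring.tendsto_pow_div_factorial_atTop (C * t)).const_mul M
    rw [mul_zero] at this
    refine this.congr fun N => ?_
    rw [mul_pow]; ring
  exact (tendsto_nhds_unique h2 hs.hasSum.tendsto_sum_nat) ▸ hs.hasSum

/-! ### The symbol as a matrix polynomial in the frequency. -/

/-- The frequency vector `2 π k`. -/
noncomputable def xi (k : Space) : Fin 3 → ℝ := fun j => 2 * Real.pi * k j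

/-- The symbol of the system at the frequency `2 π k`. -/
noncomputable def symbol (P : Params) (k : Space) :
    (Component → ℂ) →L[ℂ] (Component → ℂ) :=
  LinearMap.toContinuousLinearMap
    { toFun := evolOp P fun j x => (Complex.I * xi k j) * x
      map_add' := fun v w => by
        funext a
        rcases a with α | ⟨α, j⟩ | j | j
        · simp only [evolOp, Pi.add_apply, mul_add, Finset.sum_add_distrib]; ring
        · simp only [evolOp, Pi.add_apply, smul_eq_mul]; ring
        · simp only [evolOp, Pi.add_apply, smul_eq_mul, mul_add, Finset.sum_add_distrib]
          fin_cases j <;> · simp [curlOp]; ring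
        · simp only [evolOp, Pi.add_apply, smul_eq_mul]
          fin_cases j <;> · simp [curlOp]; ring
      map_smul' := fun c v => by
        funext a
        rcases a with α | ⟨α, j⟩ | j | j
        · simp only [evolOp, Pi.smul_apply, smul_eq_mul, RingHom.id_apply, mul_left_comm _ c,
            ← Finset.mul_sum]; ring
        · simp only [evolOp, Pi.smul_apply, smul_eq_mul, RingHom.id_apply]; ring
        · simp only [evolOp, Pi.smul_apply, smul_eq_mul, RingHom.id_apply, mul_left_comm _ c,
            ← Finset.mul_sum]
          fin_cases j <;> · simp [curlOp]; ring
        · simp only [evolOp, Pi.smul_apply, smul_eq_mul, RingHom.id_apply]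
          fin_cases j <;> · simp [curlOp]; ring }

lemma symbol_apply (P : Params) (k : Space) (v : Component → ℂ) :
    symbol P k v = evolOp P (fun j x => (Complex.I * xi k j) * x) v := rfl

lemma contDiff_symbol_apply (P : Params) {w : Space → Component → ℂ}
    (hw : ContDiff ℝ (⊤ : ℕ∞) w) : ContDiff ℝ (⊤ : ℕ∞) fun k => symbol P k (w k) := by
  have hw' := contDiff_pi.1 hw
  have hx : ∀ j, ContDiff ℝ (⊤ : ℕ∞) fun k : Space => Complex.I * (xi k j : ℂ) := fun j =>
    contDiff_const.mul (Complex.ofRealCLM.contDiff.comp (contDiff_const.mul (by fun_prop)))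
  refine contDiff_pi.2 fun a => ?_
  simp only [symbol_apply]
  rcases a with α | ⟨α, j⟩ | j | j
  · exact (ContDiff.sum fun j _ => (hx j).mul (hw' _)).neg
  · exact (((((hx j).mul (hw' _)).const_smul _).neg.add ((hw' _).const_smul _)).sub
      ((hw' _).const_smul _)).const_smul _
  · refine ContDiff.sub (ContDiff.const_smul _ ?_) (ContDiff.const_smul _
      (ContDiff.sum fun _ _ => (hw' _).const_smul _))
    fin_cases j <;> exact ((hx _).mul (hw' _)).sub ((hx _).mul (hw' _))
  · refine ContDiff.neg (ContDiff.const_smul _ ?_)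
    fin_cases j <;> exact ((hx _).mul (hw' _)).sub ((hx _).mul (hw' _))

lemma contDiff_symbol_pow_apply (P : Params) (w : Component → ℂ) (n : ℕ) :
    ContDiff ℝ (⊤ : ℕ∞) fun k => (symbol P k ^ n) w := by
  induction n with
  | zero => simpa using contDiff_const
  | succ n ih =>
    simp only [pow_succ']
    exact contDiff_symbol_apply P ih

lemma continuous_symbol (P : Params) : Continuous (symbol P) :=
  continuous_clm_apply.2 fun _ => (contDiff_symbol_apply P contDiff_const).continuous

lemma HasFourier.neg {T : Dist} {h : Space → ℂ} (hT : HasFourier T h) :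
    HasFourier (-T) (fun k => -h k) := by
  rw [← neg_one_smul ℂ T]
  simpa only [neg_one_mul] using hT.smul (-1)

lemma HasFourier.sub {S T : Dist} {g h : Space → ℂ} (hS : HasFourier S g) (hT : HasFourier T h) :
    HasFourier (S - T) (fun k => g k - h k) := by
  simpa [sub_eq_add_neg] using hS.add hT.neg

lemma HasFourier.curlOp {F : Fin 3 → Dist} {h : Fin 3 → Space → ℂ}
    (H : ∀ j, HasFourier (F j) (h j)) (j : Fin 3) :
    HasFourier (curlOp (fun j => lineDerivOp (basisVec j)) F j)
      (fun k => curlOp (fun j x => (Complex.I * xi k j) * x) (fun i => h i k) j) := by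
  fin_cases j
  · exact ((H 2).lineDeriv 1).sub ((H 1).lineDeriv 2)
  · exact ((H 0).lineDeriv 2).sub ((H 2).lineDeriv 0)
  · exact ((H 1).lineDeriv 0).sub ((H 0).lineDeriv 1)

lemma HasFourier.evolOp (P : Params) {V : Component → Dist} {v : Component → Space → ℂ}
    (H : ∀ a, HasFourier (V a) (v a)) (a : Component) :
    HasFourier (evolOp P (fun j => lineDerivOp (basisVec j)) V a)
      (fun k => symbol P k (fun b => v b k) a) := by
  rcases a with α | ⟨α, j⟩ | j | j
  · exact (HasFourier.sum Finset.univ fun j => (H (Sum.inr (Sum.inl (α, j)))).lineDeriv j).neg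
  · exact (((((H (Sum.inl α)).lineDeriv j).smul (P.temp α)).neg.add
      ((H (Sum.inr (Sum.inr (Sum.inl j)))).smul (P.charge α))).sub
      ((H (Sum.inr (Sum.inl (α, j)))).smul (P.mass α * P.nu α))).smul ((P.mass α)⁻¹)
  · exact ((HasFourier.curlOp (fun i => H (Sum.inr (Sum.inr (Sum.inr i)))) j).smul P.c).sub
      ((HasFourier.sum Finset.univ fun α =>
        (H (Sum.inr (Sum.inl (α, j)))).smul (P.charge α)).smul (4 * Real.pi))
  · exact ((HasFourier.curlOp (fun i => H (Sum.inr (Sum.inr (Sum.inl i)))) j).smul P.c).neg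

lemma IsLinearSolution.hasTimeDeriv_comp {P : Params} {U₀ : State} {U : ℝ → State}
    (h : IsLinearSolution P U₀ U) {t : ℝ} (ht : 0 < t) (a : Component) :
    HasTimeDeriv (fun s => (U s).comp a)
      (EulerMaxwell.evolOp P (fun j => lineDerivOp (basisVec j)) (U t).comp a) t := by
  rcases a with α | ⟨α, j⟩ | j | j
  · exact h.mass_eq t ht α
  · intro φ
    have hm : (P.mass α : ℂ) ≠ 0 := by exact_mod_cast (P.mass_pos α).ne'
    refine ((h.momentum_eq t ht α j φ).const_mul ((P.mass α)⁻¹ : ℂ)).congr_of_eventuallyEq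
      (.of_forall fun s => ?_)
    change (U s).u α j φ = (P.mass α : ℂ)⁻¹ * ((P.mass α : ℂ) * (U s).u α j φ)
    rw [inv_mul_cancel_left₀ hm]
  · exact h.ampere_eq t ht j
  · exact h.faraday_eq t ht j

/-- Pairing with a square integrable function as a continuous functional on `L^2`. -/
lemma exists_pairing {φ : Space → ℂ} (hφ : MemLp φ 2 volume) :
    ∃ L : Lp ℂ 2 (volume : Measure Space) →L[ℂ] ℂ, ∀ V, L V = ∫ k, φ k * V k := by
  have hc : MemLp (fun k => starRingEnd ℂ (φ k)) 2 volume :=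
    hφ.of_le (Complex.continuous_conj.comp_aestronglyMeasurable hφ.1) (.of_forall fun k => by simp)
  refine ⟨innerSL ℂ hc.toLp, fun V => ?_⟩
  rw [innerSL_apply_apply, L2.inner_def]
  refine integral_congr_ae ?_
  filter_upwards [hc.coeFn_toLp] with k hk
  rw [hk, RCLike.inner_apply, starRingEnd_self_apply, mul_comm]

/-- The Fourier transform of a family of square integrable functions. -/
noncomputable def hat (V : Component → Lp ℂ 2 (volume : Measure Space)) (k : Space) :
    Component → ℂ :=
  fun a => (𝓕 (V a) : Lp ℂ 2 (volume : Measure Space)) k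

lemma locallyIntegrable_hat (V : Component → Lp ℂ 2 (volume : Measure Space)) (a : Component) :
    LocallyIntegrable (fun k => hat V k a) volume :=
  (Lp.memLp (𝓕 (V a) : Lp ℂ 2 (volume : Measure Space))).locallyIntegrable (by norm_num)

lemma apply_eq_sum (A : (Component → ℂ) →L[ℂ] (Component → ℂ)) (v : Component → ℂ)
    (a : Component) : A v a = ∑ b, A (Pi.single b 1) a * v b := by
  conv_lhs => rw [← Finset.univ_sum_single v, map_sum, Finset.sum_apply]
  refine Finset.sum_congr rfl fun b _ => ?_
  rw [show Pi.single b (v b) = v b • (Pi.single b 1 : Component → ℂ) by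
    rw [← Pi.single_smul, smul_eq_mul, mul_one], map_smul, Pi.smul_apply, smul_eq_mul, mul_comm]

lemma locallyIntegrable_apply {A : Space → (Component → ℂ) →L[ℂ] (Component → ℂ)}
    (hA : Continuous A) (V : Component → Lp ℂ 2 (volume : Measure Space)) (a : Component) :
    LocallyIntegrable (fun k => A k (hat V k) a) volume := by
  have e : (fun k => A k (hat V k) a) = ∑ b, fun k => A k (Pi.single b 1) a * hat V k b := by
    ext k; rw [apply_eq_sum]; simp
  rw [e]
  refine Finset.sum_induction _ (fun f => LocallyIntegrable f volume) (fun _ _ h h' => h.add h')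
    locallyIntegrable_zero fun b _ => ?_
  exact LocallyIntegrable.continuous_mul (locallyIntegrable_hat V b)
    ((continuous_apply a).comp (hA.clm_apply continuous_const))

lemma smul_pow_clm {W : Type*} [NormedAddCommGroup W] [NormedSpace ℂ W] (c : ℂ) (S : W →L[ℂ] W)
    (n : ℕ) : (c • S) ^ n = c ^ n • S ^ n := by
  induction n with
  | zero => simp
  | succ n ih =>
    ext v
    simp only [pow_succ, ih]
    change c ^ n • (S ^ n) (c • S v) = (c ^ n * c) • (S ^ n) (S v)
    rw [map_smul, smul_smul]

/-! ### Moments of the transformed solution and the exponential formula. -/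

section SolutionFormula

variable {P : Params} {U₀ : State} {U : ℝ → State}
  {V : Component → ℝ → Lp ℂ 2 (volume : Measure Space)}

/-- On the support of `ψ` the powers of the symbol are bounded, so the moments are finite sums of
continuous functionals on L² and inherit continuity in time from the solution. -/
lemma integral_mul_symbol_pow (P : Params) (ψ : 𝓢(Space, ℂ)) (hψ : HasCompactSupport ψ) (n : ℕ)
    (a : Component) : ∃ L : Component → (Lp ℂ 2 (volume : Measure Space) →L[ℂ] ℂ), ∀ W,
      ∫ k, ψ k * (symbol P k ^ n) (hat W k) a = ∑ b, L b (𝓕 (W b)) := by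
  have hm : ∀ b, MemLp (fun k => ψ k * (symbol P k ^ n) (Pi.single b 1) a) 2 volume := fun b =>
    (ψ.continuous.mul ((continuous_apply a).comp
      (contDiff_symbol_pow_apply P _ n).continuous)).memLp_of_hasCompactSupport hψ.mul_right
  choose L hL using fun b => exists_pairing (hm b)
  refine ⟨L, fun W => ?_⟩
  simp only [hL]
  rw [← integral_finsetSum]
  · refine integral_congr_ae (.of_forall fun k => ?_)
    simp only [apply_eq_sum _ (hat W k), Finset.mul_sum, mul_assoc]
    rfl
  · exact fun b _ => (hm b).integrable_mul (Lp.memLp _)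

lemma continuousOn_moment (hV : ∀ a, ContinuousOn (V a) (Set.Ici 0)) (ψ : 𝓢(Space, ℂ))
    (hψ : HasCompactSupport ψ) (n : ℕ) (a : Component) :
    ContinuousOn (fun s => ∫ k, ψ k * (symbol P k ^ n) (hat (fun b => V b s) k) a)
      (Set.Ici 0) := by
  obtain ⟨L, hL⟩ := integral_mul_symbol_pow P ψ hψ n a
  simp only [hL]
  exact continuousOn_finsetSum _ fun b _ => (L b).continuous.comp_continuousOn
    ((Lp.fourierTransformₗᵢ Space ℂ).continuous.comp_continuousOn (hV b))

/-- Entries of `symbol P k ^ n` are smooth in k, so their products with `ψ` are again compactly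
supported Schwartz functions and may be inserted in the weak form of the equations. Each time
derivative then produces one more power of the symbol. -/
lemma hasDerivAt_moment (h : IsLinearSolution P U₀ U)
    (hV : ∀ a t, 0 ≤ t → (U t).comp a = Lp.toTemperedDistribution (V a t)) (ψ : 𝓢(Space, ℂ))
    (hψ : HasCompactSupport ψ) (n : ℕ) (a : Component) {t : ℝ} (ht : 0 < t) :
    HasDerivAt (fun s => ∫ k, ψ k * (symbol P k ^ n) (hat (fun b => V b s) k) a)
      (∫ k, ψ k * (symbol P k ^ (n + 1)) (hat (fun b => V b t) k) a) t := by
  have hex : ∀ b, ∃ χ : 𝓢(Space, ℂ), HasCompactSupport χ ∧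
      ∀ k, χ k = ψ k * (symbol P k ^ n) (Pi.single b 1) a := fun b =>
    exists_schwartzMap_of_contDiff hψ.mul_right
      ((ψ.smooth ⊤).mul (contDiff_pi.1 (contDiff_symbol_pow_apply P _ n) a))
  choose χ hχc hχ using hex
  have hF : ∀ s, 0 ≤ s → ∀ b, HasFourier ((U s).comp b) (fun k => hat (fun b => V b s) k b) :=
    fun s hs b => by rw [hV b s hs]; exact hasFourier_toTemperedDistribution _
  have e1 : ∀ s, 0 ≤ s → ∫ k, ψ k * (symbol P k ^ n) (hat (fun b => V b s) k) a =
      ∑ b, (U s).comp b (𝓕 (χ b)) := by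
    intro s hs
    simp only [fun b => (hF s hs b).2 _ (hχc b)]
    rw [← integral_finsetSum]
    · refine integral_congr_ae (.of_forall fun k => ?_)
      simp only [apply_eq_sum _ (hat _ k), Finset.mul_sum, hχ, mul_assoc]
    · exact fun b _ => LocallyIntegrable.integrable_schwartz_mul (hF s hs b).1 _ (hχc b)
  have e2 : ∫ k, ψ k * (symbol P k ^ (n + 1)) (hat (fun b => V b t) k) a =
      ∑ b, (EulerMaxwell.evolOp P (fun j => lineDerivOp (basisVec j)) (U t).comp b)
        (𝓕 (χ b)) := by
    have hG := fun b => HasFourier.evolOp P (hF t ht.le) b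
    simp only [fun b => (hG b).2 _ (hχc b)]
    rw [← integral_finsetSum]
    · refine integral_congr_ae (.of_forall fun k => ?_)
      simp only [pow_succ]
      change ψ k * (symbol P k ^ n) (symbol P k (hat (fun b => V b t) k)) a = _
      rw [apply_eq_sum (symbol P k ^ n), Finset.mul_sum]
      simp only [hχ, mul_assoc]
    · exact fun b _ => LocallyIntegrable.integrable_schwartz_mul (hG b).1 _ (hχc b)
  rw [e2]
  refine (HasDerivAt.fun_sum fun b _ => h.hasTimeDeriv_comp ht b (𝓕 (χ b))).congr_of_eventuallyEq ?_
  filter_upwards [lt_mem_nhds ht] with s hs using e1 s hs.le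

/-- The equations are assumed only for t > 0. At t = 0 the right derivative is recovered as the
limit of derivatives, using continuity of the next moment. -/
lemma hasDerivWithinAt_moment (h : IsLinearSolution P U₀ U)
    (hc : ∀ a, ContinuousOn (V a) (Set.Ici 0))
    (hV : ∀ a t, 0 ≤ t → (U t).comp a = Lp.toTemperedDistribution (V a t)) (ψ : 𝓢(Space, ℂ))
    (hψ : HasCompactSupport ψ) (n : ℕ) (a : Component) {t : ℝ} (ht : 0 ≤ t) :
    HasDerivWithinAt (fun s => ∫ k, ψ k * (symbol P k ^ n) (hat (fun b => V b s) k) a)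
      (∫ k, ψ k * (symbol P k ^ (n + 1)) (hat (fun b => V b t) k) a) (Set.Ici t) t := by
  rcases ht.eq_or_lt with rfl | ht
  · have hd := fun s (hs : s ∈ Set.Ioi (0 : ℝ)) => hasDerivAt_moment h hV ψ hψ n a hs
    refine hasDerivWithinAt_Ici_of_tendsto_deriv (s := Set.Ioi 0)
      (fun s hs => (hd s hs).differentiableAt.differentiableWithinAt)
      ((continuousOn_moment hc ψ hψ n a 0 Set.self_mem_Ici).mono Set.Ioi_subset_Ici_self)
      self_mem_nhdsWithin ?_
    refine (((continuousOn_moment hc ψ hψ (n + 1) a 0 Set.self_mem_Ici).mono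
      Set.Ioi_subset_Ici_self).tendsto).congr' ?_
    filter_upwards [self_mem_nhdsWithin] with s hs using (hd s hs).deriv.symm
  · exact (hasDerivAt_moment h hV ψ hψ n a ht).hasDerivWithinAt

lemma exists_bound_symbol_pow (P : Params) (ψ : 𝓢(Space, ℂ)) (hψ : HasCompactSupport ψ) :
    ∃ C, 0 ≤ C ∧ ∀ (n : ℕ) (k : Space) (v : Component → ℂ) (a : Component),
      ‖ψ k * (symbol P k ^ n) v a‖ ≤ C ^ n * ∑ b, ‖ψ k * v b‖ := by
  obtain ⟨C, hC⟩ := hψ.isCompact.exists_bound_of_continuousOn (continuous_symbol P).continuousOn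
  refine ⟨max C 0, le_max_right _ _, fun n k v a => ?_⟩
  by_cases hk : k ∈ tsupport ψ
  · have h1 : ‖(symbol P k ^ n) v a‖ ≤ max C 0 ^ n * ‖v‖ :=
      (norm_le_pi_norm _ a).trans (((symbol P k ^ n).le_opNorm v).trans (by
        gcongr
        exact (norm_pow_le _ n).trans (pow_le_pow_left₀ (norm_nonneg _)
          ((hC k hk).trans (le_max_left _ _)) n)))
    have h2 : ‖v‖ ≤ ∑ b, ‖v b‖ := (pi_norm_le_iff_of_nonneg
      (Finset.sum_nonneg fun _ _ => norm_nonneg _)).2 fun b =>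
        Finset.single_le_sum (f := fun b => ‖v b‖) (fun _ _ => norm_nonneg _) (Finset.mem_univ b)
    simp only [norm_mul, ← Finset.mul_sum]
    calc ‖ψ k‖ * ‖(symbol P k ^ n) v a‖ ≤ ‖ψ k‖ * (max C 0 ^ n * ∑ b, ‖v b‖) := by
          gcongr; exact h1.trans (by gcongr)
      _ = _ := by ring
  · rw [image_eq_zero_of_notMem_tsupport hk]; simp

lemma exists_bound_moment (hc : ∀ a, ContinuousOn (V a) (Set.Ici 0)) (ψ : 𝓢(Space, ℂ)) (t : ℝ) :
    ∃ M, ∀ s ∈ Set.Icc 0 t, ∑ b, ∫ k, ‖ψ k * hat (fun b => V b s) k b‖ ≤ M := by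
  have hb : ∀ b, ∃ M, ∀ s ∈ Set.Icc 0 t, ‖V b s‖ ≤ M := fun b =>
    isCompact_Icc.exists_bound_of_continuousOn ((hc b).mono Set.Icc_subset_Ici_self)
  choose M hM using hb
  refine ⟨∑ b, ‖ψ.toLp 2 volume‖ * M b, fun s hs => Finset.sum_le_sum fun b _ => ?_⟩
  have h1 : ∫⁻ k, ‖ψ k * hat (fun b => V b s) k b‖ₑ ≤
      ENNReal.ofReal (‖ψ.toLp 2 volume‖ * M b) := by
    have := eLpNorm_smul_le_mul_eLpNorm (p := 2) (q := 2) (r := 1)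
      (Lp.memLp (𝓕 (V b s) : Lp ℂ 2 (volume : Measure Space))).1
      (ψ.continuous.aestronglyMeasurable (μ := volume))
    rw [eLpNorm_one_eq_lintegral_enorm] at this
    refine le_trans this ?_
    rw [ENNReal.ofReal_mul (norm_nonneg _), SchwartzMap.norm_toLp,
      ENNReal.ofReal_toReal (ψ.memLp 2 volume).2.ne]
    gcongr
    rw [← ENNReal.ofReal_toReal (Lp.memLp _).2.ne, ← Lp.norm_def, Lp.norm_fourier_eq]
    exact ENNReal.ofReal_le_ofReal (hM b s hs)
  have hm : AEStronglyMeasurable (fun k => ψ k * hat (fun b => V b s) k b) volume :=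
    ψ.continuous.aestronglyMeasurable.mul (Lp.memLp _).1
  rw [integral_norm_eq_lintegral_enorm hm]
  exact ENNReal.toReal_le_of_le_ofReal
    (mul_nonneg (norm_nonneg _) ((norm_nonneg _).trans (hM b s hs))) h1

/-- The Fourier transform of the solution is obtained from the data by the exponential of the
symbol. -/
theorem hat_eq_exp (h : IsLinearSolution P U₀ U) (hc : ∀ a, ContinuousOn (V a) (Set.Ici 0))
    (hV : ∀ a t, 0 ≤ t → (U t).comp a = Lp.toTemperedDistribution (V a t)) {t : ℝ} (ht : 0 ≤ t) :
    ∀ᵐ k, hat (fun b => V b t) k = NormedSpace.exp ((t : ℂ) • symbol P k) (hat (fun b => V b 0) k) := by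
  have hexp : Continuous (NormedSpace.exp : ((Component → ℂ) →L[ℂ] (Component → ℂ)) → _) := by
    let _ : NormedAlgebra ℚ ((Component → ℂ) →L[ℂ] (Component → ℂ)) :=
      NormedAlgebra.restrictScalars ℚ ℂ _
    exact NormedSpace.exp_continuous
  have key : ∀ a, ∀ᵐ k, hat (fun b => V b t) k a =
      NormedSpace.exp ((t : ℂ) • symbol P k) (hat (fun b => V b 0) k) a := by
    intro a
    refine ae_eq_of_forall_integral_eq (locallyIntegrable_hat _ a) (locallyIntegrable_apply
      (A := fun k => NormedSpace.exp ((t : ℂ) • symbol P k))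
      (hexp.comp ((continuous_symbol P).const_smul (t : ℂ))) _ a) fun ψ hψ => ?_
    obtain ⟨C, hC, hCb⟩ := exists_bound_symbol_pow P ψ hψ
    obtain ⟨M, hM⟩ := exists_bound_moment hc ψ t
    have hint : ∀ s b, Integrable (fun k => ψ k * hat (fun b => V b s) k b) := fun s b =>
      LocallyIntegrable.integrable_schwartz_mul (locallyIntegrable_hat _ b) ψ hψ
    have hint' : ∀ n s, Integrable
        (fun k => ψ k * (symbol P k ^ n) (hat (fun b => V b s) k) a) := fun n s =>
      LocallyIntegrable.integrable_schwartz_mul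
        (locallyIntegrable_apply ((continuous_symbol P).pow n) _ a) ψ hψ
    have hnorm : ∀ n, ∀ s ∈ Set.Icc 0 t,
        ∫ k, ‖ψ k * (symbol P k ^ n) (hat (fun b => V b s) k) a‖ ≤ M * C ^ n := by
      intro n s hs
      calc _ ≤ ∫ k, C ^ n * ∑ b, ‖ψ k * hat (fun b => V b s) k b‖ :=
            integral_mono (hint' n s).norm
              ((integrable_finsetSum _ fun b _ => (hint s b).norm).const_mul _)
              fun k => hCb n k _ a
        _ = C ^ n * ∑ b, ∫ k, ‖ψ k * hat (fun b => V b s) k b‖ := by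
            rw [integral_const_mul, integral_finsetSum _ fun b _ => (hint s b).norm]
        _ ≤ C ^ n * M := by gcongr; exact hM s hs
        _ = _ := mul_comm _ _
    -- No ODE is available at fixed k, since the solution is weak in space. Instead the moment is
    -- expanded in its Taylor series at 0, and summation is exchanged with integration to recognise
    -- the moment of the exponential series applied to the data.
    have h1 := hasSum_taylor ht
      (y := fun n s => ∫ k, ψ k * (symbol P k ^ n) (hat (fun b => V b s) k) a)
      (fun n s hs => hasDerivWithinAt_moment h hc hV ψ hψ n a hs)
      (fun n => (continuousOn_moment hc ψ hψ n a).mono Set.Icc_subset_Ici_self)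
      (fun n s hs => (norm_integral_le_integral_norm _).trans (hnorm n s hs))
    have h2 := hasSum_integral_of_summable_integral_norm
      (F := fun n k => ((t ^ n / n.factorial : ℝ) : ℂ) *
        (ψ k * (symbol P k ^ n) (hat (fun b => V b 0) k) a))
      (fun n => (hint' n 0).const_mul _) (by
        refine Summable.of_nonneg_of_le (fun n => integral_nonneg fun k => norm_nonneg _)
          (fun n => ?_) ((Real.summable_pow_div_factorial (C * t)).mul_left M)
        simp only [norm_mul ((t ^ n / n.factorial : ℝ) : ℂ), integral_const_mul]
        rw [Complex.norm_real, Real.norm_of_nonneg (by positivity), mul_pow]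
        calc _ ≤ t ^ n / n.factorial * (M * C ^ n) := by
              gcongr; exact hnorm n 0 ⟨le_rfl, ht⟩
          _ = _ := by ring)
    simp only [integral_const_mul] at h2
    have h3 := h1.unique h2
    simp only [pow_zero, one_apply_eq_self] at h3
    rw [h3]
    refine integral_congr_ae (.of_forall fun k => ?_)
    have h4 := NormedSpace.exp_series_hasSum_exp' (𝕂 := ℂ) ((t : ℂ) • symbol P k)
    have h5 := ((ContinuousLinearMap.proj (R := ℂ) (φ := fun _ : Component => ℂ) a).comp
      (ContinuousLinearMap.apply ℂ (Component → ℂ) (hat (fun b => V b 0) k))).hasSum h4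
    have h6 := (h5.mul_left (ψ k)).tsum_eq
    refine Eq.trans (tsum_congr fun n => ?_) h6
    have e : (n.factorial : ℂ)⁻¹ • ((t : ℂ) • symbol P k) ^ n =
        ((t ^ n / n.factorial : ℝ) : ℂ) • symbol P k ^ n := by
      rw [smul_pow_clm, smul_smul, inv_mul_eq_div]
      push_cast; rfl
    rw [e]
    change _ = ψ k * (((t ^ n / n.factorial : ℝ) : ℂ) * (symbol P k ^ n) (hat (fun b => V b 0) k) a)
    rw [mul_left_comm]
  filter_upwards [ae_all_iff.2 key] with k hk
  exact funext hk

end SolutionFormula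

/-! ### Lebesgue norms of families of distributions -/

/-- The vector-valued function with components `g a`. -/
noncomputable def vec {ι : Type} [Fintype ι] (g : ι → Space → ℂ) (x : Space) : EuclideanSpace ℂ ι :=
  WithLp.toLp 2 (fun a => g a x)

lemma norm_le_norm_vec {ι : Type} [Fintype ι] (g : ι → Space → ℂ) (a : ι) (x : Space) :
    ‖g a x‖ ≤ ‖vec g x‖ :=
  PiLp.norm_apply_le (vec g x) a

lemma norm_vec_le_sum {ι : Type} [Fintype ι] (g : ι → Space → ℂ) (x : Space) :
    ‖vec g x‖ ≤ ∑ a, ‖g a x‖ := by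
  classical
  have : vec g x = ∑ a, EuclideanSpace.single a (g a x) := by
    ext b
    simp [vec]
  rw [this]
  refine (norm_sum_le _ _).trans (le_of_eq (Finset.sum_congr rfl fun a _ => ?_))
  simp

lemma IsRepresentedBy.ae_eq {ι : Type} {p : ℝ≥0∞} (hp : 1 ≤ p) {F : ι → Dist}
    {g g' : ι → Space → ℂ} (h : IsRepresentedBy F p g) (h' : IsRepresentedBy F p g') (a : ι) :
    g a =ᵐ[volume] g' a :=
  ae_eq_of_forall_integral_eq ((h a).1.locallyIntegrable hp) ((h' a).1.locallyIntegrable hp)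
    fun ψ _ => by rw [← (h a).2, ← (h' a).2]

/-- Representatives are unique almost everywhere, so any one of them realises the infimum defining
the norm. -/
lemma exists_isRepresentedBy {ι : Type} [Fintype ι] {p : ℝ≥0∞} (hp : 1 ≤ p) {F : ι → Dist}
    (hF : lpNorm p F ≠ ⊤) : ∃ g, IsRepresentedBy F p g ∧ eLpNorm (vec g) p volume ≤ lpNorm p F := by
  obtain ⟨g, hg⟩ : ∃ g, IsRepresentedBy F p g := by
    by_contra! hc
    exact hF (by simp [lpNorm, hc])
  refine ⟨g, hg, le_iInf₂ fun g' hg' => le_of_eq (eLpNorm_congr_ae ?_)⟩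
  filter_upwards [ae_all_iff.2 fun a => hg.ae_eq hp hg' a] with x hx
  simp only [vec, hx]

/-- Members of a family with finite `L^p` norm, `1 ≤ p ≤ 2`, have Fourier transforms that are
functions with Gaussian-weighted bounds. -/
lemma exists_hasFourier_of_lpNorm_ne_top {ι : Type} [Fintype ι] {p : ℝ≥0∞} (hp1 : 1 ≤ p)
    (hp2 : p ≤ 2) {F : ι → Dist} (hF : lpNorm p F ≠ ⊤) (a : ι) :
    ∃ h, HasFourier (F a) h ∧ GaussBound p (fun k => ‖h k‖) (lpNorm p F) := by
  obtain ⟨g, hg, hle⟩ := exists_isRepresentedBy hp1 hF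
  obtain ⟨h, hh, hb⟩ := exists_hasFourier hp1 hp2 (hg a).1 (hg a).2
  refine ⟨h, hh, GaussBound.of_norm hh.1.aestronglyMeasurable fun s hs => (hb s hs).trans ?_⟩
  gcongr
  exact (eLpNorm_mono (norm_le_norm_vec g a)).trans hle

lemma lpNorm_le_sum {ι : Type} [Fintype ι] {q : ℝ≥0∞} (hq : 1 ≤ q) {F : ι → Dist}
    {W : ι → Lp ℂ 2 (volume : Measure Space)} {X : ℝ≥0∞} (hX : X ≠ ⊤)
    (hF : ∀ a, F a = Lp.toTemperedDistribution (W a)) (hW : ∀ a, eLpNorm (W a) q volume ≤ X) :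
    lpNorm q F ≤ Fintype.card ι * X := by
  have hrep : IsRepresentedBy F q fun a => W a := fun a =>
    ⟨⟨(Lp.memLp (W a)).1, (hW a).trans_lt hX.lt_top⟩, fun φ => by
      rw [hF a, Lp.toTemperedDistribution_apply]; rfl⟩
  refine (iInf₂_le _ hrep).trans ?_
  have h1 : eLpNorm (vec fun a => W a) q volume ≤
      eLpNorm (∑ a, fun x => ‖(W a : Space → ℂ) x‖) q volume := by
    refine eLpNorm_mono fun x => (norm_vec_le_sum _ x).trans (le_of_eq ?_)
    rw [Finset.sum_apply, Real.norm_of_nonneg (Finset.sum_nonneg fun _ _ => norm_nonneg _)]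
  refine h1.trans ((eLpNorm_sum_le (fun a _ => (Lp.memLp (W a)).1.norm) hq).trans ?_)
  simp only [eLpNorm_norm]
  exact (Finset.sum_le_sum fun a _ => hW a).trans (by simp)

/-! ### Bounds for derivatives of a component -/

lemma norm_xi_prod_le {m : ℕ} (β : Fin m → Fin 3) (k : Space) :
    ‖∏ j, (Complex.I * (2 * Real.pi * k (β j) : ℝ))‖ ≤ freq k ^ m := by
  rw [norm_prod]
  refine (Finset.prod_le_prod (fun _ _ => norm_nonneg _) (g := fun _ => freq k)
    fun j _ => ?_).trans (by simp)
  rw [norm_mul, Complex.norm_I, one_mul, Complex.norm_real, norm_mul,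
    Real.norm_of_nonneg (by positivity : (0 : ℝ) ≤ 2 * Real.pi), freq]
  gcongr
  exact PiLp.norm_apply_le k (β j)

/-- Expanding (∑ⱼ |ξⱼ|)^M over words of length M gives exactly the symbols of the derivatives of
order M. -/
lemma freq_pow_le_sum (M : ℕ) (k : Space) :
    freq k ^ M ≤ ∑ β : Fin M → Fin 3, ‖∏ j, (Complex.I * (2 * Real.pi * k (β j) : ℝ))‖ := by
  have h1 : freq k ≤ ∑ j, |2 * Real.pi * k j| := by
    have h : ‖k‖ ≤ ∑ j, ‖k j‖ := by
      have e : k = ∑ a, EuclideanSpace.single a (k a) := by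
        ext b; simp
      conv_lhs => rw [e]
      exact (norm_sum_le _ _).trans (le_of_eq (Finset.sum_congr rfl fun a _ => by simp))
    simp only [abs_mul, ← Finset.mul_sum]
    rw [freq, abs_of_pos Real.pi_pos, abs_two]
    gcongr
    exact h
  refine (pow_le_pow_left₀ (freq_nonneg k) h1 M).trans (le_of_eq ?_)
  rw [Fintype.sum_pow]
  refine Finset.sum_congr rfl fun β _ => ?_
  rw [norm_prod]
  refine Finset.prod_congr rfl fun j _ => ?_
  rw [norm_mul, Complex.norm_I, one_mul, Complex.norm_real, Real.norm_eq_abs]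

/-- The test function is treated like the data: as a distribution its transform is 𝓕φ, and the
inverse transform is the reflection of 𝓕φ, which a Gaussian weight does not notice. -/
lemma gaussBound_fourierInv {p : ℝ≥0∞} (hp1 : 1 ≤ p) (hp2 : p ≤ 2) (φ : 𝓢(Space, ℂ)) :
    GaussBound p (fun k => ‖(𝓕⁻ φ : 𝓢(Space, ℂ)) k‖) (eLpNorm φ p volume) := by
  set T : Dist := Lp.toTemperedDistribution (φ.toLp 2 volume) with hT
  have hTφ : ∀ ψ : 𝓢(Space, ℂ), T ψ = ∫ x, ψ x * φ x := fun ψ => by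
    rw [hT, Lp.toTemperedDistribution_apply]
    exact integral_congr_ae ((φ.coeFn_toLp 2 volume).mono fun x hx => by
      simp only [hx, smul_eq_mul])
  obtain ⟨h, hh, hb⟩ := exists_hasFourier hp1 hp2 (φ.memLp p volume) hTφ
  have e : h =ᵐ[volume] (𝓕 φ : 𝓢(Space, ℂ)) := by
    have h1 := hh.ae_eq (hasFourier_toTemperedDistribution (φ.toLp 2 volume))
    rw [SchwartzMap.toLp_fourier_eq] at h1
    exact h1.trans ((𝓕 φ : 𝓢(Space, ℂ)).coeFn_toLp 2 volume)
  refine ⟨(𝓕⁻ φ : 𝓢(Space, ℂ)).continuous.norm.aestronglyMeasurable, fun a ha => ?_⟩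
  refine le_trans (le_of_eq ?_) (hb a ha)
  have h2 : eLpNorm (fun k : Space => (Real.exp (-(a * ‖k‖ ^ 2)) : ℂ) * h k) 2 volume =
      eLpNorm (fun k : Space => (Real.exp (-(a * ‖k‖ ^ 2)) : ℂ) * (𝓕 φ : 𝓢(Space, ℂ)) k) 2 volume :=
    eLpNorm_congr_ae (e.mono fun k hk => by simp only [hk])
  rw [h2]
  rw [← eLpNorm_comp_measurePreserving (μ := volume) (ν := volume) (f := Neg.neg)
    (by fun_prop : Continuous fun k : Space => (Real.exp (-(a * ‖k‖ ^ 2)) : ℂ) *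
      (𝓕 φ : 𝓢(Space, ℂ)) k).aestronglyMeasurable (Measure.measurePreserving_neg volume)]
  refine eLpNorm_congr_norm_ae (.of_forall fun k => ?_)
  rw [Function.comp_apply, norm_neg, norm_mul, norm_mul, norm_norm, Complex.norm_real,
    SchwartzMap.fourierInv_coe, SchwartzMap.fourier_coe, Real.fourierInv_eq_fourier_neg]

lemma ofReal_le_ofReal_mul_enorm {a b c : ℝ} (hb : 0 ≤ b) (h : a ≤ b * c) :
    ENNReal.ofReal a ≤ ENNReal.ofReal b * ‖c‖ₑ := by
  rw [← ofReal_norm, ← ENNReal.ofReal_mul hb]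
  exact ENNReal.ofReal_le_ofReal (h.trans (by gcongr; exact Real.le_norm_self c))

/-- The derivative must be known to be an L² function before its L^q norm can be tested by duality.
Low frequencies are bounded by r^m|W|, high ones by the weighted bound on the data. -/
lemma memLp_iteratedDeriv_of_bounds {p : ℝ≥0∞} {s : ℝ} (hs : IsHighExponent p s) {m M : ℕ}
    (hM : m + s ≤ M) {r K : ℝ} (hr : 0 < r) (hK : 0 ≤ K) {H : Space → ℝ} {N : ℝ≥0∞} (hN : N ≠ ⊤)
    (hH : GaussBound p (fun k => freq k ^ M * H k) N) (W : Lp ℂ 2 (volume : Measure Space))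
    (hW : ∀ᵐ k, r ≤ freq k → ‖W k‖ ≤ K * H k) (β : Fin m → Fin 3) :
    MemLp (fun k => (∏ j, (Complex.I * (2 * Real.pi * k (β j) : ℝ))) * W k) 2 volume := by
  obtain ⟨C, hC, hw⟩ := exists_high_weight_bound hs hr
  set S := {k : Space | r ≤ freq k} with hS
  have hmeas : MeasurableSet S := measurableSet_le measurable_const continuous_freq.measurable
  set H' : Space → ℝ := S.indicator fun k => freq k ^ (-s) * (freq k ^ M * H k) with hH'
  have hH'm : MemLp H' 2 volume :=
    ⟨(((continuous_freq.measurable.pow_const (-s)).aestronglyMeasurable).mul hH.1).indicator hmeas,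
      (hw _ _ hH).trans_lt (ENNReal.mul_lt_top hC.lt_top hN.lt_top)⟩
  set δ := (M : ℝ) - (m + s) with hδ
  have hδ0 : 0 ≤ δ := by linarith
  have hsum : MemLp (fun k => r ^ m * ‖W k‖ + K * r ^ (-δ) * ‖H' k‖) 2 volume :=
    ((Lp.memLp W).norm.const_mul _).add (hH'm.norm.const_mul _)
  refine hsum.of_le ?_ ?_
  · exact (by fun_prop : Continuous fun k : Space =>
      ∏ j, (Complex.I * ((2 * Real.pi * k (β j) : ℝ) : ℂ))).aestronglyMeasurable.mul (Lp.memLp W).1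
  · filter_upwards [hW] with k hk
    have h0 := freq_nonneg k
    have hpos : 0 ≤ r ^ m * ‖W k‖ + K * r ^ (-δ) * ‖H' k‖ := by positivity
    rw [norm_mul, Real.norm_of_nonneg hpos]
    refine (mul_le_mul_of_nonneg_right (norm_xi_prod_le β k) (norm_nonneg _)).trans ?_
    rcases le_total r (freq k) with h | h
    · have hκ : 0 < freq k := hr.trans_le h
      have h1 := hk h
      rw [show H' k = freq k ^ (-s) * (freq k ^ M * H k) from
        Set.indicator_of_mem (show k ∈ S from h) _]
      have h5 : 1 ≤ r ^ (-δ) * freq k ^ δ := by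
        rw [Real.rpow_neg hr.le, ← div_eq_inv_mul, ← Real.div_rpow hκ.le hr.le]
        exact Real.one_le_rpow ((one_le_div hr).2 h) hδ0
      have e6 : freq k ^ (-s) * freq k ^ M = freq k ^ m * freq k ^ δ := by
        rw [← Real.rpow_natCast _ M, ← Real.rpow_natCast _ m, ← Real.rpow_add hκ,
          ← Real.rpow_add hκ]
        congr 1; rw [hδ]; ring
      have hH0 : 0 ≤ K * H k := (norm_nonneg _).trans h1
      calc freq k ^ m * ‖W k‖ ≤ freq k ^ m * (K * H k) * 1 := by rw [mul_one]; gcongr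
        _ ≤ freq k ^ m * (K * H k) * (r ^ (-δ) * freq k ^ δ) := by gcongr
        _ = K * r ^ (-δ) * (freq k ^ m * freq k ^ δ * H k) := by ring
        _ = K * r ^ (-δ) * (freq k ^ (-s) * (freq k ^ M * H k)) := by rw [← e6]; ring
        _ ≤ K * r ^ (-δ) * ‖freq k ^ (-s) * (freq k ^ M * H k)‖ := by
          gcongr; exact Real.le_norm_self _
        _ ≤ _ := le_add_of_nonneg_left (by positivity)
    · calc freq k ^ m * ‖W k‖ ≤ r ^ m * ‖W k‖ := by gcongr
        _ ≤ _ := le_add_of_nonneg_right (by positivity)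

/-- A component with low- and high-frequency decay satisfies the asserted `L^q` bound. -/
lemma exists_component_bound {p r q q' : ℝ≥0∞} [hqq : ENNReal.HolderConjugate q' q] (hq : 2 ≤ q)
    {s s' : ℝ} (hs : IsHighExponent r s) (hs' : IsHighExponent q' s') {l : ℝ} (hl : 0 ≤ l)
    {m M : ℕ} (hM : m + l + s + s' ≤ M) (j : ℕ) {lam lam' ρ K K' : ℝ} (hlam : 0 < lam)
    (hlam' : 0 < lam') (hρ : 0 < ρ) (hK : 0 ≤ K) (hK' : 0 ≤ K') :
    ∃ C : ℝ≥0∞, C ≠ ⊤ ∧ ∀ (W : Lp ℂ 2 (volume : Measure Space)) (H H₁ : Space → ℝ)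
      (N N₁ A : ℝ≥0∞) (t : ℝ), 0 ≤ t → GaussBound p H N → GaussBound p H₁ N₁ →
      GaussBound r (fun k => freq k ^ M * H k) A → A ≠ ⊤ → (∀ k, 0 ≤ H k) →
      (∀ᵐ k, freq k ≤ ρ → ‖(𝓕 W : Lp ℂ 2 (volume : Measure Space)) k‖ ≤
        K * (freq k ^ j * Real.exp (-lam * freq k ^ 2 * t) * H₁ k + Real.exp (-lam * t) * H k)) →
      (∀ᵐ k, ρ ≤ freq k → ‖(𝓕 W : Lp ℂ 2 (volume : Measure Space)) k‖ ≤
        K' * Real.exp (-(lam' * (freq k)⁻¹ ^ 2) * t) * H k) →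
      ∀ β : Fin m → Fin 3, ∃ W' : Lp ℂ 2 (volume : Measure Space),
        ∂^{fun i => basisVec (β i)} (Lp.toTemperedDistribution W) = Lp.toTemperedDistribution W' ∧
        eLpNorm W' q volume ≤ C * (polyRate p q (m + j) t * N₁ + expRate lam t * N +
          regLossRate l t * A) := by
  have hq' : q' ≤ 2 := by
    have h1 := ENNReal.HolderConjugate.one_sub_inv q q'
    rw [← inv_inv q', ← h1, ENNReal.inv_le_iff_inv_le]
    calc (2 : ℝ≥0∞)⁻¹ = 1 - 2⁻¹ := ENNReal.one_sub_inv_two.symm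
      _ ≤ 1 - q⁻¹ := by gcongr
  have hq1 : 1 ≤ q' := ENNReal.HolderConjugate.one_le q' q
  have hqq' : (q'⁻¹).toReal + (q⁻¹).toReal = 1 := by
    have h0 := ENNReal.HolderConjugate.inv_add_inv_eq_one q' q
    have h := congrArg ENNReal.toReal h0
    have hst : q'⁻¹ + q⁻¹ ≠ ⊤ := by rw [h0]; simp
    rwa [ENNReal.toReal_add (ENNReal.add_ne_top.1 hst).1 (ENNReal.add_ne_top.1 hst).2,
      ENNReal.toReal_one] at h
  obtain ⟨C₁, hC₁, b₁⟩ := exists_low_frequency_bound p q' q hqq' (m + j) (r := ρ) hlam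
  obtain ⟨C₂, hC₂, b₂⟩ := exists_low_frequency_bound p q' q hqq' m (r := ρ) hlam
  obtain ⟨C₃, hC₃, b₃⟩ := exists_high_frequency_bound hs hs' hl hM hlam' hρ
  set k₁ := ENNReal.ofReal K with hk₁
  set k₂ := ENNReal.ofReal K' with hk₂
  refine ⟨k₁ * C₁ + k₁ * C₂ + k₂ * C₃, by finiteness,
    fun W H H₁ N N₁ A t ht hH hH₁ hA hAt hH0 hlow hhigh β => ?_⟩
  -- Only the derivative weight matters here, so the decaying exponential is bounded by 1 and the
  -- exponents `l` and `s'` are discarded.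
  have h2 := memLp_iteratedDeriv_of_bounds hs (m := m) (M := M) (by linarith [hs'.1]) hρ hK' hAt hA
    (𝓕 W) (hhigh.mono fun k hk h => (hk h).trans (by
      refine mul_le_mul_of_nonneg_right (mul_le_of_le_one_right hK' ?_) (hH0 k)
      exact Real.exp_le_one_iff.2 (mul_nonpos_of_nonpos_of_nonneg
        (neg_nonpos.2 (by positivity)) ht))) β
  refine ⟨𝓕⁻ h2.toLp, iteratedLineDeriv_toTemperedDistribution W β h2, ?_⟩
  refine eLpNorm_le_of_forall_schwartz (p := q') (Lp.memLp _) hq fun φ hφ => ?_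
  set G : Space → ℝ := fun k => ‖(𝓕⁻ φ : 𝓢(Space, ℂ)) k‖ with hG
  have hGb : GaussBound q' G (eLpNorm φ q' volume) := gaussBound_fourierInv hq1 hq' φ
  set D := eLpNorm φ q' volume with hD
  have e1 : ∫ x, φ x * (𝓕⁻ h2.toLp : Lp ℂ 2 (volume : Measure Space)) x =
      ∫ k, (𝓕⁻ φ : 𝓢(Space, ℂ)) k * (h2.toLp : Lp ℂ 2 (volume : Measure Space)) k := by
    have e' := toTemperedDistribution_apply_fourier (𝓕⁻ h2.toLp) (𝓕⁻ φ)
    rw [FourierTransform.fourier_fourierInv_eq, FourierTransform.fourier_fourierInv_eq,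
      Lp.toTemperedDistribution_apply] at e'
    exact e'
  rw [e1]
  set w : Space → ℝ≥0∞ := fun k =>
    ENNReal.ofReal (freq k ^ m) * ‖(𝓕 W : Lp ℂ 2 (volume : Measure Space)) k‖ₑ * ‖G k‖ₑ with hw
  have e2 : ‖∫ k, (𝓕⁻ φ : 𝓢(Space, ℂ)) k * (h2.toLp : Lp ℂ 2 (volume : Measure Space)) k‖ₑ ≤ ∫⁻ k, w k := by
    refine (enorm_integral_le_lintegral_enorm _).trans (lintegral_mono_ae ?_)
    filter_upwards [h2.coeFn_toLp] with k hk
    rw [hk, enorm_mul, enorm_mul, mul_comm, hw, hG]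
    simp only [enorm_norm]
    gcongr
    rw [← ofReal_norm]
    exact ENNReal.ofReal_le_ofReal (norm_xi_prod_le β k)
  have hmL : MeasurableSet {k : Space | freq k ≤ ρ} :=
    measurableSet_le continuous_freq.measurable measurable_const
  have hmH : MeasurableSet {k : Space | ρ ≤ freq k} :=
    measurableSet_le measurable_const continuous_freq.measurable
  have e3 : ∫⁻ k, w k ≤ (∫⁻ k in {k | freq k ≤ ρ}, w k) + ∫⁻ k in {k | ρ ≤ freq k}, w k := by
    rw [← setLIntegral_univ, show (Set.univ : Set Space) = {k | freq k ≤ ρ} ∪ {k | ρ ≤ freq k} by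
      ext k; simpa using le_total (freq k) ρ]
    exact lintegral_union_le _ _ _
  have hlowI : ∫⁻ k in {k | freq k ≤ ρ}, w k ≤
      k₁ * (C₁ * polyRate p q (m + j) t * (N₁ * D)) + k₁ * (C₂ * expRate lam t * (N * D)) := by
    have h3 := b₁ H₁ G N₁ D hH₁ hGb t ht
    -- The part that already carries exp(-λt) is estimated at time 0, where the heat factor is 1 and
    -- the polynomial rate equals 1; low frequency is used only to bound the integral.
    have h4 := b₂ H G N D hH hGb 0 le_rfl
    have htop : k₁ * expRate lam t ≠ ⊤ :=
      ENNReal.mul_ne_top ENNReal.ofReal_ne_top ENNReal.ofReal_ne_top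
    have e4 : polyRate p q m 0 = 1 := by simp [polyRate]
    rw [e4, mul_one] at h4
    calc _ ≤ ∫⁻ k in {k | freq k ≤ ρ}, (k₁ * (ENNReal.ofReal (freq k ^ (m + j) *
          Real.exp (-lam * freq k ^ 2 * t)) * (‖H₁ k‖ₑ * ‖G k‖ₑ)) + k₁ * expRate lam t *
          (ENNReal.ofReal (freq k ^ m * Real.exp (-lam * freq k ^ 2 * 0)) *
            (‖H k‖ₑ * ‖G k‖ₑ))) := by
          refine lintegral_mono_ae ?_
          filter_upwards [ae_restrict_mem hmL, ae_restrict_of_ae hlow] with k hk hk'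
          have h5 := hk' hk
          have h0 := freq_nonneg k
          have h6 : ‖(𝓕 W : Lp ℂ 2 (volume : Measure Space)) k‖ₑ ≤
              k₁ * (ENNReal.ofReal (freq k ^ j * Real.exp (-lam * freq k ^ 2 * t)) * ‖H₁ k‖ₑ +
                expRate lam t * ‖H k‖ₑ) := by
            rw [← ofReal_norm]
            refine (ENNReal.ofReal_le_ofReal h5).trans ?_
            rw [ENNReal.ofReal_mul hK]
            refine mul_le_mul_right (ENNReal.ofReal_add_le.trans (add_le_add ?_ ?_)) _
            · exact ofReal_le_ofReal_mul_enorm (by positivity) le_rfl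
            · exact ofReal_le_ofReal_mul_enorm (by positivity) le_rfl
          calc w k ≤ ENNReal.ofReal (freq k ^ m) * (k₁ * (ENNReal.ofReal (freq k ^ j *
                Real.exp (-lam * freq k ^ 2 * t)) * ‖H₁ k‖ₑ + expRate lam t * ‖H k‖ₑ)) *
                ‖G k‖ₑ := by simp only [hw]; gcongr
            _ = _ := by
              rw [mul_zero, Real.exp_zero, mul_one, pow_add, mul_assoc (freq k ^ m),
                ENNReal.ofReal_mul (pow_nonneg h0 m)]
              ring
      _ ≤ (∫⁻ k in {k | freq k ≤ ρ}, (k₁ * (ENNReal.ofReal (freq k ^ (m + j) *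
          Real.exp (-lam * freq k ^ 2 * t)) * (‖H₁ k‖ₑ * ‖G k‖ₑ)))) +
          ∫⁻ k in {k | freq k ≤ ρ}, k₁ * expRate lam t *
          (ENNReal.ofReal (freq k ^ m * Real.exp (-lam * freq k ^ 2 * 0)) *
            (‖H k‖ₑ * ‖G k‖ₑ)) := by
          refine le_of_eq (lintegral_add_left' ?_ _)
          have hf : Measurable fun k : Space => ENNReal.ofReal (freq k ^ (m + j) *
              Real.exp (-lam * freq k ^ 2 * t)) := by
            have := continuous_freq
            exact (by fun_prop : Continuous fun k : Space => freq k ^ (m + j) *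
              Real.exp (-lam * freq k ^ 2 * t)).measurable.ennreal_ofReal
          exact ((hf.aemeasurable.mul (hH₁.1.enorm.mul hGb.1.enorm)).const_mul _).restrict
      _ ≤ _ := by
          rw [lintegral_const_mul' _ _ (by finiteness), lintegral_const_mul' _ _ htop]
          refine add_le_add (by gcongr) ?_
          calc k₁ * expRate lam t * _ ≤ k₁ * expRate lam t * (C₂ * (N * D)) := by gcongr
            _ = _ := by ring
  have hhighI : ∫⁻ k in {k | ρ ≤ freq k}, w k ≤ k₂ * (C₃ * regLossRate l t * (A * D)) := by
    have h3 := b₃ H G A D hA hGb t ht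
    calc _ ≤ ∫⁻ k in {k | ρ ≤ freq k}, k₂ * (ENNReal.ofReal (freq k ^ m *
        Real.exp (-(lam' * (freq k)⁻¹ ^ 2) * t)) * (‖H k‖ₑ * ‖G k‖ₑ)) := by
          refine lintegral_mono_ae ?_
          filter_upwards [ae_restrict_mem hmH, ae_restrict_of_ae hhigh] with k hk hk'
          have h0 := freq_nonneg k
          have h6 : ‖(𝓕 W : Lp ℂ 2 (volume : Measure Space)) k‖ₑ ≤
              ENNReal.ofReal (K' * Real.exp (-(lam' * (freq k)⁻¹ ^ 2) * t)) * ‖H k‖ₑ := by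
            rw [← ofReal_norm]
            exact ofReal_le_ofReal_mul_enorm (by positivity) (hk' hk)
          calc w k ≤ ENNReal.ofReal (freq k ^ m) * (ENNReal.ofReal (K' *
                Real.exp (-(lam' * (freq k)⁻¹ ^ 2) * t)) * ‖H k‖ₑ) * ‖G k‖ₑ := by simp only [hw]; gcongr
            _ = _ := by
              rw [ENNReal.ofReal_mul hK', ENNReal.ofReal_mul (pow_nonneg h0 m)]
              ring
      _ ≤ _ := by
          rw [lintegral_const_mul' _ _ ENNReal.ofReal_ne_top]
          gcongr
  refine e2.trans (e3.trans ((add_le_add hlowI hhighI).trans ?_))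
  calc _ = (k₁ * C₁ * (polyRate p q (m + j) t * N₁) + k₁ * C₂ * (expRate lam t * N) +
        k₂ * C₃ * (regLossRate l t * A)) * D := by ring
    _ ≤ ((k₁ * C₁ + k₁ * C₂ + k₂ * C₃) * (polyRate p q (m + j) t * N₁) +
        (k₁ * C₁ + k₁ * C₂ + k₂ * C₃) * (expRate lam t * N) +
        (k₁ * C₁ + k₁ * C₂ + k₂ * C₃) * (regLossRate l t * A)) * D := by
      gcongr
      · exact le_add_right le_self_add
      · exact le_add_right le_add_self
      · exact le_add_self
    _ = _ := by ring

/-! ### Bounds for solutions -/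

lemma exp_zero_smul_apply {W : Type*} [NormedAddCommGroup W] [NormedSpace ℂ W] (S : W →L[ℂ] W)
    (v : W) : NormedSpace.exp (((0 : ℝ) : ℂ) • S) v = v := by
  simp [NormedSpace.exp_zero]

lemma hasDerivAt_exp_smul_apply {W : Type*} [NormedAddCommGroup W] [NormedSpace ℂ W]
    [CompleteSpace W] (S : W →L[ℂ] W) (v : W) (t : ℝ) :
    HasDerivAt (fun s : ℝ => NormedSpace.exp ((s : ℂ) • S) v)
      (S (NormedSpace.exp ((t : ℂ) • S) v)) t := by
  have h1 : HasDerivAt (fun s : ℝ => NormedSpace.exp ((s : ℂ) • S))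
      (S * NormedSpace.exp ((t : ℂ) • S)) t :=
    HasDerivAt.scomp_of_eq (g₁ := fun u : ℂ => NormedSpace.exp (u • S)) t
      (hasDerivAt_exp_smul_const' (𝕂 := ℂ) S (t : ℂ)) Complex.ofRealCLM.hasDerivAt rfl
      |>.congr_deriv (by simp)
  exact (((ContinuousLinearMap.apply ℂ W v).restrictScalars ℝ).hasFDerivAt.comp_hasDerivAt t h1)

lemma isMode_exp (P : Params) (k : Space) (v₀ : Component → ℂ)
    (hg : ∑ j, (Complex.I * (xi k j : ℂ)) * v₀ (Sum.inr (Sum.inr (Sum.inl j))) =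
      (4 * Real.pi : ℂ) * ∑ α, (P.charge α : ℂ) * v₀ (Sum.inl α))
    (hm : ∀ j, v₀ (Sum.inr (Sum.inr (Sum.inr j))) = 0) :
    IsMode P (xi k) fun s => NormedSpace.exp ((s : ℂ) • symbol P k) v₀ := by
  have h0 := exp_zero_smul_apply (symbol P k) v₀
  exact ⟨fun t => hasDerivAt_pi.1 (hasDerivAt_exp_smul_apply (symbol P k) v₀ t),
    by simpa only [h0] using hg, fun j => by simpa only [h0] using hm j⟩

/-- Since (1/r - 1/2) + (1/q' - 1/2) = 1/r - 1/q, the two weights need slightly more than 3(1/r -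
1/q) in total. The integer part plus one exceeds ℓ + 3(1/r - 1/q) strictly, and half of the excess
goes to each weight. For integer ℓ and r = q = 2 both weights can be zero. -/
lemma exists_high_exponents {r q q' : ℝ≥0∞} [hqq : ENNReal.HolderConjugate q' q] (hr1 : 1 ≤ r)
    (hr : r ≤ 2) (hq : 2 ≤ q) {l : ℝ} (hl : 0 ≤ l) :
    ∃ s s', IsHighExponent r s ∧ IsHighExponent q' s' ∧
      ∀ m : ℕ, m + l + s + s' ≤ ((m + regIndex l r q : ℕ) : ℝ) := by
  have hqq' : (q'⁻¹).toReal + (q⁻¹).toReal = 1 := by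
    have h0 := ENNReal.HolderConjugate.inv_add_inv_eq_one q' q
    have h := congrArg ENNReal.toReal h0
    have hst : q'⁻¹ + q⁻¹ ≠ ⊤ := by rw [h0]; simp
    rwa [ENNReal.toReal_add (ENNReal.add_ne_top.1 hst).1 (ENNReal.add_ne_top.1 hst).2,
      ENNReal.toReal_one] at h
  by_cases hc : (∃ n : ℕ, l = n) ∧ r = 2 ∧ q = 2
  · obtain ⟨⟨n, rfl⟩, rfl, rfl⟩ := hc
    have hq'2 : q' = 2 := ENNReal.HolderConjugate.unique 2 q' 2
    refine ⟨0, 0, ⟨le_rfl, Or.inr rfl⟩, ⟨le_rfl, Or.inr hq'2⟩, fun m => ?_⟩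
    simp [regIndex]
  · set x := l + 3 * ((r⁻¹).toReal - (q⁻¹).toReal) with hx
    have hreg : regIndex l r q = ⌊x⌋₊ + 1 := by
      unfold regIndex; rw [if_neg hc]
    have hlt : x < (regIndex l r q : ℝ) := by
      rw [hreg]; push_cast; exact Nat.lt_floor_add_one x
    set ε := ((regIndex l r q : ℝ) - x) / 2 with hε
    have hε0 : 0 < ε := by linarith
    have hq2 : (q⁻¹).toReal ≤ 1 / 2 := by
      simpa using ENNReal.toReal_mono (by simp) (ENNReal.inv_le_inv.2 hq)
    have hr0 : r ≠ 0 := (one_pos.trans_le hr1).ne'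
    have hr2 : 1 / 2 ≤ (r⁻¹).toReal := by
      simpa using ENNReal.toReal_mono (by simpa using hr0) (ENNReal.inv_le_inv.2 hr)
    refine ⟨3 * ((r⁻¹).toReal - 1 / 2) + ε, 3 * ((q'⁻¹).toReal - 1 / 2) + ε,
      ⟨by linarith, Or.inl (by linarith)⟩, ⟨by linarith, Or.inl (by linarith)⟩, fun m => ?_⟩
    push_cast
    linarith

/-- The power of the frequency gained at low frequencies by a component. -/
def decayOrder : Component → ℕ
  | Sum.inl _ => 1
  | Sum.inr (Sum.inl _) => 2
  | Sum.inr (Sum.inr (Sum.inl _)) => 2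
  | Sum.inr (Sum.inr (Sum.inr _)) => 1

lemma isDirection_xi {k : Space} (hk : k ≠ 0) :
    IsDirection (xi k) (fun j => k j / ‖k‖) (freq k) := by
  have h0 : 0 < ‖k‖ := norm_pos_iff.2 hk
  refine ⟨by unfold freq; positivity, fun j => ?_, ?_⟩
  · simp only [xi, freq]; field_simp
  · have h := EuclideanSpace.norm_sq_eq k
    simp only [Fin.sum_univ_three, Real.norm_eq_abs, sq_abs] at h
    simp only [div_pow, ← add_div, ← h]
    exact div_self (by positivity)

/-! ### The special data on the Fourier side. -/

section Modes

variable {P : Params} {f g₂ : Species → Fin 3 → Dist} {g₃ : Fin 3 → Dist}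
  {V₀ : Component → Lp ℂ 2 (volume : Measure Space)}

lemma hasFourier_hat {N₀ : State} (hV : ∀ a, N₀.comp a = Lp.toTemperedDistribution (V₀ a))
    (a : Component) : HasFourier (N₀.comp a) (fun k => hat V₀ k a) := by
  rw [hV a]; exact hasFourier_toTemperedDistribution _

/-- The compatibility condition and B = 0 hold as distributions; uniqueness of the transform makes
them pointwise identities for almost every k. -/
lemma ae_isMode (hV : ∀ a, (specialData f g₂ g₃).comp a = Lp.toTemperedDistribution (V₀ a))
    (hc : Compatible P (specialData f g₂ g₃)) :
    ∀ᵐ k, IsMode P (xi k) fun s => NormedSpace.exp ((s : ℂ) • symbol P k) (hat V₀ k) := by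
  have hF := hasFourier_hat hV
  have h1 := (HasFourier.div fun j => hF (Sum.inr (Sum.inr (Sum.inl j))))
  have h2 := (HasFourier.sum Finset.univ fun α => (hF (Sum.inl α)).smul (P.charge α)).smul
    (4 * Real.pi : ℂ)
  have h3 := h1.ae_eq (h := _) (h' := _) (hc.1 ▸ h2)
  have h4 : ∀ j, ∀ᵐ k, hat V₀ k (Sum.inr (Sum.inr (Sum.inr j))) = 0 := fun j =>
    (hF (Sum.inr (Sum.inr (Sum.inr j)))).ae_eq hasFourier_zero
  filter_upwards [h3, ae_all_iff.2 h4] with k hk hk'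
  exact isMode_exp P k _ hk hk'

lemma gaussBound_hat {p : ℝ≥0∞} (hp1 : 1 ≤ p) (hp2 : p ≤ 2) {N₀ : State}
    (hV : ∀ a, N₀.comp a = Lp.toTemperedDistribution (V₀ a)) (hN : lpNorm p N₀.comp ≠ ⊤) :
    GaussBound p (fun k => ∑ a, ‖hat V₀ k a‖) (∑ _ : Component, lpNorm p N₀.comp) := by
  refine GaussBound.sum fun a => ?_
  obtain ⟨h, hh, hb⟩ := exists_hasFourier_of_lpNorm_ne_top hp1 hp2 hN a
  have e := hh.ae_eq (hasFourier_hat hV a)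
  exact hb.mono (locallyIntegrable_hat V₀ a).aestronglyMeasurable.norm
    (e.mono fun k hk => by rw [hk]) le_rfl

lemma gaussBound_freq_pow_mul_hat {p : ℝ≥0∞} (hp1 : 1 ≤ p) (hp2 : p ≤ 2) {N₀ : State}
    (hV : ∀ a, N₀.comp a = Lp.toTemperedDistribution (V₀ a)) {M : ℕ}
    (hN : lpNorm p (nablaPow M N₀.comp) ≠ ⊤) :
    GaussBound p (fun k => freq k ^ M * ∑ a, ‖hat V₀ k a‖)
      (∑ _ : Component × (Fin M → Fin 3), lpNorm p (nablaPow M N₀.comp)) := by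
  choose h hh hb using exists_hasFourier_of_lpNorm_ne_top hp1 hp2 hN
  have e := fun x : Component × (Fin M → Fin 3) =>
    (hh x).ae_eq ((hasFourier_hat hV x.1).iteratedLineDeriv x.2)
  refine (GaussBound.sum hb).mono ?_ ?_ le_rfl
  · exact (continuous_freq.pow M).aestronglyMeasurable.mul
      (Finset.aestronglyMeasurable_fun_sum _ fun a _ =>
        (locallyIntegrable_hat V₀ a).aestronglyMeasurable.norm)
  · filter_upwards [ae_all_iff.2 e] with k hk
    have h0 := freq_nonneg k
    rw [abs_of_nonneg (by positivity), abs_of_nonneg (by positivity)]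
    simp only [hk, norm_mul]
    rw [Fintype.sum_prod_type, Finset.mul_sum]
    refine Finset.sum_le_sum fun a _ => ?_
    change freq k ^ M * ‖hat V₀ k a‖ ≤ ∑ β : Fin M → Fin 3,
      ‖∏ j, (Complex.I * ((2 * Real.pi * k (β j) : ℝ) : ℂ))‖ * ‖hat V₀ k a‖
    rw [← Finset.sum_mul]
    exact mul_le_mul_of_nonneg_right (freq_pow_le_sum M k) (norm_nonneg _)

/-- Because ρ = ∇·f, the transform of ρ is iξ·f̂. This is the factor κ required at low frequency,
and the reason the L^p norm of f appears. -/
lemma exists_flux_bound {p : ℝ≥0∞} (hp1 : 1 ≤ p) (hp2 : p ≤ 2)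
    (hV : ∀ a, (specialData f g₂ g₃).comp a = Lp.toTemperedDistribution (V₀ a))
    (hf : lpNorm p (Function.uncurry f) ≠ ⊤) :
    ∃ Φ : Space → ℝ, GaussBound p Φ (∑ _ : Species × Fin 3, lpNorm p (Function.uncurry f)) ∧
      ∀ᵐ k, ∀ α, ‖hat V₀ k (Sum.inl α)‖ ≤ freq k * Φ k := by
  choose h hh hb using exists_hasFourier_of_lpNorm_ne_top hp1 hp2 hf
  refine ⟨fun k => ∑ x, ‖h x k‖, GaussBound.sum hb, ae_all_iff.2 fun α => ?_⟩
  have h1 : HasFourier ((specialData f g₂ g₃).comp (Sum.inl α)) _ :=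
    HasFourier.div fun j => hh (α, j)
  filter_upwards [(hasFourier_hat hV (Sum.inl α)).ae_eq h1] with k hk
  rw [hk, Fintype.sum_prod_type]
  have h2 : ∑ j, ‖h (α, j) k‖ ≤ ∑ β, ∑ j, ‖h (β, j) k‖ :=
    Finset.single_le_sum (f := fun β => ∑ j, ‖h (β, j) k‖)
      (fun _ _ => Finset.sum_nonneg fun _ _ => norm_nonneg _) (Finset.mem_univ α)
  refine le_trans ?_ (mul_le_mul_of_nonneg_left h2 (freq_nonneg k))
  rw [Finset.mul_sum]
  refine (norm_sum_le _ _).trans (Finset.sum_le_sum fun j _ => ?_)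
  rw [norm_mul]
  refine mul_le_mul_of_nonneg_right ?_ (norm_nonneg _)
  simpa using norm_xi_prod_le (fun _ : Fin 1 => j) k

end Modes

/-- Pointwise bounds of the Fourier transform of the solution. -/
lemma exists_hat_bound (P : Params) : ∃ ρ lam lam' K K' : ℝ, 0 < ρ ∧ 0 < lam ∧ 0 < lam' ∧ 0 < K ∧
    0 < K' ∧ ∀ (f g₂ : Species → Fin 3 → Dist) (g₃ : Fin 3 → Dist) (U : ℝ → State)
      (V : Component → ℝ → Lp ℂ 2 (volume : Measure Space)),
      Compatible P (specialData f g₂ g₃) → IsLinearSolution P (specialData f g₂ g₃) U →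
      (∀ a, ContinuousOn (V a) (Set.Ici 0)) →
      (∀ a t, 0 ≤ t → (U t).comp a = Lp.toTemperedDistribution (V a t)) → ∀ t, 0 ≤ t →
      (∀ Φ : Space → ℝ, ∀ᵐ k,
        (∀ α, ‖hat (fun b => V b 0) k (Sum.inl α)‖ ≤ freq k * Φ k) → freq k ≤ ρ →
        ∀ a, ‖hat (fun b => V b t) k a‖ ≤
          K * (freq k ^ decayOrder a * Real.exp (-lam * freq k ^ 2 * t) *
            (∑ b, ‖hat (fun b => V b 0) k b‖ + Φ k) +
              Real.exp (-lam * t) * ∑ b, ‖hat (fun b => V b 0) k b‖)) ∧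
      (∀ᵐ k, freq k ≤ ρ → ∀ j, ‖hat (fun b => V b t) k (Sum.inr (Sum.inr (Sum.inr j)))‖ ≤
          K * (freq k * Real.exp (-lam * freq k ^ 2 * t) *
            ∑ b, ‖hat (fun b => V b 0) k b‖ +
              Real.exp (-lam * t) * ∑ b, ‖hat (fun b => V b 0) k b‖)) ∧
      (∀ᵐ k, ρ ≤ freq k → ∀ a, ‖hat (fun b => V b t) k a‖ ≤
          K' * Real.exp (-(lam' * (freq k)⁻¹ ^ 2) * t) *
            ∑ b, ‖hat (fun b => V b 0) k b‖) := by
  obtain ⟨ρ, lam, K, hρ, hlam, hK, hlow⟩ := low_mode_decay P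
  obtain ⟨lam', K', hlam', hK', hhigh⟩ := high_mode_decay P hρ
  refine ⟨ρ, lam, lam', K, K', hρ, hlam, hlam', hK, hK',
    fun f g₂ g₃ U V hc hU hVc hV t ht => ?_⟩
  have hV0 : ∀ a, (specialData f g₂ g₃).comp a = Lp.toTemperedDistribution (V a 0) := fun a => by
    rw [← hU.initial]; exact hV a 0 le_rfl
  have hmode := ae_isMode hV0 hc
  have hexp := hat_eq_exp hU hVc hV ht
  have hne : ∀ᵐ k : Space, k ≠ 0 := by simp [ae_iff]
  refine ⟨fun Φ => ?_, ?_, ?_⟩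
  · filter_upwards [hmode, hexp, hne] with k hm he hk hΦ hkρ a
    have h0 := exp_zero_smul_apply (symbol P k) (hat (fun b => V b 0) k)
    have h1 := hlow _ _ _ (isDirection_xi hk) hkρ _ hm (Φ k) (by simpa only [h0] using hΦ) t ht
    simp only [h0, ← he] at h1
    obtain ⟨hr, hu, hE, hB⟩ := h1
    have hΦ0 : 0 ≤ Φ k := by
      have h3 := (norm_nonneg _).trans (hΦ Species.ion)
      exact nonneg_of_mul_nonneg_right h3 (isDirection_xi hk).pos
    rcases a with α | ⟨α, j⟩ | j | j
    · simpa only [decayOrder, pow_one] using hr α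
    · simp only [modeU, ← he] at hu
      simpa only [decayOrder] using hu α j
    · simp only [modeE, ← he] at hE
      simpa only [decayOrder] using hE j
    · simp only [modeB, ← he] at hB
      refine (hB j).trans ?_
      have h4 := freq_nonneg k
      simp only [decayOrder, pow_one]
      gcongr
      exact le_add_of_nonneg_right hΦ0
  · filter_upwards [hmode, hexp, hne] with k hm he hk hkρ j
    have h0 := exp_zero_smul_apply (symbol P k) (hat (fun b => V b 0) k)
    have hpos := (isDirection_xi hk).pos
    have h1 := hlow _ _ _ (isDirection_xi hk) hkρ _ hm
      -- Any bound of the densities by κF will do: the value chosen here has no useful size as κ →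
      -- 0, but the magnetic estimate does not contain it.
      (∑ α, ‖hat (fun b => V b 0) k (Sum.inl α)‖ / freq k) (fun α => by
        simp only [h0]
        rw [← Finset.sum_div, mul_div_cancel₀ _ hpos.ne']
        exact Finset.single_le_sum (f := fun α => ‖hat (fun b => V b 0) k (Sum.inl α)‖)
          (fun _ _ => norm_nonneg _) (Finset.mem_univ α)) t ht
    have h2 := h1.2.2.2 j
    simpa only [modeB, h0, ← he] using h2
  · filter_upwards [hmode, hexp, hne] with k hm he hk hkρ a
    have h0 := exp_zero_smul_apply (symbol P k) (hat (fun b => V b 0) k)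
    have h1 := hhigh _ _ _ (isDirection_xi hk) hkρ _ hm t ht a
    simpa only [h0, ← he] using h1

/-- Components of solutions with special data satisfy the asserted bounds. -/
lemma exists_solution_bound (P : Params) : ∃ lam : ℝ, 0 < lam ∧
    ∀ (m : ℕ) (p r q : ℝ≥0∞) (l : ℝ), 1 ≤ p → p ≤ 2 → 1 ≤ r → r ≤ 2 → 2 ≤ q → 0 ≤ l →
    ∃ C : ℝ≥0∞, C ≠ ⊤ ∧ ∀ (f g₂ : Species → Fin 3 → Dist) (g₃ : Fin 3 → Dist) (U : ℝ → State),
      Compatible P (specialData f g₂ g₃) → IsLinearSolution P (specialData f g₂ g₃) U →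
      lpNorm p (specialData f g₂ g₃).comp ≠ ⊤ →
      lpNorm r (nablaPow (m + regIndex l r q) (specialData f g₂ g₃).comp) ≠ ⊤ →
      ∀ t : ℝ, 0 ≤ t → ∀ (N₁ : ℝ≥0∞) (a : Component),
        ((∃ j, a = Sum.inr (Sum.inr (Sum.inr j))) ∧ N₁ = 0 ∨
          lpNorm p (Function.uncurry f) ≠ ⊤ ∧ N₁ = lpNorm p (Function.uncurry f)) →
        ∀ β : Fin m → Fin 3, ∃ W : Lp ℂ 2 (volume : Measure Space),
          ∂^{fun i => basisVec (β i)} ((U t).comp a) = Lp.toTemperedDistribution W ∧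
          eLpNorm W q volume ≤ C * (polyRate p q (m + decayOrder a) t *
              (lpNorm p (specialData f g₂ g₃).comp + N₁) +
            expRate lam t * lpNorm p (specialData f g₂ g₃).comp +
            regLossRate l t *
              lpNorm r (nablaPow (m + regIndex l r q) (specialData f g₂ g₃).comp)) := by
  obtain ⟨ρ, lam, lam', K, K', hρ, hlam, hlam', hK, hK', hb⟩ := exists_hat_bound P
  refine ⟨lam, hlam, fun m p r q l hp1 hp2 hr1 hr2 hq hl => ?_⟩
  have hqq0 : ENNReal.HolderConjugate q (1 - q⁻¹)⁻¹ :=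
    ENNReal.HolderConjugate.inv_one_sub_inv' (one_le_two.trans hq)
  set q' := (1 - q⁻¹)⁻¹
  have hqq : ENNReal.HolderConjugate q' q := hqq0.symm
  obtain ⟨s, s', hs, hs', hM⟩ := exists_high_exponents (q' := q') hr1 hr2 hq hl
  set M := m + regIndex l r q with hMdef
  choose C hC hbound using fun j => exists_component_bound (p := p) hq hs hs' hl (hM m) j hlam hlam'
    hρ hK.le hK'.le
  set D : ℝ≥0∞ := Fintype.card Component + Fintype.card (Component × (Fin M → Fin 3)) +
    Fintype.card (Species × Fin 3) with hD
  have hDt : D ≠ ⊤ := by finiteness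
  refine ⟨(C 1 + C 2) * D, ENNReal.mul_ne_top (ENNReal.add_ne_top.2 ⟨hC 1, hC 2⟩) hDt,
    fun f g₂ g₃ U hc hU hN hA t ht N₁ a ha β => ?_⟩
  obtain ⟨V, hVV⟩ := hU.continuous_L2
  have hVc := fun a => (hVV a).1
  have hV := fun a => (hVV a).2
  obtain ⟨b1, b2, b3⟩ := hb f g₂ g₃ U V hc hU hVc hV t ht
  have hV0 : ∀ a, (specialData f g₂ g₃).comp a = Lp.toTemperedDistribution (V a 0) := fun a => by
    rw [← hU.initial]; exact hV a 0 le_rfl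
  set n := lpNorm p (specialData f g₂ g₃).comp with hn
  set A := lpNorm r (nablaPow M (specialData f g₂ g₃).comp) with hAd
  have hH := gaussBound_hat hp1 hp2 hV0 hN
  have hHA := gaussBound_freq_pow_mul_hat hr1 hr2 hV0 hA
  set H : Space → ℝ := fun k => ∑ b, ‖hat (fun b => V b 0) k b‖ with hHd
  have hH0 : ∀ k, 0 ≤ H k := fun k => Finset.sum_nonneg fun _ _ => norm_nonneg _
  have hAt : (∑ _ : Component × (Fin M → Fin 3), A) ≠ ⊤ := by
    rw [Finset.sum_const, nsmul_eq_mul]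
    exact ENNReal.mul_ne_top (ENNReal.natCast_ne_top _) hA
  have hCa : C (decayOrder a) ≤ C 1 + C 2 := by
    rcases a with α | ⟨α, j⟩ | j | j
    exacts [le_self_add, le_add_self, le_add_self, le_self_add]
  obtain ⟨H₁, hH₁, hlow⟩ : ∃ H₁ : Space → ℝ, GaussBound p H₁ (D * (n + N₁)) ∧
      ∀ᵐ k, freq k ≤ ρ → ‖hat (fun b => V b t) k a‖ ≤
        K * (freq k ^ decayOrder a * Real.exp (-lam * freq k ^ 2 * t) * H₁ k +
          Real.exp (-lam * t) * H k) := by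
    -- For magnetic components the low-frequency majorant is the data alone; for the others the flux
    -- majorant is added, which needs a finite L^p norm of f.
    rcases ha with ⟨⟨j, rfl⟩, -⟩ | ⟨hf, rfl⟩
    · refine ⟨H, hH.mono hH.1 (.of_forall fun k => le_rfl) ?_, b2.mono fun k hk h => ?_⟩
      · rw [Finset.sum_const, nsmul_eq_mul]
        exact mul_le_mul' ((le_self_add.trans le_self_add)) le_self_add
      · simpa only [decayOrder, pow_one] using hk h j
    · obtain ⟨Φ, hΦ, hΦb⟩ := exists_flux_bound hp1 hp2 hV0 hf
      have hsum := GaussBound.sum (ι := Bool) (H := fun b => if b then H else Φ)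
        (N := fun b => if b then ∑ _ : Component, n else
          ∑ _ : Species × Fin 3, lpNorm p (Function.uncurry f))
        (fun b => by cases b; exacts [hΦ, hH])
      refine ⟨fun k => H k + Φ k, ?_, ?_⟩
      · refine hsum.mono (hH.1.add hΦ.1) (.of_forall fun k => by simp) ?_
        simp only [Fintype.sum_bool, if_true, Bool.false_eq_true, if_false, Finset.sum_const,
          nsmul_eq_mul, mul_add]
        exact add_le_add (mul_le_mul' (le_self_add.trans le_self_add) le_rfl)
          (mul_le_mul' le_add_self le_rfl)
      · filter_upwards [b1 Φ, hΦb] with k hk hk' h using hk hk' h a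
  obtain ⟨W, hW, hWb⟩ := hbound (decayOrder a) (V a t) H H₁ _ _ _ t ht hH hH₁ hHA hAt hH0 hlow
    (b3.mono fun k hk h => hk h a) β
  refine ⟨W, by rw [hV a t ht]; exact hW, hWb.trans ?_⟩
  simp only [Finset.sum_const, nsmul_eq_mul, Finset.card_univ]
  rw [mul_assoc (C 1 + C 2)]
  refine mul_le_mul' hCa ?_
  rw [mul_add D _ (regLossRate l t * A), mul_add D _ (expRate lam t * n)]
  refine add_le_add (add_le_add (mul_left_comm (_ : ℝ≥0∞) _ _).le ?_) ?_
  · rw [mul_left_comm D]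
    exact mul_le_mul' le_rfl (mul_le_mul' (le_self_add.trans le_self_add) le_rfl)
  · rw [mul_left_comm D]
    exact mul_le_mul' le_rfl (mul_le_mul' (le_add_self.trans le_self_add) le_rfl)

lemma polyRate_ne_zero (p q : ℝ≥0∞) (k : ℕ) {t : ℝ} (ht : 0 ≤ t) : polyRate p q k t ≠ 0 :=
  (ENNReal.ofReal_pos.2 (Real.rpow_pos_of_pos (by linarith) _)).ne'

lemma regLossRate_ne_zero (l : ℝ) {t : ℝ} (ht : 0 ≤ t) : regLossRate l t ≠ 0 :=
  (ENNReal.ofReal_pos.2 (Real.rpow_pos_of_pos (by linarith) _)).ne'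

/-- If all derivatives of order `m` of the members of a family have representatives bounded in
`L^q` by `X`, then so is their joint `L^q` norm, up to the number of components. -/
lemma lpNorm_nablaPow_le {ι : Type} [Fintype ι] {q X : ℝ≥0∞} (hq : 1 ≤ q) (hX : X ≠ ⊤) {m : ℕ}
    {F : ι → Dist}
    (h : ∀ i (β : Fin m → Fin 3), ∃ W : Lp ℂ 2 (volume : Measure Space),
      ∂^{fun j => basisVec (β j)} (F i) = Lp.toTemperedDistribution W ∧ eLpNorm W q volume ≤ X) :
    lpNorm q (nablaPow m F) ≤ Fintype.card (ι × (Fin m → Fin 3)) * X := by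
  choose W hW hb using h
  exact lpNorm_le_sum (W := fun a : ι × (Fin m → Fin 3) => W a.1 a.2) hq hX
    (fun a => hW a.1 a.2) fun a => hb a.1 a.2

/-- The added 1 keeps the real constant positive even when `C` vanishes. -/
lemma card_mul_le_ofReal {k k' : ℕ} (hk : k ≤ k') {C : ℝ≥0∞} (hC : C ≠ ⊤) (Y : ℝ≥0∞) :
    (k : ℝ≥0∞) * (C * Y) ≤ ENNReal.ofReal (k' * C.toReal + 1) * Y := by
  rw [← mul_assoc]
  refine mul_le_mul' ?_ le_rfl
  rw [ENNReal.ofReal_add (by positivity) zero_le_one,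
    ENNReal.ofReal_mul (Nat.cast_nonneg _), ENNReal.ofReal_natCast, ENNReal.ofReal_toReal hC]
  exact (mul_le_mul' (Nat.cast_le.2 hk) le_rfl).trans le_self_add

end EulerMaxwell

/-! ### Assembly of the four estimates. -/

open EulerMaxwell in
theorem theorem4p3 (P : Params) :
    ∃ lam : ℝ, 0 < lam ∧
    ∀ (m : ℕ) (p r q : ℝ≥0∞) (ℓ : ℝ), 1 ≤ m → 1 ≤ p → p ≤ 2 → 1 ≤ r → r ≤ 2 → 2 ≤ q → 0 ≤ ℓ →
    ∃ C : ℝ, 0 < C ∧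
    ∀ (f g₂ : Species → Fin 3 → Dist) (g₃ : Fin 3 → Dist) (N₀ : State) (U : ℝ → State),
      N₀ = specialData f g₂ g₃ → Compatible P N₀ → IsLinearSolution P N₀ U →
      ∀ t : ℝ, 0 ≤ t →
        (∀ α, lpNorm q (nablaPow m (fun _ : Unit => (U t).rho α)) ≤
          ENNReal.ofReal C *
            (polyRate p q (m + 1) t * lpNorm p N₀.comp
              + expRate lam t * lpNorm p N₀.comp
              + regLossRate ℓ t * lpNorm r (nablaPow (m + regIndex ℓ r q) N₀.comp)
              + expRate lam t * lpNorm r (nablaPow (m + 1 + regIndex 0 r q) (Function.uncurry f))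
              + polyRate p q (m + 1) t * lpNorm p (Function.uncurry f))) ∧
        (∀ α, lpNorm q (nablaPow m ((U t).u α)) ≤
          ENNReal.ofReal C *
            (polyRate p q (m + 2) t * lpNorm p N₀.comp
              + expRate lam t * lpNorm p N₀.comp
              + regLossRate ℓ t * lpNorm r (nablaPow (m + regIndex ℓ r q) N₀.comp)
              + expRate lam t * lpNorm r (nablaPow (m + 2 + regIndex 0 r q) (Function.uncurry f))
              + polyRate p q (m + 2) t * lpNorm p (Function.uncurry f))) ∧
        (lpNorm q (nablaPow m (U t).E) ≤
          ENNReal.ofReal C *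
            (polyRate p q (m + 2) t * lpNorm p N₀.comp
              + expRate lam t * lpNorm p N₀.comp
              + regLossRate ℓ t * lpNorm r (nablaPow (m + regIndex ℓ r q) N₀.comp)
              + expRate lam t * lpNorm r (nablaPow (m + 2 + regIndex 0 r q) (Function.uncurry f))
              + polyRate p q (m + 2) t * lpNorm p (Function.uncurry f))) ∧
        (lpNorm q (nablaPow m (U t).B) ≤
          ENNReal.ofReal C *
            (polyRate p q (m + 1) t * lpNorm p N₀.comp
              + expRate lam t * lpNorm p N₀.comp
              + regLossRate ℓ t * lpNorm r (nablaPow (m + regIndex ℓ r q) N₀.comp))) := by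
  obtain ⟨lam, hlam, hmain⟩ := exists_solution_bound P
  refine ⟨lam, hlam, fun m p r q ℓ _ hp1 hp2 hr1 hr2 hq hℓ => ?_⟩
  obtain ⟨C, hC, hb⟩ := hmain m p r q ℓ hp1 hp2 hr1 hr2 hq hℓ
  set k' := Fintype.card (Fin 3 × (Fin m → Fin 3)) with hk'
  have hC0 : 0 < k' * C.toReal + 1 := by positivity
  have hCne : ENNReal.ofReal (k' * C.toReal + 1) ≠ 0 := (ENNReal.ofReal_pos.2 hC0).ne'
  refine ⟨k' * C.toReal + 1, hC0, fun f g₂ g₃ N₀ U hN₀ hc hU t ht => ?_⟩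
  subst hN₀
  have hq1 : 1 ≤ q := one_le_two.trans hq
  set n := lpNorm p (specialData f g₂ g₃).comp with hn
  set A := lpNorm r (nablaPow (m + regIndex ℓ r q) (specialData f g₂ g₃).comp) with hA
  have hpt : ∀ k, polyRate p q k t ≠ ⊤ := fun _ => ENNReal.ofReal_ne_top
  have het : expRate lam t ≠ ⊤ := ENNReal.ofReal_ne_top
  have hrt : regLossRate ℓ t ≠ ⊤ := ENNReal.ofReal_ne_top
  have bound : ∀ {ι : Type} [Fintype ι] (F : ι → Component) (d : ℕ) (N₁ : ℝ≥0∞),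
      Fintype.card (ι × (Fin m → Fin 3)) ≤ k' → (∀ i, decayOrder (F i) = d) →
      (∀ i, (∃ j, F i = Sum.inr (Sum.inr (Sum.inr j))) ∧ N₁ = 0 ∨
        N₁ = lpNorm p (Function.uncurry f)) →
      lpNorm q (nablaPow m fun i => (U t).comp (F i)) ≤ ENNReal.ofReal (k' * C.toReal + 1) *
        (polyRate p q (m + d) t * (n + N₁) + expRate lam t * n + regLossRate ℓ t * A) := by
    intro ι _ F d N₁ hcard hd hF
    -- An infinite norm of the data makes the right-hand side infinite, because every rate is
    -- nonzero at finite time. The analytic estimate is needed only for finite norms.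
    by_cases hnt : n = ⊤
    · simp [hnt, ENNReal.mul_top, polyRate_ne_zero p q (m + d) ht, hCne]
    by_cases hAt : A = ⊤
    · simp [hAt, ENNReal.mul_top, regLossRate_ne_zero ℓ ht, hCne]
    by_cases hNt : N₁ = ⊤
    · simp [hNt, ENNReal.mul_top, polyRate_ne_zero p q (m + d) ht, hCne]
    refine (lpNorm_nablaPow_le (X := C * (polyRate p q (m + d) t * (n + N₁) + expRate lam t * n
      + regLossRate ℓ t * A)) hq1 ?_ fun i β => ?_).trans (card_mul_le_ofReal hcard hC _)
    · have := hpt (m + d)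
      finiteness
    · obtain ⟨W, hW, hWb⟩ := hb f g₂ g₃ U hc hU hnt hAt t ht N₁ (F i)
        ((hF i).imp_right fun h : N₁ = _ => ⟨h.symm.trans_ne hNt, h⟩) β
      exact ⟨W, hW, by rwa [hd i] at hWb⟩
  -- `Z` is the exponentially decaying term with derivatives of f; it enters only as a nonnegative
  -- summand added to a bound already proved.
  have combine : ∀ (d : ℕ) (Z : ℝ≥0∞), ENNReal.ofReal (k' * C.toReal + 1) *
        (polyRate p q (m + d) t * (n + lpNorm p (Function.uncurry f)) + expRate lam t * n
          + regLossRate ℓ t * A) ≤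
      ENNReal.ofReal (k' * C.toReal + 1) * (polyRate p q (m + d) t * n + expRate lam t * n
        + regLossRate ℓ t * A + Z + polyRate p q (m + d) t * lpNorm p (Function.uncurry f)) :=
    fun d Z => mul_le_mul' le_rfl <| by
      rw [show polyRate p q (m + d) t * (n + lpNorm p (Function.uncurry f)) + expRate lam t * n
          + regLossRate ℓ t * A = polyRate p q (m + d) t * n + expRate lam t * n
          + regLossRate ℓ t * A + polyRate p q (m + d) t * lpNorm p (Function.uncurry f) by ring]
      exact add_le_add le_self_add le_rfl
  refine ⟨fun α => ?_, fun α => ?_, ?_, ?_⟩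
  · refine (bound (fun _ : Unit => Sum.inl α) 1 _ ?_ (fun _ => rfl) fun _ => .inr rfl).trans
      (combine 1 _)
    rw [hk', Fintype.card_prod, Fintype.card_prod]
    exact Nat.mul_le_mul_right _ (by simp)
  · exact (bound (fun j : Fin 3 => Sum.inr (Sum.inl (α, j))) 2 _ le_rfl (fun _ => rfl)
      fun _ => .inr rfl).trans (combine 2 _)
  · exact (bound (fun j : Fin 3 => Sum.inr (Sum.inr (Sum.inl j))) 2 _ le_rfl (fun _ => rfl)
      fun _ => .inr rfl).trans (combine 2 _)
  · have := bound (fun j : Fin 3 => Sum.inr (Sum.inr (Sum.inr j))) 1 0 le_rfl (fun _ => rfl)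
      fun j => .inl ⟨⟨j, rfl⟩, rfl⟩
    rwa [add_zero] at this
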